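/- Let $\mathbf k$ be an algebraically closed field of characteristic $0$ and $H$ a cocommutative Hopf algebra over $\mathbf k$ with coproduct $\Delta$, antipode $S$ and flip $\sigma(f\otimes g)=g\otimes f$. For a left $H$-module $M$, $H^{\otimes n}\otimes_H M$ is formed with $H$ acting on $H^{\otimes n}$ from the right through the iterated coproduct; $\mathbf k$ is an $H$-module through the counit, and $M\otimes M$ through $\Delta$. A Lie pseudoalgebra is a left $H$-module $L$ with an $H\otimes H$-linear map $L\otimes L\to (H\otimes H)\otimes_H L$, $a\otimes b\mapsto[a*b]$, such that $[b*a]=-(\sigma\otimes_H\mathrm{id})[a*b]$ and $[a*[b*c]]-((\sigma\otimes\mathrm{id})\otimes_H\mathrm{id})[b*[a*c]]=[[a*b]*c]$ in $H^{\otimes3}\otimes_H L$, where for $[a*b]=\sum(f_i\otimes g_i)\otimes_H e_i$ and $[e_i*c]=\sum(f_{ij}\otimes g_{ij})\otimes_H e_{ij}$ one puts $[[a*b]*c]=\sum(f_i f_{ij(1)}\otimes g_i f_{ij(2)}\otimes g_{ij})\otimes_H e_{ij}$, and for $[b*c]=\sum (h_i\otimes l_i)\otimes_H d_i$ and $[a*d_i]=\sum(h_{ij}\otimes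 l_{ij})\otimes_H d_{ij}$ one puts $[a*[b*c]]=\sum(h_{ij}\otimes h_il_{ij(1)}\otimes l_il_{ij(2)})\otimes_H d_{ij}$. A pseudosubalgebra is an $H$-submodule $N$ with $[N*N]\subset(H\otimes H)\otimes_H N$. A Lie pseudo-bialgebra structure on a Lie pseudoalgebra $L$ is an $H$-linear map $\delta:L\to\wedge^2L\subset L\otimes L$ with $(\mathrm{id}\otimes\delta)\delta-\tau_{12}(\mathrm{id}\otimes\delta)\delta=(\delta\otimes\mathrm{id})\delta$ and $a*\delta(b)-(\sigma\otimes_H\mathrm{id})(b*\delta(a))=(\mathrm{id}\otimes_H\delta)[a*b]$ for all $a,b\in L$. Here $a*(m\otimes n)=\sum_i(h_i\otimes1)\otimes_H(m_i\otimes n)+\sum_j(l_j\otimes1)\otimes_H(m\otimes n_j)$ if $[a*m]=\sum_i(h_i\otimes1)\otimes_H m_i$ and $[a*n]=\sum_j(l_j\otimes1)\otimes_H n_j$. The dual $V^*$ of an $H$-module $V$ is the space of $\mathbf k$-linear maps $\phi:V\to(H\otimes H)\otimes_H\mathbf k$ with $\phi(hv)=(1\otimes h)\phi(v)$, with the $H$-action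 $(h\phi)(v)=(h\otimes1)\phi(v)$. A bilinear pseudo-form on $V$ is an $H\otimes H$-linear map $\langle\,,\rangle:V\otimes V\to(H\otimes H)\otimes_H\mathbf k$. It is symmetric if $\langle v,w\rangle=(\sigma\otimes_H\mathrm{id})\langle w,v\rangle$, non-degenerate if $V\to V^*$, $v\mapsto\langle v,\cdot\rangle$, is an isomorphism, and (on a Lie pseudoalgebra) invariant if $\langle[a*b],c\rangle=\langle a,[b*c]\rangle$ in $H^{\otimes 3}\otimes_H\mathbf k$, with the above composition rules. A pseudo Manin triple $(R,R_1,R_0)$ is a Lie pseudoalgebra $R$, finitely generated over $H$, with a non-degenerate invariant symmetric bilinear pseudo-form and pseudosubalgebras $R_1,R_0$ such that $R=R_1\oplus R_0$ as an $H$-module and $\langle R_i,R_i\rangle=0$ for $i=0,1$. Theorem. Let $L$ be a Lie pseudoalgebra that is free of finite rank over $H$. There is a map $\delta\mapsto D(\delta)$ from the Lie pseudo-bialgebra structures on $L$ to the pseudo Manin triples $(R,R_1,R_0)$ with $R_1=L$, and it induces a bijection onto the isomorphism classes of such triples (isomorphisms of Lie pseudoalgebras that preserve the form and $R_0$ and are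 the identity on $L$). Moreover $D(\delta)=(L\oplus L^*,L,L^*)$ with the form $$\langle a+f,b+g\rangle=f(b)+(\sigma\otimes_H\mathrm{id})\,g(a)\qquad(a,b\in L,\ f,g\in L^*).$$ The bracket of $D(\delta)$ restricts on $L$ to the given bracket, and on $L^*$ to the bracket dual to $\delta$, which is the unique Lie pseudoalgebra structure on $L^*$ such that, for every $H$-basis $(e_i)$ of $L$ with dual basis $(e_i^*)$ (that is, $e_i^*(e_j)=(1\otimes1)\otimes_H\delta_{ij}$), if $[e_i^**e_j^*]=\sum_l x^{ij}_l\otimes_H e_l^*$ with $x^{ij}_l\in H\otimes H$, then $\delta(e_l)=\sum_{i,j}\big((S\otimes S)x^{ij}_l\big)(e_i\otimes e_j)$. The bracket of $D(\delta)$ is the only skew-symmetric $H\otimes H$-linear pseudobracket on $L\oplus L^*$ that restricts to these brackets on $L$ and $L^*$ and for which the form is invariant. -/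

import Mathlib

open scoped TensorProduct

namespace Pseudo

set_option linter.unusedSectionVars false

universe u v w x y z t

noncomputable section

/-! ### The tensor product over a noncommutative algebra

For an algebra map `θ : H → A` and a left `H`-module `M`, `BaseTensor θ M` is `A ⊗_H M`, where
`H` acts on `A` from the right through `θ`. It is a left `A`-module. -/

section BaseTensor

variable {k : Type u} {H : Type v} {A : Type w} {B : Type x} [Field k] [Ring H] [Algebra k H]
  [Ring A] [Algebra k A] [Ring B] [Algebra k B]

/-- The relations `x θ(h) ⊗ m = x ⊗ h m`. -/
def baseRel (θ : H →ₐ[k] A) (M : Type y) [AddCommGroup M] [Module k M] [Module H M] :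
    Submodule A (A ⊗[k] M) :=
  Submodule.span A
    {s | ∃ (a : A) (h : H) (m : M), s = (a * θ h) ⊗ₜ[k] m - a ⊗ₜ[k] (h • m)}

/-- `A ⊗_H M`. -/
def BaseTensor (θ : H →ₐ[k] A) (M : Type y) [AddCommGroup M] [Module k M] [Module H M] :
    Type (max w y) :=
  (A ⊗[k] M) ⧸ baseRel θ M

variable (θ : H →ₐ[k] A) (M : Type y) [AddCommGroup M] [Module k M] [Module H M]

instance : AddCommGroup (BaseTensor θ M) :=
  inferInstanceAs (AddCommGroup ((A ⊗[k] M) ⧸ baseRel θ M))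

instance : Module A (BaseTensor θ M) :=
  inferInstanceAs (Module A ((A ⊗[k] M) ⧸ baseRel θ M))

instance : Module k (BaseTensor θ M) :=
  inferInstanceAs (Module k ((A ⊗[k] M) ⧸ baseRel θ M))

instance : IsScalarTower k A (BaseTensor θ M) :=
  inferInstanceAs (IsScalarTower k A ((A ⊗[k] M) ⧸ baseRel θ M))

instance : SMulCommClass k A (BaseTensor θ M) := IsScalarTower.to_smulCommClass

/-- The quotient map `A ⊗ M → A ⊗_H M`. -/
def BaseTensor.mkQ : (A ⊗[k] M) →ₗ[A] BaseTensor θ M := (baseRel θ M).mkQ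

/-- The bilinear map `(a, m) ↦ a ⊗_H m`. -/
def BaseTensor.tmulₗ : A →ₗ[k] M →ₗ[k] BaseTensor θ M :=
  (TensorProduct.mk k A M).compr₂ ((BaseTensor.mkQ θ M).restrictScalars k)

variable {M}

/-- The element `a ⊗_H m`. -/
def BaseTensor.tmul (a : A) (m : M) : BaseTensor θ M := BaseTensor.mkQ θ M (a ⊗ₜ[k] m)

theorem BaseTensor.smul_tmul (b a : A) (m : M) :
    b • BaseTensor.tmul θ a m = BaseTensor.tmul θ (b * a) m := by
  unfold BaseTensor.tmul
  rw [← map_smul, TensorProduct.smul_tmul', smul_eq_mul]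

theorem BaseTensor.mul_tmul (a : A) (h : H) (m : M) :
    BaseTensor.tmul θ (a * θ h) m = BaseTensor.tmul θ a (h • m) :=
  (Submodule.Quotient.eq (baseRel θ M)).2 (Submodule.subset_span ⟨a, h, m, rfl⟩)

variable {P : Type z} [AddCommGroup P] [Module k P]

theorem baseRel_le_ker (f : A →ₗ[k] M →ₗ[k] P)
    (hf : ∀ a h m, f (a * θ h) m = f a (h • m)) :
    (baseRel θ M).restrictScalars k ≤ LinearMap.ker (TensorProduct.lift f) := by
  have key : ∀ s ∈ baseRel θ M, ∀ a : A, TensorProduct.lift f (a • s) = 0 := by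
    intro s hs
    refine Submodule.span_induction ?_ ?_ ?_ ?_ hs
    · rintro _ ⟨b, h, m, rfl⟩ a
      rw [smul_sub, TensorProduct.smul_tmul', TensorProduct.smul_tmul', map_sub,
        TensorProduct.lift.tmul, TensorProduct.lift.tmul, smul_eq_mul, smul_eq_mul,
        ← mul_assoc, hf, sub_self]
    · intro a
      rw [smul_zero, map_zero]
    · intro s₁ s₂ _ _ h₁ h₂ a
      rw [smul_add, map_add, h₁, h₂, add_zero]
    · intro b s₁ _ h₁ a
      rw [← mul_smul]
      exact h₁ (a * b)
  intro s hs
  have := key s hs 1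
  rwa [one_smul] at this

/-- The map on `A ⊗_H M` induced by an `H`-balanced bilinear map. -/
def BaseTensor.lift (f : A →ₗ[k] M →ₗ[k] P) (hf : ∀ a h m, f (a * θ h) m = f a (h • m)) :
    BaseTensor θ M →ₗ[k] P :=
  (((baseRel θ M).restrictScalars k).liftQ (TensorProduct.lift f) (baseRel_le_ker θ f hf)) ∘ₗ
    (Submodule.Quotient.restrictScalarsEquiv k (baseRel θ M)).symm.toLinearMap

theorem BaseTensor.lift_tmul (f : A →ₗ[k] M →ₗ[k] P)
    (hf : ∀ a h m, f (a * θ h) m = f a (h • m)) (a : A) (m : M) :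
    BaseTensor.lift θ f hf (BaseTensor.tmul θ a m) = f a m :=
  TensorProduct.lift.tmul a m

theorem BaseTensor.induction {p : BaseTensor θ M → Prop} (s : BaseTensor θ M)
    (h0 : p 0) (ht : ∀ a m, p (BaseTensor.tmul θ a m)) (ha : ∀ s t, p s → p t → p (s + t)) :
    p s := by
  obtain ⟨s, rfl⟩ := Submodule.mkQ_surjective (baseRel θ M) s
  induction s using TensorProduct.induction_on with
  | zero => rw [map_zero]; exact h0
  | tmul a m => exact ht a m
  | add s₁ s₂ h₁ h₂ => rw [map_add]; exact ha _ _ h₁ h₂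

/-- `a ⊗_H m ↦ α(a) ⊗_H g(m)`, for an algebra map `α` compatible with the two maps from `H` and
an `H`-linear map `g`. -/
def BaseTensor.map {N : Type z} [AddCommGroup N] [Module k N] [Module H N]
    [IsScalarTower k H M] [IsScalarTower k H N] {η : H →ₐ[k] B}
    (α : A →ₐ[k] B) (hα : ∀ h, α (θ h) = η h) (g : M →ₗ[H] N) :
    BaseTensor θ M →ₗ[k] BaseTensor η N :=
  BaseTensor.lift θ
    ((BaseTensor.tmulₗ η N).compl₁₂ α.toLinearMap (g.restrictScalars k))
    (fun a h m => by
      change BaseTensor.tmul η (α (a * θ h)) (g m) = BaseTensor.tmul η (α a) (g (h • m))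
      rw [map_mul, hα, BaseTensor.mul_tmul, map_smul])

theorem BaseTensor.map_tmul {N : Type z} [AddCommGroup N] [Module k N] [Module H N]
    [IsScalarTower k H M] [IsScalarTower k H N] {η : H →ₐ[k] B}
    (α : A →ₐ[k] B) (hα : ∀ h, α (θ h) = η h) (g : M →ₗ[H] N) (a : A) (m : M) :
    BaseTensor.map θ α hα g (BaseTensor.tmul θ a m) = BaseTensor.tmul η (α a) (g m) :=
  BaseTensor.lift_tmul θ _ _ a m

theorem BaseTensor.map_smul {N : Type z} [AddCommGroup N] [Module k N] [Module H N]
    [IsScalarTower k H M] [IsScalarTower k H N] {η : H →ₐ[k] B}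
    (α : A →ₐ[k] B) (hα : ∀ h, α (θ h) = η h) (g : M →ₗ[H] N) (a : A) (s : BaseTensor θ M) :
    BaseTensor.map θ α hα g (a • s) = α a • BaseTensor.map θ α hα g s := by
  induction s using BaseTensor.induction with
  | h0 => simp
  | ht b m => rw [BaseTensor.smul_tmul, BaseTensor.map_tmul, BaseTensor.map_tmul,
      BaseTensor.smul_tmul, map_mul]
  | ha s t hs ht => rw [smul_add, map_add, hs, ht, map_add, smul_add]

theorem BaseTensor.id_comp (h : H) : AlgHom.id k A (θ h) = θ h := rfl

theorem BaseTensor.map_id [IsScalarTower k H M] (s : BaseTensor θ M) :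
    BaseTensor.map θ (AlgHom.id k A) (BaseTensor.id_comp θ) (LinearMap.id : M →ₗ[H] M) s = s := by
  induction s using BaseTensor.induction with
  | h0 => simp
  | ht b m => rw [BaseTensor.map_tmul]; rfl
  | ha s t hs ht => rw [map_add, hs, ht]

end BaseTensor

/-! ### Tensor powers of a cocommutative Hopf algebra -/

section Powers

variable (k : Type u) (H : Type v) [Field k] [Ring H] [HopfAlgebra k H]

/-- `H ⊗ H`. -/
abbrev H2 : Type v := H ⊗[k] H

/-- `H ⊗ H ⊗ H`. -/
abbrev H3 : Type v := H ⊗[k] (H ⊗[k] H)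

/-- `Δ : H → H ⊗ H`. -/
abbrev comul2 : H →ₐ[k] H2 k H := Bialgebra.comulAlgHom k H

/-- `id ⊗ Δ : H ⊗ H → H ⊗ H ⊗ H`. -/
def idComul : H2 k H →ₐ[k] H3 k H := Algebra.TensorProduct.map (AlgHom.id k H) (comul2 k H)

/-- `Δ ⊗ id : H ⊗ H → H ⊗ H ⊗ H`. -/
def comulId : H2 k H →ₐ[k] H3 k H :=
  (Algebra.TensorProduct.assoc k k k H H H).toAlgHom.comp
    (Algebra.TensorProduct.map (comul2 k H) (AlgHom.id k H))

/-- The iterated comultiplication `H → H ⊗ H ⊗ H`. -/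
def comul3 : H →ₐ[k] H3 k H := (idComul k H).comp (comul2 k H)

theorem comulId_comul (h : H) : comulId k H (comul2 k H h) = comul3 k H h :=
  Coalgebra.coassoc_apply h

theorem idComul_comul (h : H) : idComul k H (comul2 k H h) = comul3 k H h := rfl

/-- `x ↦ x ⊗ 1`, from `H ⊗ H` to `H ⊗ H ⊗ H`. -/
def incl12 : H2 k H →ₐ[k] H3 k H :=
  (Algebra.TensorProduct.assoc k k k H H H).toAlgHom.comp
    (Algebra.TensorProduct.includeLeft : H2 k H →ₐ[k] H2 k H ⊗[k] H)

/-- `x ↦ 1 ⊗ x`, from `H ⊗ H` to `H ⊗ H ⊗ H`. -/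
def incl23 : H2 k H →ₐ[k] H3 k H := Algebra.TensorProduct.includeRight

theorem incl12_comul (h : H) : incl12 k H (comul2 k H h) = comulId k H (h ⊗ₜ[k] 1) := by
  simp [incl12, comulId]

theorem incl23_comul (h : H) : incl23 k H (comul2 k H h) = idComul k H (1 ⊗ₜ[k] h) := by
  simp [incl23, idComul]

/-- The flip `σ` of `H ⊗ H`. -/
def flip2 : H2 k H →ₐ[k] H2 k H := (Algebra.TensorProduct.comm k H H).toAlgHom

theorem flip2_comul [Coalgebra.IsCocomm k H] (h : H) :
    flip2 k H (comul2 k H h) = comul2 k H h :=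
  Coalgebra.comm_comul k h

/-- `σ ⊗ id`, the exchange of the first two factors of `H ⊗ H ⊗ H`. -/
def flip12 : H3 k H →ₐ[k] H3 k H := (Algebra.TensorProduct.leftComm k H H H).toAlgHom

theorem flip12_comul [Coalgebra.IsCocomm k H] (h : H) :
    flip12 k H (comul3 k H h) = comul3 k H h := by
  have key : (flip12 k H).comp (comulId k H) = comulId k H := by
    ext a
    · have : ∀ s : H2 k H, flip12 k H (incl12 k H s) = incl12 k H (flip2 k H s) := by
        intro s
        induction s using TensorProduct.induction_on with
        | zero => simp
        | tmul a b => simp [flip12, incl12, flip2]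
        | add s t hs ht => simp only [map_add, hs, ht]
      have h2 := this (comul2 k H a)
      rw [flip2_comul, incl12_comul] at h2
      simpa using h2
    · simp [flip12, comulId, Algebra.TensorProduct.one_def]
  rw [← comulId_comul, ← AlgHom.comp_apply, key]

/-- The Fourier transform `f ⊗ g ↦ (f ⊗ 1) (S ⊗ id)(Δ(g))`. -/
def fourier : H2 k H →ₗ[k] H2 k H :=
  TensorProduct.lift
    ((LinearMap.mul k (H2 k H)).compl₁₂
      (Algebra.TensorProduct.includeLeft : H →ₐ[k] H2 k H).toLinearMap
      ((LinearMap.rTensor H (HopfAlgebra.antipode k)) ∘ₗ Coalgebra.comul))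

theorem fourier_tmul (f g : H) :
    fourier k H (f ⊗ₜ[k] g) =
      (f ⊗ₜ[k] 1) * LinearMap.rTensor H (HopfAlgebra.antipode k) (Coalgebra.comul g) := rfl

theorem fourier_mul_comul (s : H2 k H) (h : H) :
    fourier k H (s * comul2 k H h) = fourier k H s * (1 ⊗ₜ[k] h) := by
  induction s using TensorProduct.induction_on with
  | zero => simp
  | add s t hs ht => rw [add_mul, map_add, hs, ht, map_add, add_mul]
  | tmul f g =>
    let N : H2 k H → H3 k H →ₗ[k] H2 k H := fun X => TensorProduct.lift
      ((LinearMap.mul k (H2 k H)).compl₁₂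
        ((Algebra.TensorProduct.includeLeft : H →ₐ[k] H2 k H).toLinearMap ∘ₗ
          LinearMap.mulLeft k f)
        ((LinearMap.rTensor H (HopfAlgebra.antipode k)) ∘ₗ LinearMap.mulLeft k X))
    have hN : ∀ X u y, N X (u ⊗ₜ[k] y) =
        ((f * u) ⊗ₜ[k] 1) * LinearMap.rTensor H (HopfAlgebra.antipode k) (X * y) :=
      fun _ _ _ => rfl
    have h1 : ∀ y : H2 k H, fourier k H ((f ⊗ₜ[k] g) * y) =
        N (comul2 k H g) (idComul k H y) := by
      intro y
      induction y using TensorProduct.induction_on with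
      | zero => simp
      | add s t hs ht => rw [mul_add, map_add, hs, ht, map_add, map_add]
      | tmul a b =>
        have hb : idComul k H (a ⊗ₜ[k] b) = a ⊗ₜ[k] (comul2 k H b) := by simp [idComul]
        have hc : (Coalgebra.comul (g * b) : H2 k H) = comul2 k H g * comul2 k H b :=
          map_mul (comul2 k H) g b
        rw [hb, hN, Algebra.TensorProduct.tmul_mul_tmul, fourier_tmul, hc]
    have h2 : ∀ (X z : H2 k H) (y : H), N X (Algebra.TensorProduct.assoc k k k H H H (z ⊗ₜ[k] y)) =
        (f ⊗ₜ[k] 1) * ((LinearMap.mul' k H (LinearMap.lTensor H (HopfAlgebra.antipode k) z))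
          ⊗ₜ[k] 1) * (LinearMap.rTensor H (HopfAlgebra.antipode k) X * (1 ⊗ₜ[k] y)) := by
      intro X z y
      induction z using TensorProduct.induction_on with
      | zero => simp
      | add s t hs ht =>
        simp only [TensorProduct.add_tmul, map_add, hs, ht, mul_add, add_mul]
      | tmul p q =>
        rw [Algebra.TensorProduct.assoc_tmul, hN]
        induction X using TensorProduct.induction_on with
        | zero => simp
        | add s t hs ht => simp only [map_add, hs, ht, mul_add, add_mul]
        | tmul a b => simp [HopfAlgebra.antipode_mul_antidistrib, mul_assoc]
    have h3 : ∀ (X y : H2 k H), N X (comulId k H y) =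
        (f ⊗ₜ[k] 1) * (LinearMap.rTensor H (HopfAlgebra.antipode k) X *
          (1 ⊗ₜ[k] TensorProduct.lid k H (LinearMap.rTensor H Coalgebra.counit y))) := by
      intro X y
      induction y using TensorProduct.induction_on with
      | zero => simp
      | add s t hs ht => simp only [map_add, hs, ht, mul_add, TensorProduct.tmul_add]
      | tmul a b =>
        have hb : comulId k H (a ⊗ₜ[k] b) =
            Algebra.TensorProduct.assoc k k k H H H ((Coalgebra.comul a) ⊗ₜ[k] b) := by
          simp [comulId]
        rw [hb, h2, HopfAlgebra.mul_antipode_lTensor_comul_apply]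
        simp only [LinearMap.rTensor_tmul, TensorProduct.lid_tmul, TensorProduct.tmul_smul,
          Algebra.algebraMap_eq_smul_one, TensorProduct.smul_tmul']
        simp only [← TensorProduct.smul_tmul', smul_mul_assoc, mul_smul_comm,
          mul_one, ← Algebra.TensorProduct.one_def]
    have h4 : idComul k H (comul2 k H h) = comulId k H (comul2 k H h) :=
      (comulId_comul k H h).symm
    rw [h1, h4, h3, fourier_tmul, ← mul_assoc]
    have h5 : LinearMap.rTensor H Coalgebra.counit (comul2 k H h) = (1 : k) ⊗ₜ[k] h :=
      Coalgebra.rTensor_counit_comul h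
    rw [h5, TensorProduct.lid_tmul, one_smul]
    rfl

end Powers

/-! ### The `H`-modules `(H ⊗ H) ⊗_H M` and `(H ⊗ H ⊗ H) ⊗_H M` -/

section Modules

variable (k : Type u) (H : Type v) [Field k] [Ring H] [HopfAlgebra k H]

/-- `(H ⊗ H) ⊗_H M`. -/
abbrev PT2 (M : Type w) [AddCommGroup M] [Module k M] [Module H M] : Type (max v w) :=
  BaseTensor (comul2 k H) M

/-- `(H ⊗ H ⊗ H) ⊗_H M`. -/
abbrev PT3 (M : Type w) [AddCommGroup M] [Module k M] [Module H M] : Type (max v w) :=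
  BaseTensor (comul3 k H) M

/-- The base field as a left `H`-module through the counit. -/
def Triv (k : Type u) (_H : Type v) : Type u := k

instance : AddCommGroup (Triv k H) := inferInstanceAs (AddCommGroup k)

instance : Module k (Triv k H) := inferInstanceAs (Module k k)

instance : Module H (Triv k H) :=
  Module.compHom k (Bialgebra.counitAlgHom k H : H →+* k)

theorem Triv.smul_def (h : H) (c : Triv k H) :
    h • c = (Coalgebra.counit (R := k) h) • c := rfl

instance : IsScalarTower k H (Triv k H) :=
  ⟨fun a h c => by rw [Triv.smul_def, Triv.smul_def, map_smul, smul_assoc]⟩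

/-- The element `1` of the base field. -/
def Triv.one : Triv k H := (1 : k)

variable (M : Type w) [AddCommGroup M] [Module k M] [Module H M] [IsScalarTower k H M]
  (N : Type x) [AddCommGroup N] [Module k N] [Module H N] [IsScalarTower k H N]

/-- `M ⊗ N` over the base field, with `H` acting through the comultiplication. -/
def DTensor (k : Type u) (_H : Type v) [Field k] (M : Type w) [AddCommGroup M] [Module k M]
    (N : Type x) [AddCommGroup N] [Module k N] : Type (max w x) := M ⊗[k] N

instance : AddCommGroup (DTensor k H M N) := inferInstanceAs (AddCommGroup (M ⊗[k] N))

instance : Module k (DTensor k H M N) := inferInstanceAs (Module k (M ⊗[k] N))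

/-- The componentwise action of `H ⊗ H` on `M ⊗ N`. -/
def act2 : H2 k H →ₐ[k] Module.End k (M ⊗[k] N) :=
  (Module.endTensorEndAlgHom (R := k) (S := k) (A := k) (M := M) (N := N)).comp
    (Algebra.TensorProduct.map (Algebra.lsmul k k M) (Algebra.lsmul k k N))

theorem act2_tmul (f g : H) (m : M) (n : N) :
    act2 k H M N (f ⊗ₜ[k] g) (m ⊗ₜ[k] n) = (f • m) ⊗ₜ[k] (g • n) := rfl

instance : Module H (DTensor k H M N) :=
  Module.compHom (M ⊗[k] N) ((act2 k H M N).comp (comul2 k H)).toRingHom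

theorem DTensor.smul_def (h : H) (s : DTensor k H M N) :
    h • s = act2 k H M N (comul2 k H h) s := rfl

instance : IsScalarTower k H (DTensor k H M N) :=
  ⟨fun a h s => by
    rw [DTensor.smul_def, DTensor.smul_def, map_smul, map_smul]
    rfl⟩

/-- The identification of `DTensor k H M N` with the vector space `M ⊗ N`. -/
def DTensor.toTensor : DTensor k H M N ≃ₗ[k] M ⊗[k] N := LinearEquiv.refl k (M ⊗[k] N)

variable {M N}

/-- `id ⊗_H g` on `(H ⊗ H) ⊗_H M`. -/
def PT2.map (g : M →ₗ[H] N) : PT2 k H M →ₗ[k] PT2 k H N :=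
  BaseTensor.map (comul2 k H) (AlgHom.id k (H2 k H)) (BaseTensor.id_comp (comul2 k H)) g

/-- `σ ⊗_H id` on `(H ⊗ H) ⊗_H M`. -/
def PT2.flip [Coalgebra.IsCocomm k H] : PT2 k H M →ₗ[k] PT2 k H M :=
  BaseTensor.map (comul2 k H) (flip2 k H) (flip2_comul k H) LinearMap.id

/-- `(σ ⊗ id) ⊗_H id` on `(H ⊗ H ⊗ H) ⊗_H M`. -/
def PT3.flip12 [Coalgebra.IsCocomm k H] : PT3 k H M →ₗ[k] PT3 k H M :=
  BaseTensor.map (comul3 k H) (Pseudo.flip12 k H) (flip12_comul k H) LinearMap.id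

/-- `(Δ ⊗ id) ⊗_H id` on `(H ⊗ H) ⊗_H M`. -/
def PT2.comulId : PT2 k H M →ₗ[k] PT3 k H M :=
  BaseTensor.map (comul2 k H) (Pseudo.comulId k H) (comulId_comul k H) LinearMap.id

/-- `(id ⊗ Δ) ⊗_H id` on `(H ⊗ H) ⊗_H M`. -/
def PT2.idComul : PT2 k H M →ₗ[k] PT3 k H M :=
  BaseTensor.map (comul2 k H) (Pseudo.idComul k H) (idComul_comul k H) LinearMap.id

/-- The normal form `(f ⊗ g) ⊗_H m ↦ f g₍₋₁₎ ⊗ g₍₂₎ m` of the elements of `(H ⊗ H) ⊗_H M`: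
an element is the image of its normal form under `h ⊗ c ↦ (h ⊗ 1) ⊗_H c`. -/
def PT2.normal : PT2 k H M →ₗ[k] H ⊗[k] M :=
  BaseTensor.lift (comul2 k H)
    (((LinearMap.lTensorHom (R := k) H (N := H) (P := M)) ∘ₗ
      (Algebra.lsmul k k M : H →ₐ[k] Module.End k M).toLinearMap.flip).flip ∘ₗ fourier k H)
    (fun s h m => by
      change LinearMap.lTensor H
          ((Algebra.lsmul k k M : H →ₐ[k] Module.End k M).toLinearMap.flip m)
          (fourier k H (s * comul2 k H h)) =
        LinearMap.lTensor H
          ((Algebra.lsmul k k M : H →ₐ[k] Module.End k M).toLinearMap.flip (h • m))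
          (fourier k H s)
      rw [fourier_mul_comul]
      induction fourier k H s using TensorProduct.induction_on with
      | zero => simp
      | tmul a b => simp
      | add s t hs ht => rw [add_mul, map_add, hs, ht, map_add])

end Modules

/-! ### Polylinear maps and Lie pseudoalgebras -/

section Lie

variable (k : Type u) (H : Type v) [Field k] [Ring H] [HopfAlgebra k H]

/-- Polylinear maps from `{U, V}` to `Z`: `H ⊗ H`-linear maps `U ⊠ V → (H ⊗ H) ⊗_H Z`. -/
@[ext]
structure Lin2 (U : Type w) [AddCommGroup U] [Module k U] [Module H U]
    (V : Type x) [AddCommGroup V] [Module k V] [Module H V]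
    (Z : Type y) [AddCommGroup Z] [Module k Z] [Module H Z] where
  /-- The underlying bilinear map. -/
  toFun : U →ₗ[k] V →ₗ[k] PT2 k H Z
  map_smul' : ∀ (f g : H) (a : U) (b : V),
    toFun (f • a) (g • b) = (f ⊗ₜ[k] g : H2 k H) • toFun a b

section Composition

variable {k H}
variable {U : Type w} [AddCommGroup U] [Module k U] [Module H U] [IsScalarTower k H U]
  {V : Type x} [AddCommGroup V] [Module k V] [Module H V] [IsScalarTower k H V]
  {W : Type y} [AddCommGroup W] [Module k W] [Module H W] [IsScalarTower k H W]
  {Z : Type z} [AddCommGroup Z] [Module k Z] [Module H Z] [IsScalarTower k H Z]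

theorem Lin2.smul_left (φ : Lin2 k H U V Z) (h : H) (a : U) (b : V) :
    φ.toFun (h • a) b = (h ⊗ₜ[k] 1 : H2 k H) • φ.toFun a b := by
  have := φ.map_smul' h 1 a b
  rwa [one_smul] at this

theorem Lin2.smul_right (φ : Lin2 k H U V Z) (h : H) (a : U) (b : V) :
    φ.toFun a (h • b) = (1 ⊗ₜ[k] h : H2 k H) • φ.toFun a b := by
  have := φ.map_smul' 1 h a b
  rwa [one_smul] at this

/-- The composition rule for `(a * b) * c`: if `s = ∑ (f ⊗ g) ⊗_H e` and
`e * c = ∑ (f' ⊗ g') ⊗_H e'`, then `s * c = ∑ (f f'₍₁₎ ⊗ g f'₍₂₎ ⊗ g') ⊗_H e'`. -/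
def Lin2.compLeft (φ : Lin2 k H W V Z) (s : PT2 k H W) (c : V) : PT3 k H Z :=
  BaseTensor.lift (comul2 k H)
    (((Algebra.lsmul k k (PT3 k H Z)).toLinearMap ∘ₗ (incl12 k H).toLinearMap).compl₂
      (PT2.comulId k H ∘ₗ φ.toFun.flip c))
    (fun x h e => by
      change incl12 k H (x * comul2 k H h) • PT2.comulId k H (φ.toFun e c) =
        incl12 k H x • PT2.comulId k H (φ.toFun (h • e) c)
      rw [Lin2.smul_left, PT2.comulId, BaseTensor.map_smul, map_mul, incl12_comul, mul_smul]) s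

theorem Lin2.compLeft_tmul (φ : Lin2 k H W V Z) (x : H2 k H) (e : W) (c : V) :
    φ.compLeft (BaseTensor.tmul _ x e) c = incl12 k H x • PT2.comulId k H (φ.toFun e c) :=
  BaseTensor.lift_tmul _ _ _ x e

/-- The composition rule for `a * (b * c)`: if `s = ∑ (f ⊗ g) ⊗_H d` and
`a * d = ∑ (f' ⊗ g') ⊗_H d'`, then `a * s = ∑ (f' ⊗ f g'₍₁₎ ⊗ g g'₍₂₎) ⊗_H d'`. -/
def Lin2.compRight (φ : Lin2 k H U W Z) (a : U) (s : PT2 k H W) : PT3 k H Z :=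
  BaseTensor.lift (comul2 k H)
    (((Algebra.lsmul k k (PT3 k H Z)).toLinearMap ∘ₗ (incl23 k H).toLinearMap).compl₂
      (PT2.idComul k H ∘ₗ φ.toFun a))
    (fun x h d => by
      change incl23 k H (x * comul2 k H h) • PT2.idComul k H (φ.toFun a d) =
        incl23 k H x • PT2.idComul k H (φ.toFun a (h • d))
      rw [Lin2.smul_right, PT2.idComul, BaseTensor.map_smul, map_mul, incl23_comul, mul_smul]) s

theorem Lin2.compRight_tmul (φ : Lin2 k H U W Z) (a : U) (x : H2 k H) (d : W) :
    φ.compRight a (BaseTensor.tmul _ x d) = incl23 k H x • PT2.idComul k H (φ.toFun a d) :=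
  BaseTensor.lift_tmul _ _ _ x d

/-- `h ⊗ m ↦ (h ⊗ 1) ⊗_H m`. -/
def PT2.ofNormal : H ⊗[k] Z →ₗ[k] PT2 k H Z :=
  TensorProduct.lift ((BaseTensor.tmulₗ (comul2 k H) Z) ∘ₗ
    (Algebra.TensorProduct.includeLeft : H →ₐ[k] H2 k H).toLinearMap)

/-- The action of a fixed `a` on `V ⊗ W`, given polylinear actions `φ` on `V` and `ψ` on `W`: if
`a * m = ∑ (h ⊗ 1) ⊗_H m'` and `a * n = ∑ (l ⊗ 1) ⊗_H n'`, then
`a * (m ⊗ n) = ∑ (h ⊗ 1) ⊗_H (m' ⊗ n) + ∑ (l ⊗ 1) ⊗_H (m ⊗ n')`. -/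
def tensorAct (φ : Lin2 k H U V V) (ψ : Lin2 k H U W W) (a : U) :
    V ⊗[k] W →ₗ[k] PT2 k H (DTensor k H V W) :=
  PT2.ofNormal (Z := DTensor k H V W) ∘ₗ
    LinearMap.lTensor H (DTensor.toTensor k H V W).symm.toLinearMap ∘ₗ
    ((TensorProduct.assoc k H V W).toLinearMap ∘ₗ
        LinearMap.rTensor W (PT2.normal k H ∘ₗ φ.toFun a) +
      (TensorProduct.leftComm k V H W).toLinearMap ∘ₗ
        LinearMap.lTensor V (PT2.normal k H ∘ₗ ψ.toFun a))

end Composition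

variable (L : Type w) [AddCommGroup L] [Module k L] [Module H L] [IsScalarTower k H L]

/-- A Lie `H`-pseudoalgebra structure on the `H`-module `L`. -/
@[ext]
structure LiePseudoalgebra [Coalgebra.IsCocomm k H] where
  /-- The pseudobracket `[a * b]`. -/
  bracket : Lin2 k H L L L
  skew : ∀ a b, bracket.toFun b a = -PT2.flip k H (bracket.toFun a b)
  jacobi : ∀ a b c, bracket.compRight a (bracket.toFun b c) -
    PT3.flip12 k H (bracket.compRight b (bracket.toFun a c)) = bracket.compLeft (bracket.toFun a b) c

variable {k H L} in
/-- An `H`-linear map to `L ⊗ L`, as a linear map over the base field. -/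
def toTensor (δ : L →ₗ[H] DTensor k H L L) : L →ₗ[k] L ⊗[k] L :=
  (DTensor.toTensor k H L L).toLinearMap ∘ₗ δ.restrictScalars k

/-- A Lie `H`-coalgebra structure on the `H`-module `L`; `∧² L` is the space of skew-symmetric
tensors in `L ⊗ L`. -/
@[ext]
structure LieCoalgebra where
  /-- The cobracket, an `H`-linear map to `L ⊗ L`. -/
  cobracket : L →ₗ[H] DTensor k H L L
  skew : ∀ a, TensorProduct.comm k L L (toTensor cobracket a) = -toTensor cobracket a
  cojacobi : ∀ a,
    LinearMap.lTensor L (toTensor cobracket) (toTensor cobracket a) -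
      TensorProduct.leftComm k L L L
        (LinearMap.lTensor L (toTensor cobracket) (toTensor cobracket a)) =
    TensorProduct.assoc k L L L
      (LinearMap.rTensor L (toTensor cobracket) (toTensor cobracket a))

variable {k H L}

/-- A Lie pseudo-bialgebra structure on the Lie pseudoalgebra `Λ`: a Lie `H`-coalgebra structure
on the same `H`-module that satisfies the cocycle condition. -/
@[ext]
structure LiePseudoBialgebra [Coalgebra.IsCocomm k H] (Λ : LiePseudoalgebra k H L) extends
    LieCoalgebra k H L where
  cocycle : ∀ a b,
    tensorAct Λ.bracket Λ.bracket a (toTensor cobracket b) -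
      PT2.flip k H (tensorAct Λ.bracket Λ.bracket b (toTensor cobracket a)) =
    PT2.map k H cobracket (Λ.bracket.toFun a b)

end Lie

/-! ### The dual, pseudo-forms and pseudo Manin triples -/

section Manin

variable (k : Type u) (H : Type v) [Field k] [Ring H] [HopfAlgebra k H]

section Chom

variable (V : Type w) [AddCommGroup V] [Module k V] [Module H V] [IsScalarTower k H V]
  (W : Type x) [AddCommGroup W] [Module k W] [Module H W]

/-- The space `Chom(V, W)` of pseudolinear maps `V → (H ⊗ H) ⊗_H W`. -/
def Chom : Submodule k (V →ₗ[k] PT2 k H W) where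
  carrier := {φ | ∀ (h : H) (v : V), φ (h • v) = (1 ⊗ₜ[k] h : H2 k H) • φ v}
  add_mem' := fun {φ ψ} hφ hψ h v => by
    simp only [LinearMap.add_apply, hφ h v, hψ h v, smul_add]
  zero_mem' := fun h v => by simp only [LinearMap.zero_apply, smul_zero]
  smul_mem' := fun c φ hφ h v => by
    simp only [LinearMap.smul_apply, hφ h v, smul_comm c]

/-- The action of `h` on `Chom(V, W)`: `(h φ)(v) = ((h ⊗ 1) ⊗_H 1) φ(v)`. -/
instance : SMul H (Chom k H V W) where
  smul h φ := ⟨(Algebra.lsmul k k (PT2 k H W) (h ⊗ₜ[k] 1 : H2 k H)) ∘ₗ φ.1, fun g v => by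
    change (h ⊗ₜ[k] 1 : H2 k H) • φ.1 (g • v) = (1 ⊗ₜ[k] g : H2 k H) • (h ⊗ₜ[k] 1 : H2 k H) • φ.1 v
    rw [φ.2 g v, ← mul_smul, ← mul_smul]
    simp⟩

variable {V W} in
theorem Chom.smul_apply (h : H) (φ : Chom k H V W) (v : V) :
    (h • φ).1 v = (h ⊗ₜ[k] 1 : H2 k H) • φ.1 v := rfl

instance : Module H (Chom k H V W) where
  one_smul φ := by
    ext v
    rw [Chom.smul_apply, ← Algebra.TensorProduct.one_def, one_smul]
  mul_smul f g φ := by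
    ext v
    rw [Chom.smul_apply, Chom.smul_apply, Chom.smul_apply, ← mul_smul]
    simp
  smul_zero h := by
    ext v
    rw [Chom.smul_apply]
    exact smul_zero _
  smul_add h φ ψ := by
    ext v
    rw [Chom.smul_apply]
    exact smul_add _ _ _
  add_smul f g φ := by
    ext v
    rw [Chom.smul_apply, TensorProduct.add_tmul, add_smul]
    rfl
  zero_smul φ := by
    ext v
    rw [Chom.smul_apply, TensorProduct.zero_tmul, zero_smul]
    rfl

instance : IsScalarTower k H (Chom k H V W) :=
  ⟨fun a h φ => by
    ext v
    change ((a • h) ⊗ₜ[k] 1 : H2 k H) • φ.1 v = a • ((h ⊗ₜ[k] 1 : H2 k H) • φ.1 v)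
    rw [← smul_assoc, TensorProduct.smul_tmul']⟩

/-- The dual `V* = Chom(V, k)`. -/
abbrev PDual : Type (max u v w) := Chom k H V (Triv k H)

end Chom

section Forms

variable {k H}
variable [Coalgebra.IsCocomm k H]
  {V : Type w} [AddCommGroup V] [Module k V] [Module H V] [IsScalarTower k H V]

/-- The map `V → V*`, `v ↦ ⟨v, ·⟩`, of a bilinear pseudo-form. -/
def formToDual (B : Lin2 k H V V (Triv k H)) (v : V) : PDual k H V :=
  ⟨B.toFun v, fun h w => Lin2.smul_right B h v w⟩

/-- Symmetric bilinear pseudo-forms. -/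
def IsSymmForm (B : Lin2 k H V V (Triv k H)) : Prop :=
  ∀ v w, B.toFun v w = PT2.flip k H (B.toFun w v)

/-- Non-degenerate bilinear pseudo-forms: `V → V*` is an isomorphism. -/
def IsNondegenForm (B : Lin2 k H V V (Triv k H)) : Prop :=
  Function.Bijective (formToDual B)

/-- Invariance `⟨[a * b], c⟩ = ⟨a, [b * c]⟩` of a bilinear pseudo-form under a pseudobracket. -/
def IsInvariantForm (μ : Lin2 k H V V V) (B : Lin2 k H V V (Triv k H)) : Prop :=
  ∀ a b c, B.compLeft (μ.toFun a b) c = B.compRight a (μ.toFun b c)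

/-- The submodule `N` is closed under the pseudobracket: `[a * b] ∈ (H ⊗ H) ⊗_H N`. -/
def IsPseudosubalgebra (μ : Lin2 k H V V V) (N : Submodule H V) : Prop :=
  ∀ a ∈ N, ∀ b ∈ N, μ.toFun a b ∈ LinearMap.range (PT2.map k H N.subtype)

/-- The `H`-linear map `g` intertwines two pseudobrackets. -/
def IsPseudoHom {V' : Type x} [AddCommGroup V'] [Module k V'] [Module H V']
    [IsScalarTower k H V'] (μ : Lin2 k H V V V) (μ' : Lin2 k H V' V' V') (g : V →ₗ[H] V') : Prop :=
  ∀ a b, μ'.toFun (g a) (g b) = PT2.map k H g (μ.toFun a b)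

variable (k H) in
/-- A pseudo Manin triple `(R, R₁, R₀)` on the `H`-module `R`. -/
@[ext]
structure PseudoManinTriple (R : Type x) [AddCommGroup R] [Module k R] [Module H R]
    [IsScalarTower k H R] where
  /-- The Lie pseudoalgebra structure on `R`. -/
  lie : LiePseudoalgebra k H R
  /-- The bilinear pseudo-form on `R`. -/
  form : Lin2 k H R R (Triv k H)
  /-- The first isotropic pseudosubalgebra. -/
  R₁ : Submodule H R
  /-- The second isotropic pseudosubalgebra. -/
  R₀ : Submodule H R
  finite : Module.Finite H R
  symm : IsSymmForm form
  invariant : IsInvariantForm lie.bracket form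
  nondegenerate : IsNondegenForm form
  subalgebra₁ : IsPseudosubalgebra lie.bracket R₁
  subalgebra₀ : IsPseudosubalgebra lie.bracket R₀
  isCompl : IsCompl R₁ R₀
  isotropic₁ : ∀ a ∈ R₁, ∀ b ∈ R₁, form.toFun a b = 0
  isotropic₀ : ∀ a ∈ R₀, ∀ b ∈ R₀, form.toFun a b = 0

variable {L : Type w} [AddCommGroup L] [Module k L] [Module H L] [IsScalarTower k H L]

/-- A pseudo Manin triple `(R, R₁, R₀)` on the `H`-module `R` with `R₁ = L` as Lie pseudoalgebras,
the identification being given by an injective homomorphism `L → R` with image `R₁`. -/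
@[ext]
structure ManinTripleOn (Λ : LiePseudoalgebra k H L) (R : Type x) [AddCommGroup R] [Module k R]
    [Module H R] [IsScalarTower k H R] extends PseudoManinTriple k H R where
  /-- The inclusion of `L`. -/
  incl : L →ₗ[H] R
  incl_injective : Function.Injective incl
  incl_range : LinearMap.range incl = R₁
  incl_hom : IsPseudoHom Λ.bracket lie.bracket incl

/-- Two pseudo Manin triples with `R₁ = L` are isomorphic: there is an isomorphism of Lie
pseudoalgebras that preserves the form and the subalgebra `R₀` and is the identity on `L`. -/
def ManinIso {Λ : LiePseudoalgebra k H L} {R : Type x} [AddCommGroup R] [Module k R] [Module H R]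
    [IsScalarTower k H R] {R' : Type y} [AddCommGroup R'] [Module k R'] [Module H R']
    [IsScalarTower k H R'] (T : ManinTripleOn Λ R) (T' : ManinTripleOn Λ R') : Prop :=
  ∃ e : R ≃ₗ[H] R', IsPseudoHom T.lie.bracket T'.lie.bracket e.toLinearMap ∧
    (∀ r s, T'.form.toFun (e r) (e s) = T.form.toFun r s) ∧
    T.R₀.map e.toLinearMap = T'.R₀ ∧ ∀ a, e (T.incl a) = T'.incl a

variable (k H L) in
/-- The canonical pseudo-form `⟨a + f, b + g⟩ = f * b + (σ ⊗_H id) (g * a)` on `L ⊕ L*`. -/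
def canonicalForm : Lin2 k H (L × PDual k H L) (L × PDual k H L) (Triv k H) where
  toFun := LinearMap.mk₂ k (fun p q => p.2.1 q.1 + PT2.flip k H (q.2.1 p.1))
    (fun p p' q => by
      change (p.2.1 + p'.2.1) q.1 + PT2.flip k H (q.2.1 (p.1 + p'.1)) = _
      rw [LinearMap.add_apply, map_add, map_add]
      abel)
    (fun c p q => by
      change (c • p.2.1) q.1 + PT2.flip k H (q.2.1 (c • p.1)) = _
      rw [LinearMap.smul_apply, map_smul, map_smul, smul_add])
    (fun p q q' => by
      change p.2.1 (q.1 + q'.1) + PT2.flip k H ((q.2.1 + q'.2.1) p.1) = _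
      rw [LinearMap.add_apply, map_add, map_add]
      abel)
    (fun c p q => by
      change p.2.1 (c • q.1) + PT2.flip k H ((c • q.2.1) p.1) = _
      rw [LinearMap.smul_apply, map_smul, map_smul, smul_add])
  map_smul' f g p q := by
    change (f • p.2).1 (g • q.1) + PT2.flip k H ((g • q.2).1 (f • p.1)) =
      (f ⊗ₜ[k] g : H2 k H) • (p.2.1 q.1 + PT2.flip k H (q.2.1 p.1))
    rw [Chom.smul_apply, Chom.smul_apply, p.2.2, q.2.2, ← mul_smul, ← mul_smul, PT2.flip,
      BaseTensor.map_smul, smul_add]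
    simp [flip2]

/-- The Lie pseudoalgebra structure `M` on `L*` is dual to the Lie coalgebra structure `δ` on `L`:
if `e` is an `H`-basis of `L`, with dual basis `e'`, and
`[e'ᵢ * e'ⱼ] = ∑ₗ xᵢⱼₗ ⊗_H e'ₗ` with `xᵢⱼₗ ∈ H ⊗ H`, then
`δ(eₗ) = ∑ᵢⱼ ((S ⊗ S) xᵢⱼₗ) (eᵢ ⊗ eⱼ)`. -/
def IsDualBracket (δ : LieCoalgebra k H L) (M : LiePseudoalgebra k H (PDual k H L)) : Prop :=
  ∀ (n : ℕ) (e : Module.Basis (Fin n) H L) (e' : Fin n → PDual k H L)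
    (x : Fin n → Fin n → Fin n → H2 k H),
    (∀ i j, (e' i).1 (e j) =
      if i = j then BaseTensor.tmul (comul2 k H) (1 ⊗ₜ[k] 1) (Triv.one k H) else 0) →
    (∀ i j, M.bracket.toFun (e' i) (e' j) = ∑ l, BaseTensor.tmul (comul2 k H) (x i j l) (e' l)) →
    ∀ l, toTensor δ.cobracket (e l) = ∑ i, ∑ j,
      act2 k H L L
        (TensorProduct.map (HopfAlgebra.antipode k) (HopfAlgebra.antipode k) (x i j l))
        (e i ⊗ₜ[k] e j)

/-- Pseudo Manin triples `(R, R₁, R₀)` with `R₁ = L`. -/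
structure ManinTripleOver (Λ : LiePseudoalgebra k H L) where
  /-- The `H`-module `R`. -/
  carrier : Type t
  [instAddCommGroup : AddCommGroup carrier]
  [instModuleBase : Module k carrier]
  [instModule : Module H carrier]
  [instTower : IsScalarTower k H carrier]
  /-- The pseudo Manin triple on `R`. -/
  triple : ManinTripleOn Λ carrier

attribute [instance] ManinTripleOver.instAddCommGroup ManinTripleOver.instModuleBase
  ManinTripleOver.instModule ManinTripleOver.instTower

theorem PT2.map_id (s : PT2 k H V) : PT2.map k H (LinearMap.id : V →ₗ[H] V) s = s :=
  BaseTensor.map_id (comul2 k H) s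

theorem PT2.map_map {V' : Type x} [AddCommGroup V'] [Module k V'] [Module H V']
    [IsScalarTower k H V'] {V'' : Type y} [AddCommGroup V''] [Module k V''] [Module H V'']
    [IsScalarTower k H V''] (g : V →ₗ[H] V') (g' : V' →ₗ[H] V'') (s : PT2 k H V) :
    PT2.map k H g' (PT2.map k H g s) = PT2.map k H (g' ∘ₗ g) s := by
  unfold PT2.map
  induction s using BaseTensor.induction with
  | h0 => simp
  | ht b m => rw [BaseTensor.map_tmul, BaseTensor.map_tmul, BaseTensor.map_tmul]; rfl
  | ha s t hs ht => rw [_root_.map_add, _root_.map_add, hs, ht, _root_.map_add]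

theorem ManinIso.refl {Λ : LiePseudoalgebra k H L} {R : Type x} [AddCommGroup R] [Module k R]
    [Module H R] [IsScalarTower k H R] (T : ManinTripleOn Λ R) : ManinIso T T :=
  ⟨LinearEquiv.refl H R, fun a b => (PT2.map_id (T.lie.bracket.toFun a b)).symm,
    fun _ _ => rfl, Submodule.map_id T.R₀, fun _ => rfl⟩

theorem ManinIso.symm {Λ : LiePseudoalgebra k H L} {R : Type x} [AddCommGroup R] [Module k R]
    [Module H R] [IsScalarTower k H R] {R' : Type y} [AddCommGroup R'] [Module k R']
    [Module H R'] [IsScalarTower k H R'] {T : ManinTripleOn Λ R} {T' : ManinTripleOn Λ R'}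
    (h : ManinIso T T') : ManinIso T' T := by
  obtain ⟨e, h1, h2, h3, h4⟩ := h
  refine ⟨e.symm, ?_, ?_, ?_, ?_⟩
  · intro a b
    have h := h1 (e.symm a) (e.symm b)
    simp only [LinearEquiv.coe_coe, LinearEquiv.apply_symm_apply] at h
    rw [h, PT2.map_map, LinearEquiv.symm_comp, PT2.map_id]
    rfl
  · intro r s
    rw [← h2, e.apply_symm_apply, e.apply_symm_apply]
  · rw [← h3, ← Submodule.map_comp, LinearEquiv.symm_comp, Submodule.map_id]
  · intro a
    rw [← h4, e.symm_apply_apply]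

theorem ManinIso.trans {Λ : LiePseudoalgebra k H L} {R : Type x} [AddCommGroup R] [Module k R]
    [Module H R] [IsScalarTower k H R] {R' : Type y} [AddCommGroup R'] [Module k R']
    [Module H R'] [IsScalarTower k H R'] {R'' : Type z} [AddCommGroup R''] [Module k R'']
    [Module H R''] [IsScalarTower k H R''] {T : ManinTripleOn Λ R} {T' : ManinTripleOn Λ R'}
    {T'' : ManinTripleOn Λ R''} (h : ManinIso T T') (h' : ManinIso T' T'') : ManinIso T T'' := by
  obtain ⟨e, h1, h2, h3, h4⟩ := h
  obtain ⟨e', h1', h2', h3', h4'⟩ := h'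
  refine ⟨e.trans e', ?_, ?_, ?_, ?_⟩
  · intro a b
    have h := h1' (e a) (e b)
    have h5 := h1 a b
    simp only [LinearEquiv.coe_coe] at h h5
    rw [h5, PT2.map_map] at h
    exact h
  · intro r s
    rw [LinearEquiv.trans_apply, LinearEquiv.trans_apply, h2', h2]
  · rw [← h3', ← h3, ← Submodule.map_comp]
    rfl
  · intro a
    rw [LinearEquiv.trans_apply, h4, h4']

/-- Isomorphism of pseudo Manin triples with `R₁ = L`, as an equivalence relation. -/
def maninSetoid (Λ : LiePseudoalgebra k H L) : Setoid (ManinTripleOver.{u, v, w, t} Λ) where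
  r T T' := ManinIso T.triple T'.triple
  iseqv := ⟨fun T => ManinIso.refl T.triple, fun h => h.symm, fun h h' => h.trans h'⟩

end Forms

end Manin

end

end Pseudo

/-!
Elements of `A ⊗_H M`, for an algebra map `H → A`, are treated as generalised elements of `M`. A
polylinear map extends to generalised elements (`pair`); both composition rules of pseudobrackets
are instances of this extension, and identities between polylinear maps, such as symmetry
(`pair_comm`) and invariance (`pair_assoc`), persist for generalised elements. All proofs below are
calculations in which the factors of `H` are carried along by this formalism.

Since `(A ⊗ H) ⊗_H k` is `A` (`eq_tmul_resid`, `tmul_one_injective`), a pseudo-form has coordinates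
in `H`, and a basis of `L` together with its dual basis separates and represents generalised
elements of `L` and of `L*` (`IsDualFamily`). In these terms a cobracket `δ` on `L` is the same as a
pseudobracket on `L*`: the coordinate of `[f * g]` at `a` is that of `δ(a)` at `f ⊗ g` (`IsDual`).
Skew-symmetry and the co-Jacobi identity of `δ` are skew-symmetry and the Jacobi identity of the
dual bracket (`IsDual.skew_iff`, `IsDual.jacobi_iff`).

For a symmetric form on `R`, invariant pseudobrackets correspond to cyclically invariant trilinear
forms `⟨[a * b], c⟩`. Given brackets on `L` and on `L*`, their direct sum has a trilinear form whose
cyclic sum is the form of the only bracket on `L ⊕ L*` that extends both and for which the canonical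
form is invariant (`isDouble_doubleBracket`, `IsDouble.unique`).

The Jacobi identity of this bracket says that `K(a, b, c, d) = ⟨J(a, b, c), d⟩` vanishes, where `J`
is the cyclic sum of `[[a * b] * c]`. As for the Riemann tensor, invariance gives `K` symmetries in
all four arguments (`jacobiator_rot`, `pair_jacobiator_swap`), so that only three cases remain: three
arguments in `L`, which is the Jacobi identity of `L`; three arguments in `L*`, which is that of
`L*`; and `K(f, g, a, b)` with `f, g` in `L*` and `a, b` in `L`. The last one is, up to sign, the
failure of the cocycle condition at `a, b`, paired with `f ⊗ g` (`IsDouble.pair_jacobiator_eq`). So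
the double of a Lie pseudo-bialgebra is a pseudo Manin triple.

Conversely, the form of a pseudo Manin triple with `R₁ = L` identifies `R₀` with `L*`, hence `R` with
`L ⊕ L*`. The bracket of `R₀` is dual to a cobracket on `L`, which is a cocycle by the same
calculation, and uniqueness of the bracket of the double shows that the triple is its double
(`ManinTripleOn.exists_maninIso`). An isomorphism of doubles that is the identity on `L` is the
identity on `L*`, because it preserves the form, so the cobracket is determined by the triple
(`LiePseudoBialgebra.eq_of_maninIso`).
-/

namespace Pseudo

set_option linter.unusedSectionVars false

noncomputable section

/-! ### The antipode of a cocommutative Hopf algebra -/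

section Antipode

open WithConv Coalgebra HopfAlgebra

variable (k : Type*) {H : Type*} [Field k] [Ring H] [HopfAlgebra k H] [Coalgebra.IsCocomm k H]

/-- In a cocommutative Hopf algebra `Δ ∘ S = (S ⊗ S) ∘ Δ`: both sides are inverse to `Δ` under
convolution. -/
theorem comul_antipode (h : H) :
    (comul (antipode k h) : H2 k H) = TensorProduct.map (antipode k) (antipode k) (comul h) := by
  have h1 : toConv (TensorProduct.map (antipode k) (antipode k) ∘ₗ (comul : H →ₗ[k] H2 k H)) *
      toConv (comul : H →ₗ[k] H2 k H) = 1 := by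
    have h2 := LinearMap.convMul_comp_coalgHom_distrib
      (toConv (antipode k (A := H2 k H))) (toConv (LinearMap.id : H2 k H →ₗ[k] H2 k H))
      (comulCoalgHom k H)
    rw [LinearMap.antipode_mul_id] at h2
    apply WithConv.ext
    refine h2.symm.trans ?_
    ext x
    simp [LinearMap.convOne_def]
  have h3 := left_inv_eq_right_inv h1 LinearMap.comul_right_inv
  exact (congrArg (fun f : WithConv (H →ₗ[k] H2 k H) => f h) h3).symm

/-- The antipode of a cocommutative Hopf algebra is involutive: `S ∘ S` and the identity are both
inverse to `S` under convolution. -/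
theorem antipode_antipode (h : H) : antipode k (antipode k h) = h := by
  have h1 : toConv (antipode k ∘ₗ antipode k (A := H)) * toConv (antipode k (A := H)) = 1 := by
    ext x
    rw [LinearMap.convMul_apply]
    have h2 : ∀ y : H2 k H, LinearMap.mul' k H
        (TensorProduct.map (antipode k ∘ₗ antipode k) (antipode k) y) =
        antipode k (LinearMap.mul' k H (LinearMap.lTensor H (antipode k)
          (TensorProduct.comm k H H y))) := by
      intro y
      induction y using TensorProduct.induction_on with
      | zero => simp
      | tmul a b => simp [antipode_mul_antidistrib]
      | add s t hs ht => simp only [map_add, hs, ht]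
    refine (h2 _).trans ?_
    rw [Coalgebra.comm_comul, mul_antipode_lTensor_comul_apply]
    simp [Algebra.algebraMap_eq_smul_one, antipode_one]
  have h3 := left_inv_eq_right_inv h1 (LinearMap.antipode_mul_id (R := k) (C := H))
  exact congrArg (fun f : WithConv (H →ₗ[k] H) => f h) h3

end Antipode

/-! ### Base change of `A ⊗_H M` -/

section Push

variable {k H A B C : Type*} [Field k] [Ring H] [HopfAlgebra k H]
  [Ring A] [Algebra k A] [Ring B] [Algebra k B] [Ring C] [Algebra k C]
  {M : Type*} [AddCommGroup M] [Module k M] [Module H M] [IsScalarTower k H M]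
  {N : Type*} [AddCommGroup N] [Module k N] [Module H N] [IsScalarTower k H N]
  {M' : Type*} [AddCommGroup M'] [Module k M'] [Module H M'] [IsScalarTower k H M']

theorem BaseTensor.tmul_add (θ : H →ₐ[k] A) (a : A) (m n : M) :
    BaseTensor.tmul θ a (m + n) = BaseTensor.tmul θ a m + BaseTensor.tmul θ a n :=
  map_add (BaseTensor.tmulₗ θ M a) m n

theorem BaseTensor.add_tmul (θ : H →ₐ[k] A) (a b : A) (m : M) :
    BaseTensor.tmul θ (a + b) m = BaseTensor.tmul θ a m + BaseTensor.tmul θ b m :=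
  LinearMap.map_add₂ (BaseTensor.tmulₗ θ M) a b m

theorem BaseTensor.zero_tmul (θ : H →ₐ[k] A) (m : M) :
    BaseTensor.tmul θ (0 : A) m = 0 :=
  LinearMap.map_zero₂ (BaseTensor.tmulₗ θ M) m

theorem BaseTensor.tmul_sum {ι : Type*} (θ : H →ₐ[k] A) (a : A) (s : Finset ι) (m : ι → M) :
    BaseTensor.tmul θ a (∑ i ∈ s, m i) = ∑ i ∈ s, BaseTensor.tmul θ a (m i) :=
  map_sum (BaseTensor.tmulₗ θ M a) m s

theorem BaseTensor.tmul_smul (θ : H →ₐ[k] A) (a : A) (c : k) (m : M) :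
    BaseTensor.tmul θ a (c • m) = c • BaseTensor.tmul θ a m :=
  _root_.map_smul (BaseTensor.tmulₗ θ M a) c m

theorem BaseTensor.smul_tmul_base (θ : H →ₐ[k] A) (c : k) (a : A) (m : M) :
    BaseTensor.tmul θ (c • a) m = c • BaseTensor.tmul θ a m :=
  LinearMap.map_smul₂ (BaseTensor.tmulₗ θ M) c a m

theorem BaseTensor.map_map {θ : H →ₐ[k] A} {η : H →ₐ[k] B} {ζ : H →ₐ[k] C}
    (α : A →ₐ[k] B) (hα : ∀ h, α (θ h) = η h) (β : B →ₐ[k] C) (hβ : ∀ h, β (η h) = ζ h)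
    (g : M →ₗ[H] N) (g' : N →ₗ[H] M') (s : BaseTensor θ M) :
    BaseTensor.map η β hβ g' (BaseTensor.map θ α hα g s) =
      BaseTensor.map θ (β.comp α) (fun h => by rw [AlgHom.comp_apply, hα, hβ]) (g' ∘ₗ g) s := by
  induction s using BaseTensor.induction with
  | h0 => simp
  | ht a m => simp only [BaseTensor.map_tmul]; rfl
  | ha s t hs ht => simp only [map_add, hs, ht]

/-- Base change `A ⊗_H M → B ⊗_H M` along an algebra map `α : A → B` under `H`. -/
def push {θ : H →ₐ[k] A} {η : H →ₐ[k] B} (α : A →ₐ[k] B) (hα : ∀ h, α (θ h) = η h) :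
    BaseTensor θ M →ₗ[k] BaseTensor η M :=
  BaseTensor.map θ α hα LinearMap.id

variable {θ : H →ₐ[k] A} {η : H →ₐ[k] B} {ζ : H →ₐ[k] C}

theorem push_tmul (α : A →ₐ[k] B) (hα : ∀ h, α (θ h) = η h) (a : A) (m : M) :
    push α hα (BaseTensor.tmul θ a m) = BaseTensor.tmul η (α a) m :=
  BaseTensor.map_tmul θ α hα _ a m

theorem push_smul (α : A →ₐ[k] B) (hα : ∀ h, α (θ h) = η h) (a : A) (s : BaseTensor θ M) :
    push α hα (a • s) = α a • push α hα s :=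
  BaseTensor.map_smul θ α hα _ a s

theorem push_push (α : A →ₐ[k] B) (hα : ∀ h, α (θ h) = η h) (β : B →ₐ[k] C)
    (hβ : ∀ h, β (η h) = ζ h) (s : BaseTensor θ M) :
    push β hβ (push α hα s) = push (β.comp α) (fun h => by rw [AlgHom.comp_apply, hα, hβ]) s :=
  BaseTensor.map_map α hα β hβ _ _ s

theorem push_id (hα : ∀ h, AlgHom.id k A (θ h) = θ h) (s : BaseTensor θ M) :
    push (AlgHom.id k A) hα s = s :=
  BaseTensor.map_id θ s

theorem push_congr {α β : A →ₐ[k] B} (hα : ∀ h, α (θ h) = η h) (h : α = β) (s : BaseTensor θ M) :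
    push α hα s = push β (by rw [← h]; exact hα) s := by
  subst h; rfl

/-- Base change along an isomorphism is injective. -/
theorem push_injective (α : A →ₐ[k] B) (hα : ∀ h, α (θ h) = η h) (β : B →ₐ[k] A)
    (hβ : β.comp α = AlgHom.id k A) :
    Function.Injective (push α hα : BaseTensor θ M →ₗ[k] BaseTensor η M) := by
  have h1 : ∀ h, β (η h) = θ h := fun h => by
    rw [← hα, ← AlgHom.comp_apply, hβ, AlgHom.id_apply]
  refine Function.LeftInverse.injective (g := push β h1) fun s => ?_
  rw [push_push, push_congr _ hβ, push_id]

end Push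

/-! ### Polylinear maps on generalised elements -/

section Pair

variable {k H A B C D E : Type*} [Field k] [Ring H] [HopfAlgebra k H]
  [Ring A] [Algebra k A] [Ring B] [Algebra k B] [Ring C] [Algebra k C] [Ring D] [Algebra k D]

/-- The product `h ↦ ∑ θ(h₍₁₎) ⊗ η(h₍₂₎)` of two algebra maps out of `H`. -/
def boxHom (θ : H →ₐ[k] A) (η : H →ₐ[k] B) : H →ₐ[k] A ⊗[k] B :=
  (Algebra.TensorProduct.map θ η).comp (comul2 k H)

theorem boxHom_apply (θ : H →ₐ[k] A) (η : H →ₐ[k] B) (h : H) :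
    boxHom θ η h = Algebra.TensorProduct.map θ η (comul2 k H h) := rfl

theorem map_comul2 (θ : H →ₐ[k] A) (η : H →ₐ[k] B) (h : H) :
    Algebra.TensorProduct.map θ η (comul2 k H h) = boxHom θ η h := rfl

theorem apply_id (θ : H →ₐ[k] A) (h : H) : θ (AlgHom.id k H h) = θ h := rfl

theorem boxHom_id_comul2 (h : H) :
    AlgHom.id k (H3 k H) (boxHom (AlgHom.id k H) (comul2 k H) h) = comul3 k H h := rfl

theorem id_comul2 (h : H) :
    AlgHom.id k (H2 k H) (comul2 k H h) = boxHom (AlgHom.id k H) (AlgHom.id k H) h := by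
  rw [boxHom_apply, Algebra.TensorProduct.map_id]

theorem map_boxHom {θ : H →ₐ[k] A} {η : H →ₐ[k] B} {θ' : H →ₐ[k] C} {η' : H →ₐ[k] D}
    {α : A →ₐ[k] C} {β : B →ₐ[k] D} (hα : ∀ h, α (θ h) = θ' h) (hβ : ∀ h, β (η h) = η' h) (h : H) :
    Algebra.TensorProduct.map α β (boxHom θ η h) = boxHom θ' η' h := by
  obtain rfl : α.comp θ = θ' := AlgHom.ext hα
  obtain rfl : β.comp η = η' := AlgHom.ext hβ
  rw [boxHom_apply, boxHom_apply, Algebra.TensorProduct.map_comp]; rfl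

theorem comm_boxHom [Coalgebra.IsCocomm k H] (θ : H →ₐ[k] A) (η : H →ₐ[k] B) (h : H) :
    (Algebra.TensorProduct.comm k A B).toAlgHom (boxHom θ η h) = boxHom η θ h := by
  have h1 : ∀ x : H2 k H, (Algebra.TensorProduct.comm k A B).toAlgHom
      (Algebra.TensorProduct.map θ η x) =
      Algebra.TensorProduct.map η θ (flip2 k H x) := by
    intro x
    induction x using TensorProduct.induction_on with
    | zero => simp
    | tmul a b => simp [flip2]
    | add s t hs ht => simp only [map_add, hs, ht]
  rw [boxHom_apply, h1, flip2_comul, boxHom_apply]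

theorem assoc_boxHom (θ : H →ₐ[k] A) (η : H →ₐ[k] B) (ζ : H →ₐ[k] C) (h : H) :
    (Algebra.TensorProduct.assoc k k k A B C).toAlgHom (boxHom (boxHom θ η) ζ h) =
      boxHom θ (boxHom η ζ) h := by
  have h1 : ∀ x : H2 k H, (Algebra.TensorProduct.assoc k k k A B C).toAlgHom
      (Algebra.TensorProduct.map (boxHom θ η) ζ x) =
      Algebra.TensorProduct.map θ (Algebra.TensorProduct.map η ζ) (comulId k H x) := by
    intro x
    induction x using TensorProduct.induction_on with
    | zero => simp
    | tmul a b =>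
      have h2 : ∀ y : H2 k H, (Algebra.TensorProduct.assoc k k k A B C)
          (Algebra.TensorProduct.map θ η y ⊗ₜ ζ b) =
          Algebra.TensorProduct.map θ (Algebra.TensorProduct.map η ζ)
            (Algebra.TensorProduct.assoc k k k H H H (y ⊗ₜ b)) := by
        intro y
        induction y using TensorProduct.induction_on with
        | zero => simp
        | tmul a b => simp
        | add s t hs ht => simp only [map_add, TensorProduct.add_tmul, hs, ht]
      simpa [comulId, boxHom_apply] using h2 _
    | add s t hs ht => simp only [map_add, hs, ht]
  have h3 : ∀ x : H2 k H, Algebra.TensorProduct.map θ (Algebra.TensorProduct.map η ζ)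
      (idComul k H x) = Algebra.TensorProduct.map θ (boxHom η ζ) x := by
    intro x
    induction x using TensorProduct.induction_on with
    | zero => simp
    | tmul a b => simp [idComul, boxHom_apply]
    | add s t hs ht => simp only [map_add, hs, ht]
  rw [boxHom_apply, h1, comulId_comul, ← idComul_comul, h3, boxHom_apply]

theorem assoc_symm_boxHom (θ : H →ₐ[k] A) (η : H →ₐ[k] B) (ζ : H →ₐ[k] C) (h : H) :
    (Algebra.TensorProduct.assoc k k k A B C).symm.toAlgHom (boxHom θ (boxHom η ζ) h) =
      boxHom (boxHom θ η) ζ h := by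
  rw [← assoc_boxHom]
  exact (Algebra.TensorProduct.assoc k k k A B C).symm_apply_apply _

variable {U V Z : Type*}
  [AddCommGroup U] [Module k U] [Module H U] [IsScalarTower k H U]
  [AddCommGroup V] [Module k V] [Module H V] [IsScalarTower k H V]
  [AddCommGroup Z] [Module k Z] [Module H Z] [IsScalarTower k H Z]

/-- `(H ⊗ H) ⊗_H Z → (A ⊗ B) ⊗_H Z`. -/
def pushBox (θ : H →ₐ[k] A) (η : H →ₐ[k] B) : PT2 k H Z →ₗ[k] BaseTensor (boxHom θ η) Z :=
  push (Algebra.TensorProduct.map θ η) (map_comul2 θ η)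

/-- The bilinear map behind `pair`, for a fixed element `x ⊗_H u` on the left. -/
def pairAux (φ : Lin2 k H U V Z) (θ : H →ₐ[k] A) (η : H →ₐ[k] B) (x : A) (u : U) :
    BaseTensor η V →ₗ[k] BaseTensor (boxHom θ η) Z :=
  BaseTensor.lift η
    (((Algebra.lsmul k k (BaseTensor (boxHom θ η) Z)).toLinearMap ∘ₗ
      TensorProduct.mk k A B x).compl₂ (pushBox θ η ∘ₗ φ.toFun u))
    (fun y h v => by
      change (x ⊗ₜ[k] (y * η h)) • pushBox θ η (φ.toFun u v) =
        (x ⊗ₜ[k] y) • pushBox θ η (φ.toFun u (h • v))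
      rw [Lin2.smul_right, pushBox, push_smul, ← mul_smul]
      simp)

theorem pairAux_tmul (φ : Lin2 k H U V Z) (θ : H →ₐ[k] A) (η : H →ₐ[k] B) (x : A) (u : U)
    (y : B) (v : V) :
    pairAux φ θ η x u (BaseTensor.tmul η y v) = (x ⊗ₜ[k] y) • pushBox θ η (φ.toFun u v) :=
  BaseTensor.lift_tmul _ _ _ _ _

/-- The extension of a polylinear map `φ` to generalised elements:
`(x ⊗_H u, y ⊗_H v) ↦ (x ⊗ y) φ(u, v)`, with values in `(A ⊗ B) ⊗_H Z`. Both composition rules of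
pseudobrackets are instances of it. -/
def pair (φ : Lin2 k H U V Z) {θ : H →ₐ[k] A} {η : H →ₐ[k] B} :
    BaseTensor θ U →ₗ[k] BaseTensor η V →ₗ[k] BaseTensor (boxHom θ η) Z :=
  BaseTensor.lift θ
    (LinearMap.mk₂ k (pairAux φ θ η)
      (fun x x' u => by
        ext t
        induction t using BaseTensor.induction with
        | h0 => simp
        | ht y v => simp only [LinearMap.add_apply, pairAux_tmul, TensorProduct.add_tmul, add_smul]
        | ha s t hs ht => simp only [map_add, hs, ht])
      (fun c x u => by
        ext t
        induction t using BaseTensor.induction with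
        | h0 => simp
        | ht y v =>
          simp only [LinearMap.smul_apply, pairAux_tmul, ← TensorProduct.smul_tmul', smul_assoc]
        | ha s t hs ht => simp only [map_add, hs, ht])
      (fun x u u' => by
        ext t
        induction t using BaseTensor.induction with
        | h0 => simp
        | ht y v => simp only [LinearMap.add_apply, pairAux_tmul, map_add, smul_add]
        | ha s t hs ht => simp only [map_add, hs, ht])
      (fun c x u => by
        ext t
        induction t using BaseTensor.induction with
        | h0 => simp
        | ht y v => simp only [LinearMap.smul_apply, pairAux_tmul, map_smul, smul_comm c]
        | ha s t hs ht => simp only [map_add, hs, ht]))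
    (fun x h u => by
      ext t
      induction t using BaseTensor.induction with
      | h0 => simp
      | ht y v =>
        simp only [LinearMap.mk₂_apply, pairAux_tmul]
        rw [Lin2.smul_left, pushBox, push_smul, ← mul_smul]
        simp
      | ha s t hs ht => simp only [map_add, hs, ht])

section
variable (φ : Lin2 k H U V Z) {θ : H →ₐ[k] A} {η : H →ₐ[k] B}

theorem pair_tmul (x : A) (u : U) (y : B) (v : V) :
    pair φ (BaseTensor.tmul θ x u) (BaseTensor.tmul η y v) =
      (x ⊗ₜ[k] y) • pushBox θ η (φ.toFun u v) := by
  rw [pair, BaseTensor.lift_tmul, LinearMap.mk₂_apply, pairAux_tmul]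

theorem pair_smul (x : A) (y : B) (s : BaseTensor θ U) (t : BaseTensor η V) :
    pair φ (x • s) (y • t) = (x ⊗ₜ[k] y) • pair φ s t := by
  induction s using BaseTensor.induction with
  | h0 => simp
  | ht a u =>
    induction t using BaseTensor.induction with
    | h0 => simp
    | ht b v => simp only [BaseTensor.smul_tmul, pair_tmul, ← mul_smul,
        Algebra.TensorProduct.tmul_mul_tmul]
    | ha s t hs ht => simp only [smul_add, map_add, hs, ht]
  | ha s t hs ht => simp only [smul_add, map_add, LinearMap.add_apply, hs, ht]

/-- Naturality of `pair` in the algebras and in the modules. -/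
theorem pair_map {U' V' Z' : Type*}
    [AddCommGroup U'] [Module k U'] [Module H U'] [IsScalarTower k H U']
    [AddCommGroup V'] [Module k V'] [Module H V'] [IsScalarTower k H V']
    [AddCommGroup Z'] [Module k Z'] [Module H Z'] [IsScalarTower k H Z']
    (φ' : Lin2 k H U' V' Z') (f : U →ₗ[H] U') (g : V →ₗ[H] V') (l : Z →ₗ[H] Z')
    (hφ : ∀ u v, φ'.toFun (f u) (g v) = PT2.map k H l (φ.toFun u v))
    {θ' : H →ₐ[k] C} {η' : H →ₐ[k] D} (α : A →ₐ[k] C) (hα : ∀ h, α (θ h) = θ' h)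
    (β : B →ₐ[k] D) (hβ : ∀ h, β (η h) = η' h) (s : BaseTensor θ U) (t : BaseTensor η V) :
    pair φ' (BaseTensor.map θ α hα f s) (BaseTensor.map η β hβ g t) =
      BaseTensor.map _ (Algebra.TensorProduct.map α β) (map_boxHom hα hβ) l (pair φ s t) := by
  induction s using BaseTensor.induction with
  | h0 => simp
  | ht a u =>
    induction t using BaseTensor.induction with
    | h0 => simp
    | ht b v =>
      simp only [BaseTensor.map_tmul, pair_tmul, BaseTensor.map_smul, hφ, pushBox,
        Algebra.TensorProduct.map_tmul]
      congr 1
      generalize φ.toFun u v = w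
      obtain rfl : α.comp θ = θ' := AlgHom.ext hα
      obtain rfl : β.comp η = η' := AlgHom.ext hβ
      induction w using BaseTensor.induction with
      | h0 => simp only [map_zero]
      | ht c m =>
        rw [PT2.map, BaseTensor.map_tmul, push_tmul, push_tmul, BaseTensor.map_tmul,
          Algebra.TensorProduct.map_comp]
        rfl
      | ha s t hs ht => simp only [map_add, hs, ht]
    | ha s t hs ht => simp only [map_add, hs, ht]
  | ha s t hs ht => simp only [map_add, LinearMap.add_apply, hs, ht]

theorem pair_push {θ' : H →ₐ[k] C} {η' : H →ₐ[k] D} (α : A →ₐ[k] C) (hα : ∀ h, α (θ h) = θ' h)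
    (β : B →ₐ[k] D) (hβ : ∀ h, β (η h) = η' h) (s : BaseTensor θ U) (t : BaseTensor η V) :
    pair φ (push α hα s) (push β hβ t) =
      push (Algebra.TensorProduct.map α β) (map_boxHom hα hβ) (pair φ s t) :=
  pair_map φ φ LinearMap.id LinearMap.id LinearMap.id (fun _ _ => (BaseTensor.map_id _ _).symm) α hα β hβ s t

theorem pair_push_left {θ' : H →ₐ[k] C} (α : A →ₐ[k] C) (hα : ∀ h, α (θ h) = θ' h)
    (s : BaseTensor θ U) (t : BaseTensor η V) :
    pair φ (push α hα s) t =
      push (Algebra.TensorProduct.map α (AlgHom.id k B)) (map_boxHom hα (BaseTensor.id_comp η))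
        (pair φ s t) := by
  rw [← pair_push φ α hα (AlgHom.id k B) (BaseTensor.id_comp η), push_id]

theorem pair_push_right {η' : H →ₐ[k] D}
    (β : B →ₐ[k] D) (hβ : ∀ h, β (η h) = η' h) (s : BaseTensor θ U) (t : BaseTensor η V) :
    pair φ s (push β hβ t) =
      push (Algebra.TensorProduct.map (AlgHom.id k A) β) (map_boxHom (BaseTensor.id_comp θ) hβ)
        (pair φ s t) := by
  rw [← pair_push φ (AlgHom.id k A) (BaseTensor.id_comp θ) β hβ, push_id]

end

variable (k H) in
/-- An element of `M` as the generalised element `1 ⊗_H m` of `H ⊗_H M`. -/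
def pt (u : U) : BaseTensor (AlgHom.id k H) U := BaseTensor.tmul _ 1 u

theorem tmul_eq_smul_push (θ : H →ₐ[k] A) (x : A) (u : U) :
    BaseTensor.tmul θ x u = x • push θ (apply_id θ) (pt k H u) := by
  rw [pt, push_tmul, BaseTensor.smul_tmul, map_one, mul_one]

theorem pair_pt (φ : Lin2 k H U V Z) (u : U) (v : V) :
    pair φ (pt k H u) (pt k H v) = push (AlgHom.id k (H2 k H)) id_comul2 (φ.toFun u v) := by
  rw [pt, pt, pair_tmul, ← Algebra.TensorProduct.one_def, one_smul, pushBox]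
  exact push_congr _ (Algebra.TensorProduct.map_id) _

/-- A symmetry `ψ(v, u) = c (σ ⊗_H id) φ(u, v)` on elements holds for generalised elements. -/
theorem pair_comm [Coalgebra.IsCocomm k H] (φ : Lin2 k H U V Z) (ψ : Lin2 k H V U Z) (c : k)
    (hc : ∀ u v, ψ.toFun v u = c • PT2.flip k H (φ.toFun u v))
    {θ : H →ₐ[k] A} {η : H →ₐ[k] B} (s : BaseTensor θ U) (t : BaseTensor η V) :
    pair ψ t s = c • push (Algebra.TensorProduct.comm k A B).toAlgHom (comm_boxHom θ η)
      (pair φ s t) := by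
  induction s using BaseTensor.induction with
  | h0 => simp
  | ht a u =>
    induction t using BaseTensor.induction with
    | h0 => simp
    | ht b v =>
      simp only [pair_tmul, push_smul, hc, map_smul, smul_comm c]
      congr 1
      have e : ∀ w : PT2 k H Z, PT2.flip k H w = push (flip2 k H) (flip2_comul k H) w :=
        fun _ => rfl
      rw [e, pushBox, pushBox, push_push, push_push]
      refine congrArg _ (push_congr _ ?_ _)
      ext <;> simp [flip2]
    | ha s t hs ht => simp only [map_add, LinearMap.add_apply, hs, ht, smul_add]
  | ha s t hs ht => simp only [map_add, LinearMap.add_apply, hs, ht, smul_add]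

/-- `compRight` as a linear map. -/
def compRightₗ (φ : Lin2 k H U V Z) (a : U) : PT2 k H V →ₗ[k] PT3 k H Z where
  toFun := φ.compRight a
  map_add' s t := map_add (BaseTensor.lift _ _ _) s t
  map_smul' c s := map_smul (BaseTensor.lift _ _ _) c s

/-- `compLeft` as a linear map. -/
def compLeftₗ (φ : Lin2 k H U V Z) (c : V) : PT2 k H U →ₗ[k] PT3 k H Z where
  toFun s := φ.compLeft s c
  map_add' s t := map_add (BaseTensor.lift _ _ _) s t
  map_smul' c s := map_smul (BaseTensor.lift _ _ _) c s

theorem compRight_eq_pair (φ : Lin2 k H U V Z) (a : U) (s : PT2 k H V) :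
    φ.compRight a s = push (AlgHom.id k (H3 k H)) boxHom_id_comul2 (pair φ (pt k H a) s) := by
  induction s using BaseTensor.induction with
  | h0 => simp only [map_zero]; exact map_zero (compRightₗ φ a)
  | ht x v =>
    rw [Lin2.compRight_tmul, pt, pair_tmul, push_smul, pushBox, push_push]
    rfl
  | ha s t hs ht =>
    simp only [map_add, ← hs, ← ht]
    exact map_add (compRightₗ φ a) s t

theorem comulId_boxHom_id (h : H) : (Algebra.TensorProduct.assoc k k k H H H).toAlgHom
    (boxHom (comul2 k H) (AlgHom.id k H) h) = comul3 k H h :=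
  Coalgebra.coassoc_apply h

theorem compLeft_eq_pair (φ : Lin2 k H U V Z) (s : PT2 k H U) (c : V) :
    φ.compLeft s c = push (Algebra.TensorProduct.assoc k k k H H H).toAlgHom comulId_boxHom_id
      (pair φ s (pt k H c)) := by
  induction s using BaseTensor.induction with
  | h0 => simp only [map_zero, LinearMap.zero_apply]; exact map_zero (compLeftₗ φ c)
  | ht x v =>
    rw [Lin2.compLeft_tmul, pt, pair_tmul, push_smul, pushBox, push_push]
    rfl
  | ha s t hs ht =>
    simp only [map_add, LinearMap.add_apply, ← hs, ← ht]
    exact map_add (compLeftₗ φ c) s t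

/-- An identity `(a * b) * c = a * (b * c)` between compositions of polylinear maps holds for
generalised elements. -/
theorem pair_assoc {W X Y : Type*} [AddCommGroup W] [Module k W] [Module H W] [IsScalarTower k H W]
    [AddCommGroup X] [Module k X] [Module H X] [IsScalarTower k H X]
    [AddCommGroup Y] [Module k Y] [Module H Y] [IsScalarTower k H Y]
    (φ : Lin2 k H U V X) (ψ : Lin2 k H X W Z) (φ' : Lin2 k H V W Y) (ψ' : Lin2 k H U Y Z)
    (h : ∀ a b c, ψ.compLeft (φ.toFun a b) c = ψ'.compRight a (φ'.toFun b c))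
    {θ : H →ₐ[k] A} {η : H →ₐ[k] B} {ζ : H →ₐ[k] C}
    (s : BaseTensor θ U) (t : BaseTensor η V) (r : BaseTensor ζ W) :
    push (Algebra.TensorProduct.assoc k k k A B C).toAlgHom (assoc_boxHom θ η ζ)
      (pair ψ (pair φ s t) r) = pair ψ' s (pair φ' t r) := by
  induction s using BaseTensor.induction with
  | h0 => simp
  | ha s t hs ht => simp only [map_add, LinearMap.add_apply, hs, ht]
  | ht x a =>
  induction t using BaseTensor.induction with
  | h0 => simp
  | ha s t hs ht => simp only [map_add, LinearMap.add_apply, hs, ht]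
  | ht y b =>
  induction r using BaseTensor.induction with
  | h0 => simp
  | ha s t hs ht => simp only [map_add, hs, ht]
  | ht z c =>
    have h1 := h a b c
    rw [compLeft_eq_pair, compRight_eq_pair] at h1
    rw [tmul_eq_smul_push θ, tmul_eq_smul_push η, tmul_eq_smul_push ζ, pair_smul, pair_smul,
      pair_smul, pair_smul, push_smul]
    have e1 : (Algebra.TensorProduct.assoc k k k A B C).toAlgHom ((x ⊗ₜ[k] y) ⊗ₜ[k] z) =
      x ⊗ₜ[k] (y ⊗ₜ[k] z) := rfl
    rw [e1]
    congr 1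
    rw [pair_push, pair_push, pair_push, pair_push, pair_pt, pair_pt, pair_push_left,
      pair_push_right]
    have h2 := congrArg (push (Algebra.TensorProduct.map θ (Algebra.TensorProduct.map η ζ))
      (fun h => (congrArg _ (boxHom_id_comul2 h).symm).trans
        (map_boxHom (apply_id θ) (map_comul2 η ζ) h))) h1
    rw [push_push, push_push] at h2
    simp only [push_push]
    refine Eq.trans (push_congr _ ?_ _) (h2.trans (push_congr _ ?_ _))
    · ext <;> simp [Algebra.TensorProduct.one_def]
    · ext <;> simp

end Pair

/-! ### Normal forms in the last tensor factor -/

section Normal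

open HopfAlgebra

variable {k H A B : Type*} [Field k] [Ring H] [HopfAlgebra k H]
  [Ring A] [Algebra k A] [Ring B] [Algebra k B]
  {M : Type*} [AddCommGroup M] [Module k M] [Module H M] [IsScalarTower k H M]

/-- The identity `∑ S(h₍₁₎) h₍₂₎ ⊗ h₍₃₎ = 1 ⊗ h`, with the outer product left as an arbitrary
linear map `Ψ`. -/
theorem lift_antipode_comul {P : Type*} [AddCommGroup P] [Module k P] (Ψ : H2 k H →ₗ[k] P) (h : H) :
    TensorProduct.lift (((LinearMap.mul k (H2 k H)).compl₁₂
      ((Algebra.TensorProduct.includeLeft : H →ₐ[k] H2 k H).toLinearMap ∘ₗ antipode k)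
      (comul2 k H).toLinearMap).compr₂ Ψ) (comul2 k H h) = Ψ (1 ⊗ₜ[k] h) := by
  let F : H3 k H →ₗ[k] H2 k H := TensorProduct.lift ((LinearMap.mul k (H2 k H)).compl₁₂
      ((Algebra.TensorProduct.includeLeft : H →ₐ[k] H2 k H).toLinearMap ∘ₗ antipode k)
      LinearMap.id)
  have h1 : ∀ x : H2 k H, TensorProduct.lift (((LinearMap.mul k (H2 k H)).compl₁₂
      ((Algebra.TensorProduct.includeLeft : H →ₐ[k] H2 k H).toLinearMap ∘ₗ antipode k)
      (comul2 k H).toLinearMap).compr₂ Ψ) x = Ψ (F (idComul k H x)) := by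
    intro x
    induction x using TensorProduct.induction_on with
    | zero => simp
    | tmul a b => simp [F, idComul]
    | add s t hs ht => simp only [map_add, hs, ht]
  have h2 : ∀ x : H2 k H, F (comulId k H x) =
      1 ⊗ₜ[k] (TensorProduct.lid k H (LinearMap.rTensor H Coalgebra.counit x)) := by
    intro x
    induction x using TensorProduct.induction_on with
    | zero => simp
    | add s t hs ht => simp only [map_add, hs, ht, TensorProduct.tmul_add]
    | tmul a b =>
      have h3 : ∀ y : H2 k H, F (Algebra.TensorProduct.assoc k k k H H H (y ⊗ₜ[k] b)) =
          (LinearMap.mul' k H (LinearMap.rTensor H (antipode k) y)) ⊗ₜ[k] b := by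
        intro y
        induction y using TensorProduct.induction_on with
        | zero => simp
        | tmul a b => simp [F]
        | add s t hs ht => simp only [map_add, TensorProduct.add_tmul, hs, ht]
      have h4 : comulId k H (a ⊗ₜ[k] b) =
          Algebra.TensorProduct.assoc k k k H H H ((Coalgebra.comul a) ⊗ₜ[k] b) := by
        simp [comulId]
      rw [h4, h3, mul_antipode_rTensor_comul_apply]
      simp [Algebra.algebraMap_eq_smul_one, TensorProduct.smul_tmul]
  have h5 : LinearMap.rTensor H Coalgebra.counit (comul2 k H h) = (1 : k) ⊗ₜ[k] h :=
    Coalgebra.rTensor_counit_comul h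
  rw [h1, idComul_comul, ← comulId_comul, h2, h5, TensorProduct.lid_tmul, one_smul]

/-- The bilinear form of the sum `∑ (x θ(S(h₍₁₎)) ⊗ 1) ⊗_H h₍₂₎ m`. -/
def normalAux (θ : H →ₐ[k] A) (x : A) (m : M) :
    H2 k H →ₗ[k] BaseTensor (boxHom θ (AlgHom.id k H)) M :=
  TensorProduct.lift ((BaseTensor.tmulₗ (boxHom θ (AlgHom.id k H)) M).compl₁₂
    ((Algebra.TensorProduct.includeLeft : A →ₐ[k] A ⊗[k] H).toLinearMap ∘ₗ LinearMap.mulLeft k x ∘ₗ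
      θ.toLinearMap ∘ₗ antipode k)
    (((Algebra.lsmul k k M : H →ₐ[k] Module.End k M).toLinearMap.flip m)))

theorem normalAux_tmul (θ : H →ₐ[k] A) (x : A) (m : M) (a b : H) :
    normalAux θ x m (a ⊗ₜ[k] b) =
      BaseTensor.tmul (boxHom θ (AlgHom.id k H)) ((x * θ (antipode k a)) ⊗ₜ[k] 1) (b • m) := rfl

/-- Every element of `(A ⊗ H) ⊗_H M` can be normalised in the last tensor factor:
`(x ⊗ h) ⊗_H m = ∑ (x θ(S(h₍₁₎)) ⊗ 1) ⊗_H h₍₂₎ m`. -/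
theorem tmul_eq_normalAux (θ : H →ₐ[k] A) (x : A) (h : H) (m : M) :
    BaseTensor.tmul (boxHom θ (AlgHom.id k H)) (x ⊗ₜ[k] h) m =
      normalAux θ x m (comul2 k H h) := by
  let Ψ : H2 k H →ₗ[k] BaseTensor (boxHom θ (AlgHom.id k H)) M :=
    (BaseTensor.tmulₗ (boxHom θ (AlgHom.id k H)) M).flip m ∘ₗ
      LinearMap.mulLeft k (x ⊗ₜ[k] 1) ∘ₗ
      (Algebra.TensorProduct.map θ (AlgHom.id k H)).toLinearMap
  have hΨ : ∀ y, Ψ y = BaseTensor.tmul (boxHom θ (AlgHom.id k H))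
    ((x ⊗ₜ[k] 1) * Algebra.TensorProduct.map θ (AlgHom.id k H) y) m := fun _ => rfl
  have h1 := lift_antipode_comul Ψ h
  rw [hΨ] at h1
  have h2 : (x ⊗ₜ[k] (1 : H)) * Algebra.TensorProduct.map θ (AlgHom.id k H) (1 ⊗ₜ[k] h) =
    x ⊗ₜ[k] h := by simp
  rw [← h2, ← h1]
  generalize comul2 k H h = y
  induction y using TensorProduct.induction_on with
  | zero => simp
  | add s t hs ht => simp only [map_add, hs, ht]
  | tmul a b =>
    rw [TensorProduct.lift.tmul]
    simp only [LinearMap.compr₂_apply, LinearMap.compl₁₂_apply, LinearMap.mul_apply', hΨ]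
    rw [map_mul, normalAux_tmul, ← BaseTensor.mul_tmul, ← mul_assoc, boxHom_apply]
    simp

variable (k H) in
/-- The underlying scalar of an element of the trivial module. -/
def Triv.toBase : Triv k H ≃ₗ[k] k := LinearEquiv.refl k k

/-- The identification of `(A ⊗ H) ⊗_H k` with `A`, `(x ⊗ h) ⊗_H c ↦ c x θ(S(h))`. -/
def resid (θ : H →ₐ[k] A) : BaseTensor (boxHom θ (AlgHom.id k H)) (Triv k H) →ₗ[k] A :=
  BaseTensor.lift _
    (((LinearMap.lsmul k A).flip ∘ₗ
      TensorProduct.lift ((LinearMap.mul k A).compl₂ (θ.toLinearMap ∘ₗ antipode k))).compl₂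
      (Triv.toBase k H).toLinearMap)
    (fun y h c => by
      have h1 : ∀ w : H2 k H, ∀ y : A ⊗[k] H,
          TensorProduct.lift ((LinearMap.mul k A).compl₂ (θ.toLinearMap ∘ₗ antipode k))
            (y * Algebra.TensorProduct.map θ (AlgHom.id k H) w) =
          TensorProduct.lift ((LinearMap.mul k A).compl₂ (LinearMap.mulLeft k
            (θ (LinearMap.mul' k H (LinearMap.lTensor H (antipode k) w))) ∘ₗ
              (θ.toLinearMap ∘ₗ antipode k))) y := by
        intro w y
        induction y using TensorProduct.induction_on with
        | zero => simp
        | add s t hs ht => simp only [add_mul, map_add, hs, ht]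
        | tmul x g =>
          induction w using TensorProduct.induction_on with
          | zero => simp
          | add s t hs ht => simp only [mul_add, map_add, hs, ht]; simp [mul_add, add_mul]
          | tmul a b => simp [antipode_mul_antidistrib, mul_assoc]
      change (Triv.toBase k H) c • TensorProduct.lift
          ((LinearMap.mul k A).compl₂ (θ.toLinearMap ∘ₗ antipode k)) (y * boxHom θ _ h) =
        (Triv.toBase k H) (h • c) • TensorProduct.lift
          ((LinearMap.mul k A).compl₂ (θ.toLinearMap ∘ₗ antipode k)) y
      rw [boxHom_apply, h1, Triv.smul_def, map_smul]
      have h2 : LinearMap.mul' k H (LinearMap.lTensor H (antipode k) (comul2 k H h)) =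
        algebraMap k H (Coalgebra.counit h) := mul_antipode_lTensor_comul_apply h
      rw [h2, AlgHom.commutes]
      induction y using TensorProduct.induction_on with
      | zero => simp
      | add s t hs ht => simp only [map_add, smul_add, hs, ht]
      | tmul x g => simp [Algebra.algebraMap_eq_smul_one, smul_smul, mul_comm])

theorem resid_tmul (θ : H →ₐ[k] A) (x : A) (h : H) :
    resid θ (BaseTensor.tmul _ (x ⊗ₜ[k] h) (Triv.one k H)) = x * θ (antipode k h) := by
  rw [resid, BaseTensor.lift_tmul]
  exact one_smul k _

theorem Triv.eq_smul_one (c : Triv k H) : c = (show k from c) • Triv.one k H :=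
  (mul_one (show k from c)).symm

theorem resid_one (θ : H →ₐ[k] A) (x : A) :
    resid θ (BaseTensor.tmul _ (x ⊗ₜ[k] 1) (Triv.one k H)) = x := by
  rw [resid_tmul, antipode_one, map_one, mul_one]

/-- Every element of `(A ⊗ H) ⊗_H k` is of the form `(x ⊗ 1) ⊗_H 1`. -/
theorem eq_tmul_resid (θ : H →ₐ[k] A)
    (s : BaseTensor (boxHom θ (AlgHom.id k H)) (Triv k H)) :
    s = BaseTensor.tmul _ (resid θ s ⊗ₜ[k] 1) (Triv.one k H) := by
  induction s using BaseTensor.induction with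
  | h0 => simp [BaseTensor.zero_tmul]
  | ha s t hs ht => rw [map_add, TensorProduct.add_tmul, BaseTensor.add_tmul, ← hs, ← ht]
  | ht y c =>
    rw [Triv.eq_smul_one c, BaseTensor.tmul_smul, map_smul, ← TensorProduct.smul_tmul',
      BaseTensor.smul_tmul_base]
    congr 1
    induction y using TensorProduct.induction_on with
    | zero => simp [BaseTensor.zero_tmul]
    | add s t hs ht =>
      rw [BaseTensor.add_tmul, map_add, TensorProduct.add_tmul, BaseTensor.add_tmul, ← hs, ← ht]
    | tmul x h =>
      rw [resid_tmul, tmul_eq_normalAux]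
      have h1 : ∀ w : H2 k H, normalAux θ x (Triv.one k H) w =
          BaseTensor.tmul _ ((x * θ (antipode k (TensorProduct.rid k H
            (LinearMap.lTensor H Coalgebra.counit w)))) ⊗ₜ[k] 1) (Triv.one k H) := by
        intro w
        induction w using TensorProduct.induction_on with
        | zero => simp [BaseTensor.zero_tmul]
        | add s t hs ht => simp only [map_add, hs, ht, mul_add, TensorProduct.add_tmul,
            BaseTensor.add_tmul]
        | tmul a b =>
          rw [normalAux_tmul, Triv.smul_def, BaseTensor.tmul_smul, ← BaseTensor.smul_tmul_base]
          simp [TensorProduct.smul_tmul']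
      have h5 : LinearMap.lTensor H Coalgebra.counit (comul2 k H h) = h ⊗ₜ[k] (1 : k) :=
        Coalgebra.lTensor_counit_comul h
      rw [h1, h5]
      simp

theorem tmul_one_injective (θ : H →ₐ[k] A) :
    Function.Injective (fun x : A => BaseTensor.tmul (boxHom θ (AlgHom.id k H))
      (x ⊗ₜ[k] 1) (Triv.one k H)) :=
  Function.LeftInverse.injective (g := resid θ) fun x => resid_one θ x

theorem resid_smul (θ : H →ₐ[k] A) (x : A) (h : H)
    (s : BaseTensor (boxHom θ (AlgHom.id k H)) (Triv k H)) :
    resid θ ((x ⊗ₜ[k] h) • s) = x * resid θ s * θ (antipode k h) := by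
  conv_lhs => rw [eq_tmul_resid θ s]
  rw [BaseTensor.smul_tmul, Algebra.TensorProduct.tmul_mul_tmul, mul_one, resid_tmul]

/-! ### Elements of `(H ⊗ H) ⊗_H k` and `(H ⊗ H ⊗ H) ⊗_H k` as elements of `H` and `H ⊗ H` -/

variable (k H) in
/-- The identification of `(H ⊗ H) ⊗_H k` with `H`, `(f ⊗ g) ⊗_H 1 ↦ f S(g)`. -/
def scalar2 : PT2 k H (Triv k H) →ₗ[k] H :=
  resid (AlgHom.id k H) ∘ₗ push (AlgHom.id k (H2 k H)) id_comul2

theorem scalar2_tmul (f g : H) :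
    scalar2 k H (BaseTensor.tmul _ (f ⊗ₜ[k] g) (Triv.one k H)) = f * antipode k g := by
  rw [scalar2, LinearMap.comp_apply, push_tmul, AlgHom.id_apply, resid_tmul, AlgHom.id_apply]

theorem scalar2_one (f : H) :
    scalar2 k H (BaseTensor.tmul _ (f ⊗ₜ[k] 1) (Triv.one k H)) = f := by
  rw [scalar2_tmul, antipode_one, mul_one]

theorem eq_tmul_scalar2 (w : PT2 k H (Triv k H)) :
    w = BaseTensor.tmul _ (scalar2 k H w ⊗ₜ[k] 1) (Triv.one k H) := by
  apply push_injective (AlgHom.id k (H2 k H)) id_comul2 (AlgHom.id k (H2 k H)) rfl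
  rw [push_tmul]
  exact eq_tmul_resid _ _

theorem scalar2_injective : Function.Injective (scalar2 k H) := fun s t h => by
  rw [eq_tmul_scalar2 s, eq_tmul_scalar2 t, h]

theorem scalar2_smul (f g : H) (w : PT2 k H (Triv k H)) :
    scalar2 k H ((f ⊗ₜ[k] g : H2 k H) • w) = f * scalar2 k H w * antipode k g := by
  conv_lhs => rw [eq_tmul_scalar2 w]
  rw [BaseTensor.smul_tmul, Algebra.TensorProduct.tmul_mul_tmul, mul_one, scalar2_tmul]

theorem scalar2_flip [Coalgebra.IsCocomm k H] (w : PT2 k H (Triv k H)) :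
    scalar2 k H (PT2.flip k H w) = antipode k (scalar2 k H w) := by
  have h1 : PT2.flip k H (BaseTensor.tmul _ (scalar2 k H w ⊗ₜ[k] 1) (Triv.one k H)) =
    BaseTensor.tmul _ ((1 : H) ⊗ₜ[k] scalar2 k H w) (Triv.one k H) :=
      BaseTensor.map_tmul _ _ _ _ _ _
  conv_lhs => rw [eq_tmul_scalar2 w]
  rw [h1, scalar2_tmul, one_mul]

theorem assoc_symm_comul3 (h : H) : (Algebra.TensorProduct.assoc k k k H H H).symm.toAlgHom
    (comul3 k H h) = boxHom (comul2 k H) (AlgHom.id k H) h := by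
  rw [← comulId_boxHom_id]
  exact (Algebra.TensorProduct.assoc k k k H H H).symm_apply_apply _

variable (k H) in
/-- The identification of `(H ⊗ H ⊗ H) ⊗_H k` with `H ⊗ H`, `(x ⊗ h) ⊗_H 1 ↦ x Δ(S(h))`. -/
def scalar3 : PT3 k H (Triv k H) →ₗ[k] H2 k H :=
  resid (comul2 k H) ∘ₗ push (Algebra.TensorProduct.assoc k k k H H H).symm.toAlgHom
    assoc_symm_comul3

theorem assoc_symm_incl12 (x : H2 k H) : (Algebra.TensorProduct.assoc k k k H H H).symm.toAlgHom
    (incl12 k H x) = x ⊗ₜ[k] 1 :=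
  (Algebra.TensorProduct.assoc k k k H H H).symm_apply_apply (x ⊗ₜ[k] 1)

theorem scalar3_one (x : H2 k H) :
    scalar3 k H (BaseTensor.tmul _ (incl12 k H x) (Triv.one k H)) = x := by
  rw [scalar3, LinearMap.comp_apply, push_tmul, assoc_symm_incl12, resid_one]

theorem eq_tmul_scalar3 (w : PT3 k H (Triv k H)) :
    w = BaseTensor.tmul _ (incl12 k H (scalar3 k H w)) (Triv.one k H) := by
  apply push_injective (Algebra.TensorProduct.assoc k k k H H H).symm.toAlgHom assoc_symm_comul3
    (Algebra.TensorProduct.assoc k k k H H H).toAlgHom (by ext <;> simp)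
  rw [push_tmul, assoc_symm_incl12]
  exact eq_tmul_resid _ _

theorem scalar3_injective : Function.Injective (scalar3 k H) := fun s t h => by
  rw [eq_tmul_scalar3 s, eq_tmul_scalar3 t, h]

theorem scalar3_smul (f g h : H) (w : PT3 k H (Triv k H)) :
    scalar3 k H ((f ⊗ₜ[k] (g ⊗ₜ[k] h) : H3 k H) • w) =
      (f ⊗ₜ[k] g) * scalar3 k H w * comul2 k H (antipode k h) := by
  have h1 : (Algebra.TensorProduct.assoc k k k H H H).symm.toAlgHom (f ⊗ₜ[k] (g ⊗ₜ[k] h)) =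
    (f ⊗ₜ[k] g) ⊗ₜ[k] h := rfl
  rw [scalar3, LinearMap.comp_apply, push_smul, h1, resid_smul, LinearMap.comp_apply]

/-! ### Coordinates with respect to a pseudo-form -/

variable {U V : Type*} [AddCommGroup U] [Module k U] [Module H U] [IsScalarTower k H U]
  [AddCommGroup V] [Module k V] [Module H V] [IsScalarTower k H V]

/-- The element `c ∈ H` with `φ(u, v) = (c ⊗ 1) ⊗_H 1`. -/
def coord (φ : Lin2 k H U V (Triv k H)) : U →ₗ[k] V →ₗ[k] H := φ.toFun.compr₂ (scalar2 k H)

variable (φ : Lin2 k H U V (Triv k H))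

theorem coord_apply (u : U) (v : V) : coord φ u v = scalar2 k H (φ.toFun u v) := rfl

theorem eq_tmul_coord (u : U) (v : V) :
    φ.toFun u v = BaseTensor.tmul _ (coord φ u v ⊗ₜ[k] 1) (Triv.one k H) :=
  eq_tmul_scalar2 _

theorem coord_smul_left (h : H) (u : U) (v : V) : coord φ (h • u) v = h * coord φ u v := by
  rw [coord_apply, Lin2.smul_left, scalar2_smul, antipode_one, mul_one, coord_apply]

theorem coord_smul_right (h : H) (u : U) (v : V) :
    coord φ u (h • v) = coord φ u v * antipode k h := by
  rw [coord_apply, Lin2.smul_right, scalar2_smul, one_mul, coord_apply]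

/-- The coordinate of a generalised element: `x ⊗_H u ↦ x θ(c)` if `φ(u, v) = (c ⊗ 1) ⊗_H 1`. -/
def contract (v : V) {θ : H →ₐ[k] A} : BaseTensor θ U →ₗ[k] A :=
  BaseTensor.lift θ ((LinearMap.mul k A).compl₂ (θ.toLinearMap ∘ₗ (coord φ).flip v))
    (fun a h m => by
      change a * θ h * θ (coord φ m v) = a * θ (coord φ (h • m) v)
      rw [coord_smul_left, map_mul, mul_assoc])

variable {θ : H →ₐ[k] A} {η : H →ₐ[k] B}

theorem contract_tmul (v : V) (x : A) (u : U) :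
    contract φ v (BaseTensor.tmul θ x u) = x * θ (coord φ u v) :=
  BaseTensor.lift_tmul _ _ _ _ _

theorem contract_smul (v : V) (x : A) (s : BaseTensor θ U) :
    contract φ v (x • s) = x * contract φ v s := by
  induction s using BaseTensor.induction with
  | h0 => simp
  | ht a u => rw [BaseTensor.smul_tmul, contract_tmul, contract_tmul, mul_assoc]
  | ha s t hs ht => simp only [smul_add, map_add, mul_add, hs, ht]

theorem contract_smul_right (v : V) (h : H) (s : BaseTensor θ U) :
    contract φ (h • v) s = contract φ v s * θ (antipode k h) := by
  induction s using BaseTensor.induction with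
  | h0 => simp
  | ht a u => rw [contract_tmul, contract_tmul, coord_smul_right, map_mul, mul_assoc]
  | ha s t hs ht => simp only [map_add, add_mul, hs, ht]

theorem contract_add_right (v v' : V) (s : BaseTensor θ U) :
    contract φ (v + v') s = contract φ v s + contract φ v' s := by
  induction s using BaseTensor.induction with
  | h0 => simp
  | ht a u => simp only [contract_tmul, map_add, mul_add]
  | ha s t hs ht => simp only [map_add, hs, ht]; abel

theorem contract_smul_base (v : V) (c : k) (s : BaseTensor θ U) :
    contract φ (c • v) s = c • contract φ v s := by
  induction s using BaseTensor.induction with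
  | h0 => simp
  | ht a u => simp only [contract_tmul, map_smul, mul_smul_comm]
  | ha s t hs ht => simp only [map_add, hs, ht, smul_add]

/-- `contract` as a linear map in the second argument. -/
def contractₗ (s : BaseTensor θ U) : V →ₗ[k] A where
  toFun v := contract φ v s
  map_add' v v' := contract_add_right φ v v' s
  map_smul' c v := contract_smul_base φ v c s

theorem contractₗ_apply (s : BaseTensor θ U) (v : V) : contractₗ φ s v = contract φ v s := rfl

theorem contract_push (v : V) (α : A →ₐ[k] B) (hα : ∀ h, α (θ h) = η h) (s : BaseTensor θ U) :
    contract φ v (push α hα s) = α (contract φ v s) := by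
  induction s using BaseTensor.induction with
  | h0 => simp
  | ht a u => rw [push_tmul, contract_tmul, contract_tmul, map_mul, hα]
  | ha s t hs ht => simp only [map_add, hs, ht]

theorem pair_pt_right (s : BaseTensor θ U) (v : V) :
    pair φ s (pt k H v) =
      BaseTensor.tmul (boxHom θ (AlgHom.id k H)) (contract φ v s ⊗ₜ[k] 1) (Triv.one k H) := by
  induction s using BaseTensor.induction with
  | h0 => simp [BaseTensor.zero_tmul]
  | ha s t hs ht =>
    rw [map_add, LinearMap.add_apply, hs, ht, map_add, TensorProduct.add_tmul, BaseTensor.add_tmul]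
  | ht x u =>
    rw [pt, pair_tmul, eq_tmul_coord, pushBox, push_tmul, BaseTensor.smul_tmul, contract_tmul]
    simp

theorem compLeft_eq_tmul (s : PT2 k H U) (v : V) :
    φ.compLeft s v =
      BaseTensor.tmul (comul3 k H) (incl12 k H (contract φ v s)) (Triv.one k H) := by
  rw [compLeft_eq_pair, pair_pt_right, push_tmul]; rfl

theorem scalar3_compLeft (s : PT2 k H U) (v : V) :
    scalar3 k H (φ.compLeft s v) = contract φ v s := by
  rw [compLeft_eq_tmul, scalar3_one]

/-- Finite dual families of a pseudo-form: `u = ∑ᵢ ⟨u, cᵢ⟩ dᵢ` and `v = ∑ᵢ S⟨dᵢ, v⟩ cᵢ`, for the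
coordinates of the form in `H`. -/
structure IsDualFamily {ι : Type*} [Fintype ι] (d : ι → U) (c : ι → V) : Prop where
  left : ∀ u, ∑ i, coord φ u (c i) • d i = u
  right : ∀ v, ∑ i, antipode k (coord φ (d i) v) • c i = v

namespace IsDualFamily

variable {φ} {ι : Type*} [Fintype ι] {d : ι → U} {c : ι → V} (hd : IsDualFamily φ d c)
include hd

theorem expand (s : BaseTensor θ U) : ∑ i, BaseTensor.tmul θ (contract φ (c i) s) (d i) = s := by
  induction s using BaseTensor.induction with
  | h0 => simp [BaseTensor.zero_tmul]
  | ha s t hs ht =>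
    simp only [map_add, BaseTensor.add_tmul, Finset.sum_add_distrib]
    rw [hs, ht]
  | ht x u =>
    conv_rhs => rw [← hd.left u]
    rw [BaseTensor.tmul_sum]
    refine Finset.sum_congr rfl fun i _ => ?_
    rw [contract_tmul, BaseTensor.mul_tmul]

/-- Generalised elements are separated by their coordinates. -/
theorem ext {s t : BaseTensor θ U} (h : ∀ v, contract φ v s = contract φ v t) : s = t := by
  rw [← hd.expand s, ← hd.expand t]
  simp only [h]

/-- Every `H`-linear system of coordinates comes from a generalised element. -/
theorem contract_sum [Coalgebra.IsCocomm k H] (F : V →ₗ[k] A)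
    (hF : ∀ (h : H) v, F (h • v) = F v * θ (antipode k h)) (v : V) :
    contract φ v (∑ i, BaseTensor.tmul θ (F (c i)) (d i)) = F v := by
  conv_rhs => rw [← hd.right v]
  rw [map_sum, map_sum]
  refine Finset.sum_congr rfl fun i _ => ?_
  rw [contract_tmul, hF, antipode_antipode]

end IsDualFamily

end Normal

section Dual

open HopfAlgebra

variable {k H : Type*} [Field k] [Ring H] [HopfAlgebra k H]
  {L : Type*} [AddCommGroup L] [Module k L] [Module H L] [IsScalarTower k H L]

/-! ### The evaluation pairing between `L*` and `L` -/

variable (k H L) in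
/-- The evaluation `(f, a) ↦ f(a)`, as a polylinear map. -/
def ev : Lin2 k H (PDual k H L) L (Triv k H) where
  toFun := (Chom k H L (Triv k H)).subtype
  map_smul' f g φ a := by
    change (f • φ).1 (g • a) = (f ⊗ₜ[k] g : H2 k H) • φ.1 a
    rw [Chom.smul_apply, φ.2, ← mul_smul]
    simp

theorem ev_apply (f : PDual k H L) (a : L) : (ev k H L).toFun f a = f.1 a := rfl

theorem PDual.ext_coord {f g : PDual k H L} (h : ∀ a, coord (ev k H L) f a = coord (ev k H L) g a) :
    f = g :=
  Subtype.ext (LinearMap.ext fun a => scalar2_injective (h a))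

variable {ι : Type*} [Fintype ι]

/-- The dual basis, `eᵢ*(v) = (1 ⊗ vᵢ) ⊗_H 1` for the coordinates `vᵢ` of `v`. -/
def dualBasis (e : Module.Basis ι H L) (i : ι) : PDual k H L :=
  ⟨{ toFun := fun v => BaseTensor.tmul _ (1 ⊗ₜ[k] e.repr v i) (Triv.one k H)
     map_add' := fun v w => by
      rw [map_add, Finsupp.add_apply, TensorProduct.tmul_add, BaseTensor.add_tmul]
     map_smul' := fun c v => by
      rw [← algebraMap_smul H c v, map_smul, Finsupp.smul_apply, algebraMap_smul,
        TensorProduct.tmul_smul, BaseTensor.smul_tmul_base, RingHom.id_apply] },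
   fun h v => by
    change BaseTensor.tmul _ (1 ⊗ₜ[k] e.repr (h • v) i) (Triv.one k H) =
      (1 ⊗ₜ[k] h : H2 k H) • BaseTensor.tmul _ (1 ⊗ₜ[k] e.repr v i) (Triv.one k H)
    rw [BaseTensor.smul_tmul, map_smul, Finsupp.smul_apply]
    simp⟩

theorem dualBasis_apply [DecidableEq ι] (e : Module.Basis ι H L) (i j : ι) :
    (dualBasis e i : PDual k H L).1 (e j) =
      if i = j then BaseTensor.tmul (comul2 k H) (1 ⊗ₜ[k] 1) (Triv.one k H) else 0 := by
  change BaseTensor.tmul _ (1 ⊗ₜ[k] e.repr (e j) i) (Triv.one k H) = _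
  rw [e.repr_self, Finsupp.single_apply]
  by_cases h : i = j
  · rw [if_pos h, if_pos h.symm]
  · rw [if_neg h, if_neg (Ne.symm h), TensorProduct.tmul_zero, BaseTensor.zero_tmul]

theorem coord_dual_self [DecidableEq ι] {e : Module.Basis ι H L} {e' : ι → PDual k H L}
    (h : ∀ i j, (e' i).1 (e j) =
      if i = j then BaseTensor.tmul (comul2 k H) (1 ⊗ₜ[k] 1) (Triv.one k H) else 0) (i j : ι) :
    coord (ev k H L) (e' i) (e j) = if i = j then 1 else 0 := by
  rw [coord_apply, ev_apply, h]
  split_ifs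
  · rw [scalar2_one]
  · rw [map_zero]

theorem coord_dual [DecidableEq ι] {e : Module.Basis ι H L} {e' : ι → PDual k H L}
    (h : ∀ i j, (e' i).1 (e j) =
      if i = j then BaseTensor.tmul (comul2 k H) (1 ⊗ₜ[k] 1) (Triv.one k H) else 0) (i : ι) (v : L) :
    coord (ev k H L) (e' i) v = antipode k (e.repr v i) := by
  conv_lhs => rw [← e.sum_repr v]
  rw [map_sum, Finset.sum_eq_single i]
  · rw [coord_smul_right, coord_dual_self h, if_pos rfl, one_mul]
  · intro j _ hj
    rw [coord_smul_right, coord_dual_self h, if_neg (Ne.symm hj), zero_mul]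
  · simp

/-- A basis of `L` and its dual basis are dual families for the evaluation. -/
theorem isDualFamily_dual [Coalgebra.IsCocomm k H] [DecidableEq ι] {e : Module.Basis ι H L} {e' : ι → PDual k H L}
    (h : ∀ i j, (e' i).1 (e j) =
      if i = j then BaseTensor.tmul (comul2 k H) (1 ⊗ₜ[k] 1) (Triv.one k H) else 0) :
    IsDualFamily (ev k H L) e' e where
  left f := by
    refine PDual.ext_coord fun v => ?_
    conv_rhs => rw [← e.sum_repr v]
    rw [map_sum, map_sum, LinearMap.sum_apply]
    refine Finset.sum_congr rfl fun i _ => ?_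
    rw [coord_smul_left, coord_smul_right, coord_dual h]
  right v := by
    conv_rhs => rw [← e.sum_repr v]
    refine Finset.sum_congr rfl fun i _ => ?_
    rw [coord_dual h, antipode_antipode]

/-! ### Coordinates of tensors -/

/-- The coordinates in `H ⊗ H` of a tensor in `L ⊗ L`, with respect to `f` and `g`. -/
def coord2 (f g : PDual k H L) : L ⊗[k] L →ₗ[k] H2 k H :=
  TensorProduct.map (coord (ev k H L) f) (coord (ev k H L) g)

theorem coord2_tmul (f g : PDual k H L) (a b : L) :
    coord2 f g (a ⊗ₜ[k] b) = coord (ev k H L) f a ⊗ₜ[k] coord (ev k H L) g b := rfl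

theorem coord2_smul (h h' : H) (f g : PDual k H L) (w : L ⊗[k] L) :
    coord2 (h • f) (h' • g) w = (h ⊗ₜ[k] h') * coord2 f g w := by
  induction w using TensorProduct.induction_on with
  | zero => simp
  | tmul a b => simp only [coord2_tmul, coord_smul_left, Algebra.TensorProduct.tmul_mul_tmul]
  | add s t hs ht => simp only [map_add, mul_add, hs, ht]

theorem coord2_add_left (f f' g : PDual k H L) (w : L ⊗[k] L) :
    coord2 (f + f') g w = coord2 f g w + coord2 f' g w := by
  simp only [coord2, map_add, TensorProduct.map_add_left, LinearMap.add_apply]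

theorem coord2_add_right (f g g' : PDual k H L) (w : L ⊗[k] L) :
    coord2 f (g + g') w = coord2 f g w + coord2 f g' w := by
  simp only [coord2, map_add, TensorProduct.map_add_right, LinearMap.add_apply]

theorem coord2_smul_base_left (c : k) (f g : PDual k H L) (w : L ⊗[k] L) :
    coord2 (c • f) g w = c • coord2 f g w := by
  simp only [coord2, map_smul, TensorProduct.map_smul_left, LinearMap.smul_apply]

theorem coord2_smul_base_right (c : k) (f g : PDual k H L) (w : L ⊗[k] L) :
    coord2 f (c • g) w = c • coord2 f g w := by
  simp only [coord2, map_smul, TensorProduct.map_smul_right, LinearMap.smul_apply]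

theorem coord2_act2 (f g : PDual k H L) (y : H2 k H) (w : L ⊗[k] L) :
    coord2 f g (act2 k H L L y w) =
      coord2 f g w * TensorProduct.map (antipode k) (antipode k) y := by
  induction w using TensorProduct.induction_on with
  | zero => simp
  | add s t hs ht => simp only [map_add, add_mul, hs, ht]
  | tmul a b =>
    induction y using TensorProduct.induction_on with
    | zero => simp
    | add s t hs ht => simp only [map_add, mul_add, LinearMap.add_apply, hs, ht]
    | tmul h h' =>
      simp only [act2_tmul, coord2_tmul, coord_smul_right, TensorProduct.map_tmul,
        Algebra.TensorProduct.tmul_mul_tmul]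

theorem coord2_comm (f g : PDual k H L) (w : L ⊗[k] L) :
    coord2 f g (TensorProduct.comm k L L w) = flip2 k H (coord2 g f w) := by
  induction w using TensorProduct.induction_on with
  | zero => simp
  | tmul a b => simp [coord2_tmul, flip2]
  | add s t hs ht => simp only [map_add, hs, ht]

theorem toTensor_smul (δ : L →ₗ[H] DTensor k H L L) (h : H) (a : L) :
    toTensor δ (h • a) = act2 k H L L (comul2 k H h) (toTensor δ a) := by
  change DTensor.toTensor k H L L (δ (h • a)) = _
  rw [map_smul]; rfl

theorem coord2_toTensor_smul [Coalgebra.IsCocomm k H] (f g : PDual k H L)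
    (δ : L →ₗ[H] DTensor k H L L) (h : H) (a : L) :
    coord2 f g (toTensor δ (h • a)) =
      coord2 f g (toTensor δ a) * comul2 k H (antipode k h) := by
  rw [toTensor_smul, coord2_act2]
  congr 1
  exact (comul_antipode k h).symm

/-- The coordinates in `H ⊗ H ⊗ H` of a tensor in `L ⊗ L ⊗ L`. -/
def coord3 (f g h : PDual k H L) : L ⊗[k] (L ⊗[k] L) →ₗ[k] H3 k H :=
  TensorProduct.map (coord (ev k H L) f) (coord2 g h)

theorem coord3_leftComm (f g h : PDual k H L) (w : L ⊗[k] (L ⊗[k] L)) :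
    coord3 f g h (TensorProduct.leftComm k L L L w) = flip12 k H (coord3 g f h w) := by
  induction w using TensorProduct.induction_on with
  | zero => simp
  | add s t hs ht => simp only [map_add, hs, ht]
  | tmul a u =>
    induction u using TensorProduct.induction_on with
    | zero => simp
    | tmul a b => simp [coord3, coord2, flip12]
    | add s t hs ht => simp only [TensorProduct.tmul_add, map_add, hs, ht]

/-- The map `x ↦ S(x) c`. -/
def antipodeSMul (c : L) : H →ₗ[k] L :=
  (Algebra.lsmul k k L : H →ₐ[k] Module.End k L).toLinearMap.flip c ∘ₗ antipode k

theorem map_antipodeSMul (c c' : L) (x : H2 k H) :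
    TensorProduct.map (antipodeSMul c) (antipodeSMul c') x =
      act2 k H L L (TensorProduct.map (antipode k) (antipode k) x) (c ⊗ₜ[k] c') := by
  induction x using TensorProduct.induction_on with
  | zero => simp
  | tmul a b => simp [antipodeSMul, act2_tmul]
  | add s t hs ht => simp only [map_add, LinearMap.add_apply, hs, ht]

section Families

variable {d : ι → PDual k H L} {c : ι → L} (hd : IsDualFamily (ev k H L) d c)
include hd

theorem sum_map_antipodeSMul (w : L ⊗[k] L) :
    ∑ i, ∑ j, TensorProduct.map (antipodeSMul (c i)) (antipodeSMul (c j))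
      (coord2 (d i) (d j) w) = w := by
  induction w using TensorProduct.induction_on with
  | zero => simp
  | add s t hs ht => simp only [map_add, Finset.sum_add_distrib, hs, ht]
  | tmul a b =>
    have h1 : ∀ v : L, ∑ i, antipodeSMul (c i) (coord (ev k H L) (d i) v) = v := hd.right
    simp only [coord2_tmul, TensorProduct.map_tmul]
    simp only [← TensorProduct.tmul_sum, ← TensorProduct.sum_tmul, h1]

theorem coord2_ext {w w' : L ⊗[k] L} (h : ∀ f g : PDual k H L, coord2 f g w = coord2 f g w') : w = w' := by
  rw [← sum_map_antipodeSMul hd w, ← sum_map_antipodeSMul hd w']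
  simp only [h]

theorem coord3_ext {w w' : L ⊗[k] (L ⊗[k] L)} (h : ∀ f g l : PDual k H L, coord3 f g l w = coord3 f g l w') :
    w = w' := by
  have h1 : ∀ w : L ⊗[k] (L ⊗[k] L), ∑ i, ∑ j, ∑ l, TensorProduct.map (antipodeSMul (c i))
      (TensorProduct.map (antipodeSMul (c j)) (antipodeSMul (c l)))
        (coord3 (d i) (d j) (d l) w) = w := by
    intro w
    induction w using TensorProduct.induction_on with
    | zero => simp
    | add s t hs ht => simp only [map_add, Finset.sum_add_distrib, hs, ht]
    | tmul a u =>
      have h1 : ∀ v : L, ∑ i, antipodeSMul (c i) (coord (ev k H L) (d i) v) = v := hd.right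
      simp only [coord3, TensorProduct.map_tmul]
      simp only [← TensorProduct.tmul_sum, sum_map_antipodeSMul hd, ← TensorProduct.sum_tmul, h1]
  rw [← h1 w, ← h1 w']
  simp only [h]

end Families

/-! ### Duality between cobrackets and brackets -/

/-- A pseudobracket on `L*` and an `H`-linear map `L → L ⊗ L` are dual if `[f * g](a)` and
`(f ⊗ g)(δ(a))` have the same coordinates. -/
def IsDual (δ : L →ₗ[H] DTensor k H L L) (M : Lin2 k H (PDual k H L) (PDual k H L) (PDual k H L)) :
    Prop :=
  ∀ f g a, contract (ev k H L) a (M.toFun f g) = coord2 f g (toTensor δ a)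

/-- The pseudobracket on `L*` that is dual to `δ`. -/
def dualBracket [Coalgebra.IsCocomm k H] (d : ι → PDual k H L) (c : ι → L)
    (δ : L →ₗ[H] DTensor k H L L) : Lin2 k H (PDual k H L) (PDual k H L) (PDual k H L) where
  toFun := LinearMap.mk₂ k
    (fun f g => ∑ l, BaseTensor.tmul _ (coord2 f g (toTensor δ (c l))) (d l))
    (fun f f' g => by simp only [coord2_add_left, BaseTensor.add_tmul, Finset.sum_add_distrib])
    (fun r f g => by simp only [coord2_smul_base_left, BaseTensor.smul_tmul_base, Finset.smul_sum])
    (fun f g g' => by simp only [coord2_add_right, BaseTensor.add_tmul, Finset.sum_add_distrib])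
    (fun r f g => by simp only [coord2_smul_base_right, BaseTensor.smul_tmul_base, Finset.smul_sum])
  map_smul' h h' f g := by
    simp only [LinearMap.mk₂_apply, coord2_smul, Finset.smul_sum, BaseTensor.smul_tmul]

theorem isDual_dualBracket [Coalgebra.IsCocomm k H] {d : ι → PDual k H L} {c : ι → L}
    (hd : IsDualFamily (ev k H L) d c) (δ : L →ₗ[H] DTensor k H L L) :
    IsDual δ (dualBracket d c δ) := fun f g a =>
  hd.contract_sum (θ := comul2 k H) (coord2 f g ∘ₗ toTensor δ)
    (fun h v => coord2_toTensor_smul f g δ h v) a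

theorem antipode_map_antidistrib (x y : H2 k H) :
    TensorProduct.map (antipode k) (antipode k) (x * y) =
      TensorProduct.map (antipode k) (antipode k) y *
        TensorProduct.map (antipode k) (antipode k) x := by
  induction x using TensorProduct.induction_on with
  | zero => simp
  | add s t hs ht => simp only [add_mul, mul_add, map_add, hs, ht]
  | tmul a b =>
    induction y using TensorProduct.induction_on with
    | zero => simp
    | add s t hs ht => simp only [add_mul, mul_add, map_add, hs, ht]
    | tmul a b => simp [antipode_mul_antidistrib]

theorem antipode_map_antipode [Coalgebra.IsCocomm k H] (x : H2 k H) :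
    TensorProduct.map (antipode k) (antipode k)
      (TensorProduct.map (antipode k) (antipode k) x) = x := by
  induction x using TensorProduct.induction_on with
  | zero => simp
  | add s t hs ht => simp only [map_add, hs, ht]
  | tmul a b => simp [antipode_antipode]

/-- The cobracket on `L` that is dual to a pseudobracket on `L*`. -/
def dualCobracket [Coalgebra.IsCocomm k H] (d : ι → PDual k H L) (c : ι → L)
    (M : Lin2 k H (PDual k H L) (PDual k H L) (PDual k H L)) : L →ₗ[H] DTensor k H L L where
  toFun a := ∑ i, ∑ j, (DTensor.toTensor k H L L).symm (act2 k H L L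
    (TensorProduct.map (antipode k) (antipode k) (contract (ev k H L) a (M.toFun (d i) (d j))))
      (c i ⊗ₜ[k] c j))
  map_add' a b := by
    simp only [contract_add_right, map_add, LinearMap.add_apply, Finset.sum_add_distrib]
  map_smul' h a := by
    simp only [RingHom.id_apply, Finset.smul_sum]
    refine Finset.sum_congr rfl fun i _ => Finset.sum_congr rfl fun j _ => ?_
    have h1 : TensorProduct.map (antipode k) (antipode k) (comul2 k H (antipode k h)) =
        comul2 k H h := by
      refine (congrArg _ (comul_antipode k h)).trans ?_
      exact antipode_map_antipode _
    rw [contract_smul_right, antipode_map_antidistrib, h1, map_mul, Module.End.mul_apply]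
    rfl

theorem isDual_dualCobracket [Coalgebra.IsCocomm k H] {d : ι → PDual k H L} {c : ι → L}
    (hd : IsDualFamily (ev k H L) d c) (M : Lin2 k H (PDual k H L) (PDual k H L) (PDual k H L)) :
    IsDual (dualCobracket d c M) M := by
  intro f g a
  have h1 : toTensor (dualCobracket d c M) a = ∑ i, ∑ j, act2 k H L L
      (TensorProduct.map (antipode k) (antipode k) (contract (ev k H L) a (M.toFun (d i) (d j))))
        (c i ⊗ₜ[k] c j) := rfl
  rw [h1, map_sum]
  conv_lhs => rw [← hd.left f, ← hd.left g]
  rw [map_sum M.toFun, LinearMap.sum_apply, map_sum]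
  refine Finset.sum_congr rfl fun i _ => ?_
  rw [map_sum, map_sum, map_sum]
  refine Finset.sum_congr rfl fun j _ => ?_
  rw [M.map_smul', contract_smul, coord2_act2, antipode_map_antipode, coord2_tmul]

namespace IsDual

variable {d : ι → PDual k H L} {c : ι → L} (hd : IsDualFamily (ev k H L) d c)
  {δ δ' : L →ₗ[H] DTensor k H L L} {M M' : Lin2 k H (PDual k H L) (PDual k H L) (PDual k H L)}
include hd

theorem bracket_unique (h : IsDual δ M) (h' : IsDual δ M') : M = M' := by
  ext f g
  exact hd.ext fun a => (h f g a).trans (h' f g a).symm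

theorem cobracket_unique (h : IsDual δ M) (h' : IsDual δ' M) : δ = δ' := by
  ext a
  exact coord2_ext hd (w := toTensor δ a) (w' := toTensor δ' a)
    fun f g => (h f g a).symm.trans (h' f g a)

end IsDual

theorem contract_flip [Coalgebra.IsCocomm k H] (a : L) (s : PT2 k H (PDual k H L)) :
    contract (ev k H L) a (PT2.flip k H s) = flip2 k H (contract (ev k H L) a s) :=
  contract_push _ a (flip2 k H) (flip2_comul k H) s

theorem IsDual.skew_iff [Coalgebra.IsCocomm k H] {d : ι → PDual k H L} {c : ι → L}
    (hd : IsDualFamily (ev k H L) d c) {δ : L →ₗ[H] DTensor k H L L}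
    {M : Lin2 k H (PDual k H L) (PDual k H L) (PDual k H L)} (h : IsDual δ M) :
    (∀ a, TensorProduct.comm k L L (toTensor δ a) = -toTensor δ a) ↔
      ∀ f g, M.toFun g f = -PT2.flip k H (M.toFun f g) := by
  constructor
  · intro hs f g
    refine hd.ext fun a => ?_
    rw [map_neg, contract_flip, h, h, ← coord2_comm, hs, map_neg, neg_neg]
  · intro hs a
    refine coord2_ext hd fun f g => ?_
    rw [coord2_comm, ← h, map_neg, ← h, hs g f, map_neg, contract_flip, neg_neg]

/-- `(f ⊗ s)(δ(a))` is the coordinate of `f * s`, for `f ∈ L*` and a generalised element `s`. -/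
theorem IsDual.map_contract_right {δ : L →ₗ[H] DTensor k H L L}
    {M : Lin2 k H (PDual k H L) (PDual k H L) (PDual k H L)} (h : IsDual δ M) (f : PDual k H L)
    (s : PT2 k H (PDual k H L)) (a : L) :
    TensorProduct.map (coord (ev k H L) f) (contractₗ (ev k H L) s) (toTensor δ a) =
      contract (ev k H L) a (M.compRight f s) := by
  induction s using BaseTensor.induction with
  | h0 =>
    have h1 : M.compRight f 0 = 0 := map_zero (compRightₗ M f)
    have h2 : contractₗ (ev k H L) (0 : PT2 k H (PDual k H L)) = 0 := by
      ext v; exact map_zero (contract (ev k H L) v (θ := comul2 k H))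
    rw [h1, h2]; simp
  | ha s t hs ht =>
    have h1 : M.compRight f (s + t) = _ := map_add (compRightₗ M f) s t
    have h2 : contractₗ (ev k H L) (s + t) = contractₗ (ev k H L) s + contractₗ (ev k H L) t := by
      ext v; exact map_add (contract (ev k H L) v) s t
    rw [h1, h2, TensorProduct.map_add_right, LinearMap.add_apply, hs, ht, map_add]; rfl
  | ht x φ =>
    have h1 : PT2.idComul k H (M.toFun f φ) =
      push (idComul k H) (idComul_comul k H) (M.toFun f φ) := rfl
    rw [Lin2.compRight_tmul, contract_smul, h1, contract_push, h]
    generalize toTensor δ a = w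
    induction w using TensorProduct.induction_on with
    | zero => simp
    | add s t hs ht => simp only [map_add, mul_add, hs, ht]
    | tmul b b' =>
      rw [TensorProduct.map_tmul, contractₗ_apply, contract_tmul, coord2_tmul]
      simp [incl23, idComul]

/-- `(s ⊗ f)(δ(a))` is the coordinate of `s * f`, for `f ∈ L*` and a generalised element `s`. -/
theorem IsDual.map_contract_left {δ : L →ₗ[H] DTensor k H L L}
    {M : Lin2 k H (PDual k H L) (PDual k H L) (PDual k H L)} (h : IsDual δ M) (f : PDual k H L)
    (s : PT2 k H (PDual k H L)) (a : L) :
    Algebra.TensorProduct.assoc k k k H H H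
        (TensorProduct.map (contractₗ (ev k H L) s) (coord (ev k H L) f) (toTensor δ a)) =
      contract (ev k H L) a (M.compLeft s f) := by
  induction s using BaseTensor.induction with
  | h0 =>
    have h1 : M.compLeft 0 f = 0 := map_zero (compLeftₗ M f)
    have h2 : contractₗ (ev k H L) (0 : PT2 k H (PDual k H L)) = 0 := by
      ext v; exact map_zero (contract (ev k H L) v (θ := comul2 k H))
    rw [h1, h2]; simp
  | ha s t hs ht =>
    have h1 : M.compLeft (s + t) f = _ := map_add (compLeftₗ M f) s t
    have h2 : contractₗ (ev k H L) (s + t) = contractₗ (ev k H L) s + contractₗ (ev k H L) t := by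
      ext v; exact map_add (contract (ev k H L) v) s t
    rw [h1, h2, TensorProduct.map_add_left, LinearMap.add_apply, map_add, hs, ht, map_add]; rfl
  | ht x φ =>
    have h1 : PT2.comulId k H (M.toFun φ f) =
      push (comulId k H) (comulId_comul k H) (M.toFun φ f) := rfl
    rw [Lin2.compLeft_tmul, contract_smul, h1, contract_push, h]
    generalize toTensor δ a = w
    induction w using TensorProduct.induction_on with
    | zero => simp
    | add s t hs ht => simp only [map_add, mul_add, hs, ht]
    | tmul b b' =>
      rw [TensorProduct.map_tmul, contractₗ_apply, contract_tmul, coord2_tmul]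
      have h2 : (x * comul2 k H (coord (ev k H L) φ b)) ⊗ₜ[k] coord (ev k H L) f b' =
        (x ⊗ₜ[k] 1) * (comul2 k H (coord (ev k H L) φ b) ⊗ₜ[k] coord (ev k H L) f b') := by simp
      rw [h2, map_mul]
      simp [incl12, comulId]

/-- The co-Jacobi identity for `δ` is the Jacobi identity for the dual bracket. -/
theorem IsDual.jacobi_iff [Coalgebra.IsCocomm k H] {d : ι → PDual k H L} {c : ι → L}
    (hd : IsDualFamily (ev k H L) d c) {δ : L →ₗ[H] DTensor k H L L}
    {M : Lin2 k H (PDual k H L) (PDual k H L) (PDual k H L)} (h : IsDual δ M) :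
    (∀ a, LinearMap.lTensor L (toTensor δ) (toTensor δ a) -
        TensorProduct.leftComm k L L L (LinearMap.lTensor L (toTensor δ) (toTensor δ a)) =
      TensorProduct.assoc k L L L (LinearMap.rTensor L (toTensor δ) (toTensor δ a))) ↔
    ∀ f g l, M.compRight f (M.toFun g l) - PT3.flip12 k H (M.compRight g (M.toFun f l)) =
      M.compLeft (M.toFun f g) l := by
  have h1 : ∀ f g l w, coord3 f g l (LinearMap.lTensor L (toTensor δ) w) =
      TensorProduct.map (coord (ev k H L) f) (contractₗ (ev k H L) (M.toFun g l)) w := by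
    intro f g l w
    induction w using TensorProduct.induction_on with
    | zero => simp
    | add s t hs ht => simp only [map_add, hs, ht]
    | tmul b b' =>
      rw [LinearMap.lTensor_tmul, coord3, TensorProduct.map_tmul, TensorProduct.map_tmul,
        contractₗ_apply, h]
  have h2 : ∀ f g l w, coord3 f g l (TensorProduct.assoc k L L L
        (LinearMap.rTensor L (toTensor δ) w)) =
      Algebra.TensorProduct.assoc k k k H H H
        (TensorProduct.map (contractₗ (ev k H L) (M.toFun f g)) (coord (ev k H L) l) w) := by
    intro f g l w
    induction w using TensorProduct.induction_on with
    | zero => simp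
    | add s t hs ht => simp only [map_add, hs, ht]
    | tmul b b' =>
      rw [LinearMap.rTensor_tmul, TensorProduct.map_tmul, contractₗ_apply, h]
      generalize toTensor δ b = u
      induction u using TensorProduct.induction_on with
      | zero => simp
      | add s t hs ht => simp only [map_add, TensorProduct.add_tmul, hs, ht]
      | tmul b b' => simp [coord3, coord2]
  have h3 : ∀ a (s : PT3 k H (PDual k H L)), contract (ev k H L) a (PT3.flip12 k H s) =
      flip12 k H (contract (ev k H L) a s) :=
    fun a s => contract_push _ a (flip12 k H) (flip12_comul k H) s
  constructor
  · intro hj f g l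
    refine hd.ext fun a => ?_
    rw [map_sub, h3, ← h.map_contract_right, ← h.map_contract_right, ← h.map_contract_left,
      ← h1, ← h1, ← h2, ← hj, map_sub, coord3_leftComm]
  · intro hj a
    refine coord3_ext hd fun f g l => ?_
    rw [map_sub, coord3_leftComm, h1, h1, h2, h.map_contract_right, h.map_contract_right,
      h.map_contract_left, ← hj, map_sub, h3]

theorem isDualBracket_iff [Coalgebra.IsCocomm k H] [Module.Free H L] [Module.Finite H L]
    (δ : LieCoalgebra k H L)
    (M : LiePseudoalgebra k H (PDual k H L)) :
    IsDualBracket δ M ↔ IsDual δ.cobracket M.bracket := by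
  classical
  constructor
  · intro h
    let e : Module.Basis (Fin (Fintype.card (Module.Free.ChooseBasisIndex H L))) H L :=
      (Module.Free.chooseBasis H L).reindex (Fintype.equivFin _)
    have he : ∀ i j, (dualBasis e i : PDual k H L).1 (e j) = _ := dualBasis_apply e
    have hd := isDualFamily_dual he
    have h1 := h _ e (dualBasis e)
      (fun i j l => contract (ev k H L) (e l) (M.bracket.toFun (dualBasis e i) (dualBasis e j)))
      he (fun i j => (hd.expand _).symm)
    have h2 : δ.cobracket = dualCobracket (dualBasis e) e M.bracket := e.ext fun l => h1 l
    rw [h2]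
    exact isDual_dualCobracket hd M.bracket
  · intro h n e e' x he hx l
    have hd := isDualFamily_dual he
    rw [← sum_map_antipodeSMul hd (toTensor δ.cobracket (e l))]
    refine Finset.sum_congr rfl fun i _ => Finset.sum_congr rfl fun j _ => ?_
    rw [map_antipodeSMul, ← h, hx, map_sum, Finset.sum_eq_single l]
    · rw [contract_tmul, coord_dual_self he, if_pos rfl, map_one, mul_one]
    · intro m _ hm
      rw [contract_tmul, coord_dual_self he, if_neg hm, map_zero, mul_zero]
    · simp

end Dual

/-! ### Permutations of the tensor factors -/

section Rotation

variable {k H : Type*} [Field k] [Ring H] [HopfAlgebra k H]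

variable (k H) in
/-- The rotation `p ⊗ q ⊗ r ↦ r ⊗ p ⊗ q` of `H ⊗ H ⊗ H`. -/
def rot3 : H3 k H →ₐ[k] H3 k H :=
  (Algebra.TensorProduct.comm k (H2 k H) H).toAlgHom.comp
    (Algebra.TensorProduct.assoc k k k H H H).symm.toAlgHom

theorem rot3_tmul (p q r : H) : rot3 k H (p ⊗ₜ[k] (q ⊗ₜ[k] r)) = r ⊗ₜ[k] (p ⊗ₜ[k] q) := rfl

variable [Coalgebra.IsCocomm k H]

theorem rot3_comul3 (h : H) : rot3 k H (comul3 k H h) = comul3 k H h := by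
  rw [rot3, AlgHom.comp_apply, assoc_symm_comul3, comm_boxHom]; rfl

variable {Z : Type*} [AddCommGroup Z] [Module k Z] [Module H Z] [IsScalarTower k H Z]

/-- The rotation of `(H ⊗ H ⊗ H) ⊗_H Z`. -/
def PT3.rot : PT3 k H Z →ₗ[k] PT3 k H Z := push (rot3 k H) rot3_comul3

theorem PT3.rot_def (s : PT3 k H Z) : PT3.rot s = push (rot3 k H) rot3_comul3 s := rfl

theorem PT3.flip12_def (s : PT3 k H Z) :
    PT3.flip12 k H s = push (Pseudo.flip12 k H) (flip12_comul k H) s := rfl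

theorem PT2.flip_def (s : PT2 k H Z) :
    PT2.flip k H s = push (flip2 k H) (flip2_comul k H) s := rfl

theorem PT2.flip_flip (s : PT2 k H Z) : PT2.flip k H (PT2.flip k H s) = s := by
  rw [PT2.flip_def, PT2.flip_def, push_push]
  refine (push_congr _ ?_ s).trans (push_id (BaseTensor.id_comp _) s)
  ext <;> simp [flip2]

theorem PT3.flip12_flip12 (s : PT3 k H Z) : PT3.flip12 k H (PT3.flip12 k H s) = s := by
  rw [PT3.flip12_def, PT3.flip12_def, push_push]
  refine (push_congr _ ?_ s).trans (push_id (BaseTensor.id_comp _) s)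
  ext <;> simp [Pseudo.flip12, Algebra.TensorProduct.one_def]

theorem PT3.rot_rot_rot (s : PT3 k H Z) : PT3.rot (PT3.rot (PT3.rot s)) = s := by
  simp only [PT3.rot_def, push_push]
  refine (push_congr _ ?_ s).trans (push_id (BaseTensor.id_comp _) s)
  ext <;> simp [rot3, Algebra.TensorProduct.one_def]

theorem PT3.flip12_rot (s : PT3 k H Z) :
    PT3.flip12 k H (PT3.rot s) = PT3.rot (PT3.rot (PT3.flip12 k H s)) := by
  simp only [PT3.rot_def, PT3.flip12_def, push_push]
  refine push_congr _ ?_ s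
  ext <;> simp [rot3, Pseudo.flip12, Algebra.TensorProduct.one_def]

theorem PT3.rot_smul (p q r : H) (s : PT3 k H Z) :
    PT3.rot ((p ⊗ₜ[k] (q ⊗ₜ[k] r) : H3 k H) • s) =
      (r ⊗ₜ[k] (p ⊗ₜ[k] q) : H3 k H) • PT3.rot s := by
  rw [PT3.rot_def, push_smul, rot3_tmul]; rfl

/-- The sum of a trilinear expression over the cyclic permutations of its arguments, with the
factors of `H ⊗ H ⊗ H` permuted accordingly. -/
def cyclicSum {X : Type*} (t : X → X → X → PT3 k H Z) (a b c : X) : PT3 k H Z :=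
  t a b c + PT3.rot (t b c a) + PT3.rot (PT3.rot (t c a b))

theorem cyclicSum_rot {X : Type*} (t : X → X → X → PT3 k H Z) (a b c : X) :
    PT3.rot (cyclicSum t b c a) = cyclicSum t a b c := by
  simp only [cyclicSum, map_add, PT3.rot_rot_rot]
  abel

theorem cyclicSum_swap {X : Type*} {t : X → X → X → PT3 k H Z}
    (ht : ∀ a b c, t b a c = -PT3.flip12 k H (t a b c)) (a b c : X) :
    cyclicSum t b a c = -PT3.flip12 k H (cyclicSum t a b c) := by
  simp only [cyclicSum, map_add, PT3.flip12_rot, ht a b c, ht c a b, ht b c a, map_neg,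
    PT3.rot_rot_rot]
  abel

variable {U V : Type*} [AddCommGroup U] [Module k U] [Module H U] [IsScalarTower k H U]
  [AddCommGroup V] [Module k V] [Module H V] [IsScalarTower k H V]

theorem compRight_eq_rot (φ : Lin2 k H U V Z) (ψ : Lin2 k H V U Z) (c : k)
    (hc : ∀ u v, ψ.toFun v u = c • PT2.flip k H (φ.toFun u v)) (s : PT2 k H U) (v : V) :
    ψ.compRight v s = c • PT3.rot (φ.compLeft s v) := by
  rw [compRight_eq_pair, pair_comm φ ψ c hc, compLeft_eq_pair, map_smul, PT3.rot_def, push_push,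
    push_push]
  refine congrArg _ (push_congr _ ?_ _)
  ext <;> simp [rot3]

theorem compLeft_flip (φ : Lin2 k H U V Z) (s : PT2 k H U) (v : V) :
    φ.compLeft (PT2.flip k H s) v = PT3.flip12 k H (φ.compLeft s v) := by
  rw [compLeft_eq_pair, compLeft_eq_pair, PT2.flip_def, pair_push_left, push_push, PT3.flip12_def,
    push_push]
  refine push_congr _ ?_ _
  ext <;> simp [flip2, Pseudo.flip12, Algebra.TensorProduct.one_def]

theorem compLeft_neg (φ : Lin2 k H U V Z) (s : PT2 k H U) (v : V) :
    φ.compLeft (-s) v = -φ.compLeft s v := map_neg (compLeftₗ φ v) s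

theorem compLeft_add (φ : Lin2 k H U V Z) (s t : PT2 k H U) (v : V) :
    φ.compLeft (s + t) v = φ.compLeft s v + φ.compLeft t v := map_add (compLeftₗ φ v) s t

theorem compLeft_smul_base (φ : Lin2 k H U V Z) (c : k) (s : PT2 k H U) (v : V) :
    φ.compLeft (c • s) v = c • φ.compLeft s v := map_smul (compLeftₗ φ v) c s

theorem compLeft_add_right (φ : Lin2 k H U V Z) (s : PT2 k H U) (v v' : V) :
    φ.compLeft s (v + v') = φ.compLeft s v + φ.compLeft s v' := by
  have h : pt k H (v + v') = pt k H v + pt k H v' := BaseTensor.tmul_add _ _ _ _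
  simp only [compLeft_eq_pair, h, map_add]

theorem compLeft_smul_base_right (φ : Lin2 k H U V Z) (s : PT2 k H U) (c : k) (v : V) :
    φ.compLeft s (c • v) = c • φ.compLeft s v := by
  have h : pt k H (c • v) = c • pt k H v := BaseTensor.tmul_smul _ _ _ _
  simp only [compLeft_eq_pair, h, map_smul]

theorem compLeft_smul (φ : Lin2 k H U V Z) (f g h : H) (s : PT2 k H U) (v : V) :
    φ.compLeft ((f ⊗ₜ[k] g : H2 k H) • s) (h • v) =
      (f ⊗ₜ[k] (g ⊗ₜ[k] h) : H3 k H) • φ.compLeft s v := by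
  have h1 : pt k H (h • v) = h • pt k H v := by
    rw [pt, pt, BaseTensor.smul_tmul, mul_one, ← BaseTensor.mul_tmul, one_mul]; rfl
  rw [compLeft_eq_pair, compLeft_eq_pair, h1, pair_smul, push_smul]; rfl

end Rotation

section Form

variable {k H : Type*} [Field k] [Ring H] [HopfAlgebra k H] [Coalgebra.IsCocomm k H]
  {R : Type*} [AddCommGroup R] [Module k R] [Module H R] [IsScalarTower k H R]
  {B : Lin2 k H R R (Triv k H)}

/-! ### Pseudobrackets and cyclic trilinear forms -/

theorem IsSymmForm.compRight_eq (hB : IsSymmForm B) (s : PT2 k H R) (r : R) :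
    B.compRight r s = PT3.rot (B.compLeft s r) := by
  rw [compRight_eq_rot B B 1 (fun u v => by rw [one_smul]; exact hB v u), one_smul]

/-- For a symmetric form, invariance of a pseudobracket `μ` is the cyclic invariance of the
trilinear form `⟨μ(a, b), c⟩`. -/
theorem IsSymmForm.invariant_iff (hB : IsSymmForm B) (μ : Lin2 k H R R R) :
    IsInvariantForm μ B ↔
      ∀ a b c, B.compLeft (μ.toFun a b) c = PT3.rot (B.compLeft (μ.toFun b c) a) := by
  simp only [IsInvariantForm, hB.compRight_eq]

theorem IsSymmForm.coord_symm (hB : IsSymmForm B) (r s : R) :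
    HopfAlgebra.antipode k (coord B r s) = coord B s r := by
  rw [coord_apply, coord_apply, hB s r, scalar2_flip]

variable {ι : Type*} [Fintype ι] {d c : ι → R}

theorem IsDualFamily.eq_of_compLeft (hd : IsDualFamily B d c) {s t : PT2 k H R}
    (h : ∀ r, B.compLeft s r = B.compLeft t r) : s = t :=
  hd.ext fun r => by rw [← scalar3_compLeft, h, scalar3_compLeft]

theorem IsDualFamily.nondegenerate (hd : IsDualFamily B d c) : IsNondegenForm B := by
  constructor
  · intro r s h
    have h1 : ∀ v, coord B r v = coord B s v := fun v =>
      congrArg (fun f : PDual k H R => scalar2 k H (f.1 v)) h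
    rw [← hd.left r, ← hd.left s]
    simp only [h1]
  · intro φ
    refine ⟨∑ i, coord (ev k H R) φ (c i) • d i, PDual.ext_coord fun v => ?_⟩
    change coord B (∑ i, coord (ev k H R) φ (c i) • d i) v = _
    conv_rhs => rw [← hd.right v]
    rw [map_sum, map_sum, LinearMap.sum_apply]
    refine Finset.sum_congr rfl fun i _ => ?_
    rw [coord_smul_left, coord_smul_right, antipode_antipode]

/-- The trilinear form obtained from a pseudobracket by cyclic summation, as a linear map in the
last argument. -/
def cyclicForm (B : Lin2 k H R R (Triv k H)) (ν : Lin2 k H R R R) (r s : R) :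
    R →ₗ[k] PT3 k H (Triv k H) where
  toFun := cyclicSum (fun a b => B.compLeft (ν.toFun a b)) r s
  map_add' t t' := by
    simp only [cyclicSum, map_add, LinearMap.add_apply, compLeft_add, compLeft_add_right]
    abel
  map_smul' x t := by
    simp only [cyclicSum, map_smul, LinearMap.smul_apply, compLeft_smul_base,
      compLeft_smul_base_right, smul_add, RingHom.id_apply]

theorem cyclicForm_apply (ν : Lin2 k H R R R) (r s t : R) :
    cyclicForm B ν r s t = cyclicSum (fun a b => B.compLeft (ν.toFun a b)) r s t := rfl

theorem cyclicForm_smul (ν : Lin2 k H R R R) (f g h : H) (r s t : R) :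
    cyclicForm B ν (f • r) (g • s) (h • t) =
      (f ⊗ₜ[k] (g ⊗ₜ[k] h) : H3 k H) • cyclicForm B ν r s t := by
  simp only [cyclicForm_apply, cyclicSum, Lin2.map_smul', compLeft_smul, PT3.rot_smul, smul_add]

/-- The pseudobracket represented by the cyclic sum of `⟨ν(a, b), c⟩`. -/
def cyclicBracket (B : Lin2 k H R R (Triv k H)) (d c : ι → R) (ν : Lin2 k H R R R) :
    Lin2 k H R R R where
  toFun := LinearMap.mk₂ k
    (fun r s => ∑ i, BaseTensor.tmul _ (scalar3 k H (cyclicForm B ν r s (c i))) (d i))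
    (fun r r' s => by
      rw [← Finset.sum_add_distrib]
      refine Finset.sum_congr rfl fun i _ => ?_
      rw [← BaseTensor.add_tmul, ← map_add]
      congr 2
      simp only [cyclicForm_apply, cyclicSum, map_add, LinearMap.add_apply, compLeft_add,
        compLeft_add_right]
      abel)
    (fun x r s => by
      rw [Finset.smul_sum]
      refine Finset.sum_congr rfl fun i _ => ?_
      rw [← BaseTensor.smul_tmul_base, ← map_smul]
      congr 2
      simp only [cyclicForm_apply, cyclicSum, map_smul, LinearMap.smul_apply, compLeft_smul_base,
        compLeft_smul_base_right, smul_add])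
    (fun r s s' => by
      rw [← Finset.sum_add_distrib]
      refine Finset.sum_congr rfl fun i _ => ?_
      rw [← BaseTensor.add_tmul, ← map_add]
      congr 2
      simp only [cyclicForm_apply, cyclicSum, map_add, LinearMap.add_apply, compLeft_add,
        compLeft_add_right]
      abel)
    (fun x r s => by
      rw [Finset.smul_sum]
      refine Finset.sum_congr rfl fun i _ => ?_
      rw [← BaseTensor.smul_tmul_base, ← map_smul]
      congr 2
      simp only [cyclicForm_apply, cyclicSum, map_smul, LinearMap.smul_apply, compLeft_smul_base,
        compLeft_smul_base_right, smul_add])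
  map_smul' f g r s := by
    simp only [LinearMap.mk₂_apply, Finset.smul_sum]
    refine Finset.sum_congr rfl fun i _ => ?_
    have h := cyclicForm_smul (B := B) ν f g 1 r s (c i)
    rw [one_smul] at h
    rw [h, scalar3_smul, BaseTensor.smul_tmul]
    rw [HopfAlgebra.antipode_one, map_one, mul_one]

theorem IsDualFamily.compLeft_cyclicBracket (hd : IsDualFamily B d c) (ν : Lin2 k H R R R)
    (r s t : R) :
    B.compLeft ((cyclicBracket B d c ν).toFun r s) t =
      cyclicSum (fun a b => B.compLeft (ν.toFun a b)) r s t := by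
  apply scalar3_injective
  rw [scalar3_compLeft]
  refine hd.contract_sum (θ := comul2 k H) (scalar3 k H ∘ₗ cyclicForm B ν r s) (fun h v => ?_) t
  have h1 := cyclicForm_smul (B := B) ν 1 1 h r s v
  rw [one_smul, one_smul] at h1
  rw [LinearMap.comp_apply, LinearMap.comp_apply, h1, scalar3_smul]
  simp [← Algebra.TensorProduct.one_def]

theorem IsDualFamily.cyclicBracket_invariant (hd : IsDualFamily B d c) (hB : IsSymmForm B)
    (ν : Lin2 k H R R R) : IsInvariantForm (cyclicBracket B d c ν) B := by
  rw [hB.invariant_iff]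
  intro a b c
  rw [hd.compLeft_cyclicBracket, hd.compLeft_cyclicBracket, cyclicSum_rot]

theorem IsDualFamily.cyclicBracket_skew (hd : IsDualFamily B d c)
    {ν : Lin2 k H R R R} (hν : ∀ a b, ν.toFun b a = -PT2.flip k H (ν.toFun a b)) (r s : R) :
    (cyclicBracket B d c ν).toFun s r = -PT2.flip k H ((cyclicBracket B d c ν).toFun r s) := by
  refine hd.eq_of_compLeft fun t => ?_
  rw [compLeft_neg, compLeft_flip, hd.compLeft_cyclicBracket, hd.compLeft_cyclicBracket]
  exact cyclicSum_swap (fun a b c => by rw [hν, compLeft_neg, compLeft_flip]) r s t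

/-! ### The Jacobi identity as a Bianchi identity -/

section Bianchi

variable (B) (μ : Lin2 k H R R R)

/-- The failure of the Jacobi identity, as a cyclic sum of `[[a * b] * c]`. -/
def jacobiator (a b c : R) : PT3 k H R := cyclicSum (fun a b => μ.compLeft (μ.toFun a b)) a b c

variable {μ} (hμ : ∀ a b, μ.toFun b a = -PT2.flip k H (μ.toFun a b))
include hμ

/-- For a skew-symmetric pseudobracket, the Jacobi identity is the vanishing of the jacobiator. -/
theorem jacobi_iff_jacobiator (a b c : R) :
    μ.compRight a (μ.toFun b c) - PT3.flip12 k H (μ.compRight b (μ.toFun a c)) =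
      μ.compLeft (μ.toFun a b) c ↔ jacobiator μ a b c = 0 := by
  have hc : ∀ u v, μ.toFun v u = (-1 : k) • PT2.flip k H (μ.toFun u v) := fun u v => by
    rw [neg_one_smul, hμ]
  rw [compRight_eq_rot μ μ (-1) hc, compRight_eq_rot μ μ (-1) hc, hμ c a, compLeft_neg,
    compLeft_flip, jacobiator, cyclicSum]
  simp only [neg_one_smul, map_neg, PT3.flip12_rot, PT3.flip12_flip12, neg_neg]
  rw [← sub_eq_zero, ← neg_eq_zero]
  refine Eq.congr ?_ rfl
  abel

variable (k H) in
/-- `(H ⊗ H) ⊗ (H ⊗ H) ⊗_H k`. -/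
abbrev Scalar22 : Type _ := BaseTensor (boxHom (comul2 k H) (comul2 k H)) (Triv k H)

variable (k H) in
/-- `(H ⊗ H ⊗ H) ⊗ H ⊗_H k`. -/
abbrev Scalar31 : Type _ := BaseTensor (boxHom (comul3 k H) (AlgHom.id k H)) (Triv k H)

/-- The quadrilinear form `⟨[a * b], [r * s]⟩`. -/
def bracketForm (B : Lin2 k H R R (Triv k H)) (μ : Lin2 k H R R R) (a b r s : R) :
    Scalar22 k H :=
  pair B (μ.toFun a b) (μ.toFun r s)

omit hμ

variable (k H) in
/-- The reordering `(p ⊗ q) ⊗ (r ⊗ s) ↦ (p ⊗ q ⊗ r) ⊗ s`. -/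
def regroup : H2 k H ⊗[k] H2 k H →ₐ[k] H3 k H ⊗[k] H :=
  (Algebra.TensorProduct.map (Algebra.TensorProduct.assoc k k k H H H).toAlgHom
    (AlgHom.id k H)).comp (Algebra.TensorProduct.assoc k k k (H2 k H) H H).symm.toAlgHom

theorem regroup_boxHom_id (h : H) : regroup k H
    (boxHom (comul2 k H) (boxHom (AlgHom.id k H) (AlgHom.id k H)) h) =
      boxHom (comul3 k H) (AlgHom.id k H) h := by
  rw [regroup, AlgHom.comp_apply, assoc_symm_boxHom]
  exact map_boxHom comulId_boxHom_id (BaseTensor.id_comp _) h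

theorem regroup_boxHom (h : H) : regroup k H (boxHom (comul2 k H) (comul2 k H) h) =
    boxHom (comul3 k H) (AlgHom.id k H) h := by
  have h1 : boxHom (AlgHom.id k H) (AlgHom.id k H) = comul2 k H := AlgHom.ext fun h => by
    rw [← id_comul2]; rfl
  rw [← regroup_boxHom_id, h1]

/-- The reordering `(p ⊗ q) ⊗ (r ⊗ s) ↦ (p ⊗ q ⊗ r) ⊗ s` on scalars. -/
def Scalar22.regroup : Scalar22 k H →ₗ[k] Scalar31 k H := push (Pseudo.regroup k H) regroup_boxHom

/-- The exchange `(p ⊗ q) ⊗ (r ⊗ s) ↦ (r ⊗ s) ⊗ (p ⊗ q)` on scalars. -/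
def Scalar22.comm : Scalar22 k H →ₗ[k] Scalar22 k H :=
  push (Algebra.TensorProduct.comm k (H2 k H) (H2 k H)).toAlgHom (comm_boxHom _ _)

/-- The exchange `(p ⊗ q) ⊗ (r ⊗ s) ↦ (q ⊗ p) ⊗ (r ⊗ s)` on scalars. -/
def Scalar22.flipLeft : Scalar22 k H →ₗ[k] Scalar22 k H :=
  push (Algebra.TensorProduct.map (flip2 k H) (AlgHom.id k (H2 k H)))
    (map_boxHom (flip2_comul k H) (BaseTensor.id_comp (comul2 k H)))

/-- The exchange `(p ⊗ q) ⊗ (r ⊗ s) ↦ (p ⊗ q) ⊗ (s ⊗ r)` on scalars. -/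
def Scalar22.flipRight : Scalar22 k H →ₗ[k] Scalar22 k H :=
  push (Algebra.TensorProduct.map (AlgHom.id k (H2 k H)) (flip2 k H))
    (map_boxHom (BaseTensor.id_comp (comul2 k H)) (flip2_comul k H))

/-- Invariance of the form, with a generalised element as the first argument. -/
theorem pair_compLeft_pt (hinv : IsInvariantForm μ B) (t : PT2 k H R) (r s : R) :
    pair B (μ.compLeft t r) (pt k H s) = Scalar22.regroup (pair B t (μ.toFun r s)) := by
  have h1 := pair_assoc μ B μ B hinv t (pt k H r) (pt k H s)
  rw [pair_pt, pair_push_right] at h1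
  rw [compLeft_eq_pair, pair_push_left]
  have h2 := congrArg (fun x : BaseTensor (boxHom (comul2 k H)
    (boxHom (AlgHom.id k H) (AlgHom.id k H))) (Triv k H) =>
      (push (regroup k H) regroup_boxHom_id x : Scalar31 k H)) h1
  beta_reduce at h2
  rw [push_push, push_push] at h2
  refine Eq.trans (push_congr _ ?_ _) (h2.trans (push_congr _ ?_ _))
  · ext <;> simp [regroup]
  · ext <;> simp [regroup]

variable (k H) in
/-- The rotation of the first three factors. -/
def rot3Id : H3 k H ⊗[k] H →ₐ[k] H3 k H ⊗[k] H :=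
  Algebra.TensorProduct.map (rot3 k H) (AlgHom.id k H)

theorem rot3Id_boxHom (h : H) : rot3Id k H (boxHom (comul3 k H) (AlgHom.id k H) h) =
    boxHom (comul3 k H) (AlgHom.id k H) h := by
  have h1 : ∀ h : H, rot3 k H (comul3 k H h) = comul3 k H h := rot3_comul3
  have h2 : ∀ h : H, AlgHom.id k H (AlgHom.id k H h) = AlgHom.id k H h := fun _ => rfl
  exact map_boxHom h1 h2 h

/-- The rotation of the first three factors on scalars. -/
def Scalar31.rot : Scalar31 k H →ₗ[k] Scalar31 k H := push (rot3Id k H) rot3Id_boxHom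

variable (k H) in
/-- The reordering `(p ⊗ q ⊗ r) ⊗ s ↦ (p ⊗ q) ⊗ (r ⊗ s)`. -/
def ungroup : H3 k H ⊗[k] H →ₐ[k] H2 k H ⊗[k] H2 k H :=
  (Algebra.TensorProduct.assoc k k k (H2 k H) H H).toAlgHom.comp
    (Algebra.TensorProduct.map (Algebra.TensorProduct.assoc k k k H H H).symm.toAlgHom
      (AlgHom.id k H))

theorem algHom_ext_fourfold {A : Type*} [Ring A] [Algebra k A] {f g : H2 k H ⊗[k] H2 k H →ₐ[k] A}
    (h : ∀ p q r s : H, f ((p ⊗ₜ[k] q) ⊗ₜ[k] (r ⊗ₜ[k] s)) = g ((p ⊗ₜ[k] q) ⊗ₜ[k] (r ⊗ₜ[k] s))) :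
    f = g :=
  AlgHom.toLinearMap_injective (TensorProduct.ext_fourfold' h)

theorem ungroup_comp_regroup :
    (ungroup k H).comp (regroup k H) = AlgHom.id k (H2 k H ⊗[k] H2 k H) :=
  algHom_ext_fourfold fun _ _ _ _ => rfl

theorem ungroup_boxHom (h : H) : ungroup k H (boxHom (comul3 k H) (AlgHom.id k H) h) =
    boxHom (comul2 k H) (comul2 k H) h := by
  rw [← regroup_boxHom, ← AlgHom.comp_apply, ungroup_comp_regroup, AlgHom.id_apply]

/-- The reordering `(p ⊗ q ⊗ r) ⊗ s ↦ (p ⊗ q) ⊗ (r ⊗ s)` on scalars. -/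
def Scalar31.ungroup : Scalar31 k H →ₗ[k] Scalar22 k H := push (Pseudo.ungroup k H) ungroup_boxHom

theorem Scalar31.ungroup_regroup (x : Scalar22 k H) :
    Scalar31.ungroup (Scalar22.regroup x) = x := by
  rw [Scalar31.ungroup, Scalar22.regroup, push_push]
  refine (push_congr _ ungroup_comp_regroup x).trans ?_
  exact push_id (BaseTensor.id_comp _) x

theorem regroup_injective {x y : Scalar22 k H} (h : Scalar22.regroup x = Scalar22.regroup y) :
    x = y := by
  rw [← Scalar31.ungroup_regroup x, h, Scalar31.ungroup_regroup]

/-- The exchange `(p ⊗ q ⊗ r) ⊗ s ↦ (p ⊗ q ⊗ s) ⊗ r` of the last two factors. -/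
def swapLast (k H : Type*) [Field k] [Ring H] [HopfAlgebra k H] :
    H3 k H ⊗[k] H →ₐ[k] H3 k H ⊗[k] H :=
  (regroup k H).comp ((Algebra.TensorProduct.map (AlgHom.id k (H2 k H)) (flip2 k H)).comp
    (ungroup k H))

theorem swapLast_boxHom (h : H) : swapLast k H (boxHom (comul3 k H) (AlgHom.id k H) h) =
    boxHom (comul3 k H) (AlgHom.id k H) h := by
  rw [swapLast, AlgHom.comp_apply, AlgHom.comp_apply, ungroup_boxHom,
    map_boxHom (BaseTensor.id_comp _) (flip2_comul k H), regroup_boxHom]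

/-- The exchange of the last two factors on scalars. -/
def Scalar31.swapLast : Scalar31 k H →ₗ[k] Scalar31 k H :=
  push (Pseudo.swapLast k H) swapLast_boxHom

theorem pair_rot (x : PT3 k H R) (s : R) : pair B (PT3.rot x) (pt k H s) =
    Scalar31.rot (pair B x (pt k H s)) := by
  rw [PT3.rot_def, pair_push_left]; rfl

/-- The form `⟨J(a, b, r), s⟩` is a cyclic sum of forms `⟨[a * b], [r * s]⟩`. -/
theorem pair_jacobiator (hinv : IsInvariantForm μ B) (a b r s : R) :
    pair B (jacobiator μ a b r) (pt k H s) =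
      Scalar22.regroup (bracketForm B μ a b r s) +
      Scalar31.rot (Scalar22.regroup (bracketForm B μ b r a s)) +
      Scalar31.rot (Scalar31.rot (Scalar22.regroup (bracketForm B μ r a b s))) := by
  rw [jacobiator, cyclicSum, map_add, map_add, LinearMap.add_apply, LinearMap.add_apply,
    pair_rot, pair_rot, pair_rot, pair_compLeft_pt B hinv, pair_compLeft_pt B hinv,
    pair_compLeft_pt B hinv]
  rfl

theorem bracketForm_comm (hB : IsSymmForm B) (a b r s : R) :
    bracketForm B μ r s a b = Scalar22.comm (bracketForm B μ a b r s) := by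
  rw [bracketForm, pair_comm B B 1 (fun u v => by rw [one_smul]; exact hB v u), one_smul]
  rfl

include hμ

theorem bracketForm_swap_left (a b r s : R) :
    bracketForm B μ b a r s = -Scalar22.flipLeft (bracketForm B μ a b r s) := by
  rw [bracketForm, hμ a b, map_neg, LinearMap.neg_apply, PT2.flip_def, pair_push_left]; rfl

theorem bracketForm_swap_right (a b r s : R) :
    bracketForm B μ a b s r = -Scalar22.flipRight (bracketForm B μ a b r s) := by
  rw [bracketForm, hμ r s, map_neg, PT2.flip_def, pair_push_right]; rfl

omit hμ

theorem regroup_flipRight (x : Scalar22 k H) :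
    Scalar22.regroup (Scalar22.flipRight x) = Scalar31.swapLast (Scalar22.regroup x) := by
  rw [Scalar22.regroup, Scalar22.flipRight, Scalar31.swapLast, push_push, push_push]
  refine push_congr _ ?_ _
  exact algHom_ext_fourfold fun _ _ _ _ => rfl

theorem rot_regroup_comm_flipLeft (x : Scalar22 k H) :
    Scalar31.rot (Scalar22.regroup (Scalar22.comm (Scalar22.flipLeft x))) =
      Scalar31.swapLast (Scalar31.rot (Scalar31.rot (Scalar22.regroup x))) := by
  simp only [Scalar22.regroup, Scalar22.flipLeft, Scalar22.comm, Scalar31.rot, Scalar31.swapLast,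
    push_push]
  refine push_congr _ ?_ _
  exact algHom_ext_fourfold fun _ _ _ _ => rfl

theorem rot_rot_regroup_flipLeft_comm (x : Scalar22 k H) :
    Scalar31.rot (Scalar31.rot (Scalar22.regroup (Scalar22.flipLeft (Scalar22.comm x)))) =
      Scalar31.swapLast (Scalar31.rot (Scalar22.regroup x)) := by
  simp only [Scalar22.regroup, Scalar22.flipLeft, Scalar22.comm, Scalar31.rot, Scalar31.swapLast,
    push_push]
  refine push_congr _ ?_ _
  exact algHom_ext_fourfold fun _ _ _ _ => rfl

include hμ

/-- The form `⟨J(a, b, r), s⟩` is skew-symmetric in `r` and `s`. -/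
theorem pair_jacobiator_swap (hB : IsSymmForm B) (hinv : IsInvariantForm μ B) (a b r s : R) :
    pair B (jacobiator μ a b s) (pt k H r) =
      -Scalar31.swapLast (pair B (jacobiator μ a b r) (pt k H s)) := by
  rw [pair_jacobiator B hinv, pair_jacobiator B hinv, bracketForm_swap_right B hμ a b r s,
    bracketForm_comm B hB a r b s, bracketForm_swap_left B hμ r a b s,
    bracketForm_swap_left B hμ a s b r, bracketForm_comm B hB b r a s]
  simp only [map_add, map_neg, regroup_flipRight, rot_regroup_comm_flipLeft,
    rot_rot_regroup_flipLeft_comm]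
  abel

end Bianchi

end Form

section Double

variable {k H : Type*} [Field k] [Ring H] [HopfAlgebra k H] [Coalgebra.IsCocomm k H]
  {L : Type*} [AddCommGroup L] [Module k L] [Module H L] [IsScalarTower k H L]

/-! ### The canonical form on `L ⊕ L*` -/

theorem canonicalForm_apply (r s : L × PDual k H L) :
    (canonicalForm k H L).toFun r s = r.2.1 s.1 + PT2.flip k H (s.2.1 r.1) := rfl

theorem canonicalForm_symm : IsSymmForm (canonicalForm k H L) := fun r s => by
  rw [canonicalForm_apply, canonicalForm_apply, map_add, PT2.flip_flip, add_comm]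

theorem canonicalForm_inl_inl (a b : L) : (canonicalForm k H L).toFun
    (LinearMap.inl H L (PDual k H L) a) (LinearMap.inl H L (PDual k H L) b) = 0 := by
  change (0 : L →ₗ[k] PT2 k H (Triv k H)) b + PT2.flip k H ((0 : L →ₗ[k] PT2 k H (Triv k H)) a) = 0
  simp

theorem canonicalForm_inr_inr (f g : PDual k H L) : (canonicalForm k H L).toFun
    (LinearMap.inr H L (PDual k H L) f) (LinearMap.inr H L (PDual k H L) g) = 0 := by
  change f.1 0 + PT2.flip k H (g.1 0) = 0
  simp

theorem canonicalForm_inr_inl (f : PDual k H L) (a : L) : (canonicalForm k H L).toFun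
    (LinearMap.inr H L (PDual k H L) f) (LinearMap.inl H L (PDual k H L) a) = f.1 a := by
  change f.1 a + PT2.flip k H ((0 : L →ₗ[k] PT2 k H (Triv k H)) 0) = f.1 a
  simp

theorem canonicalForm_inl_inr (a : L) (f : PDual k H L) : (canonicalForm k H L).toFun
    (LinearMap.inl H L (PDual k H L) a) (LinearMap.inr H L (PDual k H L) f) =
      PT2.flip k H (f.1 a) := by
  rw [canonicalForm_symm, canonicalForm_inr_inl]

theorem inl_add_inr (r : L × PDual k H L) :
    LinearMap.inl H L (PDual k H L) r.1 + LinearMap.inr H L (PDual k H L) r.2 = r :=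
  Prod.ext (by simp) (by simp)

theorem coord_canonicalForm_inl (r : L × PDual k H L) (a : L) :
    coord (canonicalForm k H L) r (LinearMap.inl H L (PDual k H L) a) = coord (ev k H L) r.2 a := by
  conv_lhs => rw [← inl_add_inr r]
  rw [map_add, LinearMap.add_apply, coord_apply, coord_apply, canonicalForm_inl_inl,
    canonicalForm_inr_inl, map_zero, zero_add]
  rfl

theorem coord_canonicalForm_inr (r : L × PDual k H L) (f : PDual k H L) :
    coord (canonicalForm k H L) r (LinearMap.inr H L (PDual k H L) f) =
      HopfAlgebra.antipode k (coord (ev k H L) f r.1) := by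
  conv_lhs => rw [← inl_add_inr r]
  rw [map_add, LinearMap.add_apply, coord_apply, coord_apply, canonicalForm_inr_inr,
    canonicalForm_inl_inr, map_zero, add_zero, scalar2_flip]
  rfl

variable {ι : Type*} [Fintype ι] {d : ι → PDual k H L} {c : ι → L}

/-- Dual families of the canonical form, from dual families of the evaluation. -/
theorem IsDualFamily.canonicalForm (hd : IsDualFamily (ev k H L) d c) :
    IsDualFamily (canonicalForm k H L)
      (Sum.elim (fun i => LinearMap.inl H L (PDual k H L) (c i))
        (fun i => LinearMap.inr H L (PDual k H L) (d i)))
      (Sum.elim (fun i => LinearMap.inr H L (PDual k H L) (d i))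
        (fun i => LinearMap.inl H L (PDual k H L) (c i))) where
  left r := by
    simp only [Fintype.sum_sum_type, Sum.elim_inl, Sum.elim_inr, coord_canonicalForm_inl,
      coord_canonicalForm_inr, ← map_smul, ← map_sum]
    rw [hd.left, hd.right, inl_add_inr]
  right r := by
    simp only [Fintype.sum_sum_type, Sum.elim_inl, Sum.elim_inr, canonicalForm_symm.coord_symm]
    simp only [coord_canonicalForm_inl, coord_canonicalForm_inr, ← map_smul, ← map_sum]
    rw [hd.left, hd.right, add_comm, inl_add_inr]

variable {A C : Type*} [Ring A] [Algebra k A] [Ring C] [Algebra k C] {θ : H →ₐ[k] A}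
  {η : H →ₐ[k] C}

variable (k H L) in
/-- `id ⊗_H inl`. -/
def inlMap (θ : H →ₐ[k] A) : BaseTensor θ L →ₗ[k] BaseTensor θ (L × PDual k H L) :=
  BaseTensor.map θ (AlgHom.id k A) (BaseTensor.id_comp θ) (LinearMap.inl H L (PDual k H L))

variable (k H L) in
/-- `id ⊗_H inr`. -/
def inrMap (θ : H →ₐ[k] A) : BaseTensor θ (PDual k H L) →ₗ[k] BaseTensor θ (L × PDual k H L) :=
  BaseTensor.map θ (AlgHom.id k A) (BaseTensor.id_comp θ) (LinearMap.inr H L (PDual k H L))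

theorem inlMap_add_inrMap (s : BaseTensor θ (L × PDual k H L)) :
    inlMap k H L θ (BaseTensor.map θ (AlgHom.id k A) (BaseTensor.id_comp θ)
      (LinearMap.fst H L (PDual k H L)) s) +
    inrMap k H L θ (BaseTensor.map θ (AlgHom.id k A) (BaseTensor.id_comp θ)
      (LinearMap.snd H L (PDual k H L)) s) = s := by
  induction s using BaseTensor.induction with
  | h0 => simp
  | ht x r =>
    simp only [inlMap, inrMap, BaseTensor.map_tmul]
    conv_rhs => rw [← inl_add_inr r, BaseTensor.tmul_add]
    rfl
  | ha s t hs ht =>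
    simp only [map_add]
    conv_rhs => rw [← hs, ← ht]
    abel

theorem pair_inr_inl (s : BaseTensor θ (PDual k H L)) (t : BaseTensor η L) :
    pair (canonicalForm k H L) (inrMap k H L θ s) (inlMap k H L η t) = pair (ev k H L) s t := by
  rw [inrMap, inlMap, pair_map (ev k H L) (canonicalForm k H L) _ _ LinearMap.id
    (fun f a => (canonicalForm_inr_inl f a).trans (BaseTensor.map_id _ _).symm)]
  refine Eq.trans ?_ (push_id (BaseTensor.id_comp _) _)
  exact push_congr _ Algebra.TensorProduct.map_id _

theorem pair_eq_zero {U V Z : Type*} [AddCommGroup U] [Module k U] [Module H U]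
    [IsScalarTower k H U] [AddCommGroup V] [Module k V] [Module H V] [IsScalarTower k H V]
    [AddCommGroup Z] [Module k Z] [Module H Z] [IsScalarTower k H Z] {U' V' : Type*}
    [AddCommGroup U'] [Module k U'] [Module H U'] [IsScalarTower k H U']
    [AddCommGroup V'] [Module k V'] [Module H V'] [IsScalarTower k H V']
    (φ : Lin2 k H U V Z) (f : U' →ₗ[H] U) (g : V' →ₗ[H] V)
    (h : ∀ u v, φ.toFun (f u) (g v) = 0) (s : BaseTensor θ U') (t : BaseTensor η V') :
    pair φ (BaseTensor.map θ (AlgHom.id k A) (BaseTensor.id_comp θ) f s)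
      (BaseTensor.map η (AlgHom.id k C) (BaseTensor.id_comp η) g t) = 0 := by
  induction s using BaseTensor.induction with
  | h0 => simp
  | ha s t hs ht => simp only [map_add, LinearMap.add_apply, hs, ht, add_zero]
  | ht x u =>
    induction t using BaseTensor.induction with
    | h0 => simp
    | ha s t hs ht => simp only [map_add, hs, ht, add_zero]
    | ht y v => rw [BaseTensor.map_tmul, BaseTensor.map_tmul, pair_tmul, h, map_zero, smul_zero]

theorem pair_inl_inl (s : BaseTensor θ L) (t : BaseTensor η L) :
    pair (canonicalForm k H L) (inlMap k H L θ s) (inlMap k H L η t) = 0 :=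
  pair_eq_zero _ _ _ canonicalForm_inl_inl s t

theorem pair_inr_inr (s : BaseTensor θ (PDual k H L)) (t : BaseTensor η (PDual k H L)) :
    pair (canonicalForm k H L) (inrMap k H L θ s) (inrMap k H L η t) = 0 :=
  pair_eq_zero _ _ _ canonicalForm_inr_inr s t

theorem inlMap_pt (a : L) : inlMap k H L (AlgHom.id k H) (pt k H a) =
    pt k H (LinearMap.inl H L (PDual k H L) a) := BaseTensor.map_tmul _ _ _ _ _ _

theorem inrMap_pt (f : PDual k H L) : inrMap k H L (AlgHom.id k H) (pt k H f) =
    pt k H (LinearMap.inr H L (PDual k H L) f) := BaseTensor.map_tmul _ _ _ _ _ _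

theorem compLeft_inl_inl (s : PT2 k H L) (a : L) :
    (canonicalForm k H L).compLeft (inlMap k H L _ s) (LinearMap.inl H L (PDual k H L) a) = 0 := by
  rw [compLeft_eq_pair, ← inlMap_pt, pair_inl_inl, map_zero]

theorem compLeft_inr_inr (s : PT2 k H (PDual k H L)) (f : PDual k H L) :
    (canonicalForm k H L).compLeft (inrMap k H L _ s) (LinearMap.inr H L (PDual k H L) f) = 0 := by
  rw [compLeft_eq_pair, ← inrMap_pt, pair_inr_inr, map_zero]

theorem compLeft_inr_inl (s : PT2 k H (PDual k H L)) (a : L) :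
    (canonicalForm k H L).compLeft (inrMap k H L _ s) (LinearMap.inl H L (PDual k H L) a) =
      (ev k H L).compLeft s a := by
  rw [compLeft_eq_pair, compLeft_eq_pair, ← inlMap_pt, pair_inr_inl]

theorem compRight_inr_inl (f : PDual k H L) (s : PT2 k H L) :
    (canonicalForm k H L).compRight (LinearMap.inr H L (PDual k H L) f) (inlMap k H L _ s) =
      (ev k H L).compRight f s := by
  rw [compRight_eq_pair, compRight_eq_pair, ← inrMap_pt]
  exact congrArg (push (AlgHom.id k (H3 k H)) boxHom_id_comul2) (pair_inr_inl _ _)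

/-! ### The double of two pseudobrackets -/

variable (Λ : Lin2 k H L L L) (M : Lin2 k H (PDual k H L) (PDual k H L) (PDual k H L))

/-- The pseudobracket `μ` on `L ⊕ L*` restricts to `Λ` on `L` and to `M` on `L*`, and the
canonical form is invariant under it. -/
abbrev IsDouble (μ : Lin2 k H (L × PDual k H L) (L × PDual k H L) (L × PDual k H L)) : Prop :=
  IsPseudoHom Λ μ (LinearMap.inl H L (PDual k H L)) ∧
    IsPseudoHom M μ (LinearMap.inr H L (PDual k H L)) ∧ IsInvariantForm μ (canonicalForm k H L)

/-- The direct sum of two pseudobrackets. -/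
def sumBracket : Lin2 k H (L × PDual k H L) (L × PDual k H L) (L × PDual k H L) where
  toFun := (Λ.toFun.compl₁₂ (LinearMap.fst k L (PDual k H L))
      (LinearMap.fst k L (PDual k H L))).compr₂ (inlMap k H L (comul2 k H)) +
    (M.toFun.compl₁₂ (LinearMap.snd k L (PDual k H L))
      (LinearMap.snd k L (PDual k H L))).compr₂ (inrMap k H L (comul2 k H))
  map_smul' f g r s := by
    change inlMap k H L _ (Λ.toFun (f • r.1) (g • s.1)) + inrMap k H L _ (M.toFun (f • r.2) (g • s.2))
      = (f ⊗ₜ[k] g : H2 k H) • (inlMap k H L _ (Λ.toFun r.1 s.1) + inrMap k H L _ (M.toFun r.2 s.2))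
    rw [Λ.map_smul', M.map_smul', inlMap, inrMap, BaseTensor.map_smul, BaseTensor.map_smul, smul_add]
    rfl

theorem sumBracket_apply (r s : L × PDual k H L) : (sumBracket Λ M).toFun r s =
    inlMap k H L _ (Λ.toFun r.1 s.1) + inrMap k H L _ (M.toFun r.2 s.2) := rfl

variable {Λ M}

section

variable {μ : Lin2 k H (L × PDual k H L) (L × PDual k H L) (L × PDual k H L)}

theorem IsDouble.left (h : IsDouble Λ M μ) : IsPseudoHom Λ μ (LinearMap.inl H L (PDual k H L)) :=
  And.left h

theorem IsDouble.right (h : IsDouble Λ M μ) : IsPseudoHom M μ (LinearMap.inr H L (PDual k H L)) :=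
  And.left (And.right h)

theorem IsDouble.invariant (h : IsDouble Λ M μ) : IsInvariantForm μ (canonicalForm k H L) :=
  And.right (And.right h)

end

theorem PT2.flip_map {V W : Type*} [AddCommGroup V] [Module k V] [Module H V] [IsScalarTower k H V]
    [AddCommGroup W] [Module k W] [Module H W] [IsScalarTower k H W] (g : V →ₗ[H] W)
    (s : PT2 k H V) : PT2.flip k H (PT2.map k H g s) = PT2.map k H g (PT2.flip k H s) := by
  induction s using BaseTensor.induction with
  | h0 => simp
  | ht x v => unfold PT2.flip PT2.map; simp only [BaseTensor.map_tmul]; rfl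
  | ha s t hs ht => simp only [map_add, hs, ht]

theorem sumBracket_skew (hΛ : ∀ a b, Λ.toFun b a = -PT2.flip k H (Λ.toFun a b))
    (hM : ∀ f g, M.toFun g f = -PT2.flip k H (M.toFun f g)) (r s : L × PDual k H L) :
    (sumBracket Λ M).toFun s r = -PT2.flip k H ((sumBracket Λ M).toFun r s) := by
  rw [sumBracket_apply, sumBracket_apply, hΛ r.1, hM r.2, map_neg, map_neg, map_add, neg_add]
  congr 2
  · exact (PT2.flip_map _ _).symm
  · exact (PT2.flip_map _ _).symm

theorem sumBracket_inl_left (a : L) (r : L × PDual k H L) :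
    (sumBracket Λ M).toFun (LinearMap.inl H L (PDual k H L) a) r =
      inlMap k H L _ (Λ.toFun a r.1) := by
  rw [sumBracket_apply]
  change _ + inrMap k H L _ (M.toFun 0 _) = _
  rw [map_zero, LinearMap.zero_apply, map_zero, add_zero]; rfl

theorem sumBracket_inl_right (a : L) (r : L × PDual k H L) :
    (sumBracket Λ M).toFun r (LinearMap.inl H L (PDual k H L) a) =
      inlMap k H L _ (Λ.toFun r.1 a) := by
  rw [sumBracket_apply]
  change _ + inrMap k H L _ (M.toFun _ 0) = _
  rw [map_zero, map_zero, add_zero]; rfl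

theorem sumBracket_inr_left (f : PDual k H L) (r : L × PDual k H L) :
    (sumBracket Λ M).toFun (LinearMap.inr H L (PDual k H L) f) r =
      inrMap k H L _ (M.toFun f r.2) := by
  rw [sumBracket_apply]
  change inlMap k H L _ (Λ.toFun 0 _) + _ = _
  rw [map_zero, LinearMap.zero_apply, map_zero, zero_add]; rfl

theorem sumBracket_inr_right (f : PDual k H L) (r : L × PDual k H L) :
    (sumBracket Λ M).toFun r (LinearMap.inr H L (PDual k H L) f) =
      inrMap k H L _ (M.toFun r.2 f) := by
  rw [sumBracket_apply]
  change inlMap k H L _ (Λ.toFun _ 0) + _ = _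
  rw [map_zero, map_zero, zero_add]; rfl

variable (Λ M) in
/-- The pseudobracket on `L ⊕ L*` for which the canonical form is invariant and that restricts to
`Λ` on `L` and to `M` on `L*`. -/
def doubleBracket (d : ι → PDual k H L) (c : ι → L) :
    Lin2 k H (L × PDual k H L) (L × PDual k H L) (L × PDual k H L) :=
  cyclicBracket (canonicalForm k H L)
    (Sum.elim (fun i => LinearMap.inl H L (PDual k H L) (c i))
      (fun i => LinearMap.inr H L (PDual k H L) (d i)))
    (Sum.elim (fun i => LinearMap.inr H L (PDual k H L) (d i))
      (fun i => LinearMap.inl H L (PDual k H L) (c i))) (sumBracket Λ M)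

/-- The form `⟨ν(a, b), c⟩` of the direct sum of brackets vanishes unless two arguments are in the
same summand and the third one in the other; hence the cyclic sum has at most one nonzero term. -/
theorem isDouble_doubleBracket (hd : IsDualFamily (ev k H L) d c) :
    IsDouble Λ M (doubleBracket Λ M d c) := by
  refine ⟨fun a b => ?_, fun f g => ?_,
    hd.canonicalForm.cyclicBracket_invariant canonicalForm_symm _⟩
  · refine hd.canonicalForm.eq_of_compLeft fun r => ?_
    rw [doubleBracket, hd.canonicalForm.compLeft_cyclicBracket, cyclicSum, sumBracket_inl_left,
      sumBracket_inl_left, sumBracket_inl_right, compLeft_inl_inl, compLeft_inl_inl]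
    simp only [map_zero, add_zero]
    rfl
  · refine hd.canonicalForm.eq_of_compLeft fun r => ?_
    rw [doubleBracket, hd.canonicalForm.compLeft_cyclicBracket, cyclicSum, sumBracket_inr_left,
      sumBracket_inr_left, sumBracket_inr_right, compLeft_inr_inr, compLeft_inr_inr]
    simp only [map_zero, add_zero]
    rfl

variable {μ μ' : Lin2 k H (L × PDual k H L) (L × PDual k H L) (L × PDual k H L)}

/-- Invariance determines the bracket of `L` with `L*` from the brackets on `L` and on `L*`. -/
theorem IsDouble.unique (hd : IsDualFamily (ev k H L) d c) (h : IsDouble Λ M μ)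
    (h' : IsDouble Λ M μ') : μ = μ' := by
  have hrot := (canonicalForm_symm.invariant_iff μ).1 h.invariant
  have hrot' := (canonicalForm_symm.invariant_iff μ').1 h'.invariant
  have hl := fun a b => (h.left a b).trans (h'.left a b).symm
  have hr := fun a b => (h.right a b).trans (h'.right a b).symm
  have hlr : ∀ a f, μ.toFun (LinearMap.inl H L (PDual k H L) a)
      (LinearMap.inr H L (PDual k H L) f) = μ'.toFun (LinearMap.inl H L (PDual k H L) a)
      (LinearMap.inr H L (PDual k H L) f) := by
    intro a f
    refine hd.canonicalForm.eq_of_compLeft fun r => ?_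
    rw [← inl_add_inr r, compLeft_add_right, compLeft_add_right]
    congr 1
    · rw [hrot, hrot, hl, ← hrot', ← hrot']
    · rw [hrot, hr, ← hrot']
  have hrl : ∀ f a, μ.toFun (LinearMap.inr H L (PDual k H L) f)
      (LinearMap.inl H L (PDual k H L) a) = μ'.toFun (LinearMap.inr H L (PDual k H L) f)
      (LinearMap.inl H L (PDual k H L) a) := by
    intro f a
    refine hd.canonicalForm.eq_of_compLeft fun r => ?_
    rw [← inl_add_inr r, compLeft_add_right, compLeft_add_right]
    congr 1
    · rw [hrot, hl, ← hrot']
    · rw [hrot, hrot, hr, ← hrot', ← hrot']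
  apply Lin2.ext
  refine LinearMap.ext fun r => LinearMap.ext fun s => ?_
  rw [← inl_add_inr r, ← inl_add_inr s]
  simp only [map_add, LinearMap.add_apply, hl, hr, hlr, hrl]

end Double

section Jacobi

variable {k H : Type*} [Field k] [Ring H] [HopfAlgebra k H] [Coalgebra.IsCocomm k H]
  {R : Type*} [AddCommGroup R] [Module k R] [Module H R] [IsScalarTower k H R]
  {R' : Type*} [AddCommGroup R'] [Module k R'] [Module H R'] [IsScalarTower k H R']

/-! ### The Jacobi identity in the double -/

theorem jacobiator_rot (μ : Lin2 k H R R R) (a b c : R) :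
    PT3.rot (jacobiator μ b c a) = jacobiator μ a b c := cyclicSum_rot _ _ _ _

theorem jacobiator_add_right (μ : Lin2 k H R R R) (a b c c' : R) :
    jacobiator μ a b (c + c') = jacobiator μ a b c + jacobiator μ a b c' := by
  simp only [jacobiator, cyclicSum, map_add, LinearMap.add_apply, compLeft_add,
    compLeft_add_right]
  abel

theorem jacobiator_add_middle (μ : Lin2 k H R R R) (a b b' c : R) :
    jacobiator μ a (b + b') c = jacobiator μ a b c + jacobiator μ a b' c := by
  simp only [jacobiator, cyclicSum, map_add, LinearMap.add_apply, compLeft_add,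
    compLeft_add_right]
  abel

theorem jacobiator_add_left (μ : Lin2 k H R R R) (a a' b c : R) :
    jacobiator μ (a + a') b c = jacobiator μ a b c + jacobiator μ a' b c := by
  simp only [jacobiator, cyclicSum, map_add, LinearMap.add_apply, compLeft_add,
    compLeft_add_right]
  abel

/-- `id ⊗_H g` on `(H ⊗ H ⊗ H) ⊗_H R`. -/
def PT3.map (g : R →ₗ[H] R') : PT3 k H R →ₗ[k] PT3 k H R' :=
  BaseTensor.map (comul3 k H) (AlgHom.id k (H3 k H)) (BaseTensor.id_comp (comul3 k H)) g

theorem PT3.rot_map (g : R →ₗ[H] R') (s : PT3 k H R) :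
    PT3.rot (PT3.map g s) = PT3.map g (PT3.rot s) := by
  induction s using BaseTensor.induction with
  | h0 => simp
  | ht x v => unfold PT3.rot PT3.map push; simp only [BaseTensor.map_tmul]; rfl
  | ha s t hs ht => simp only [map_add, hs, ht]

variable {μ : Lin2 k H R R R} {μ' : Lin2 k H R' R' R'}

theorem IsPseudoHom.compLeft {g : R →ₗ[H] R'} (hg : IsPseudoHom μ μ' g) (s : PT2 k H R) (r : R) :
    μ'.compLeft (PT2.map k H g s) (g r) = PT3.map g (μ.compLeft s r) := by
  induction s using BaseTensor.induction with
  | h0 =>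
    rw [map_zero]
    exact (map_zero (compLeftₗ μ' (g r))).trans
      (((congrArg _ (map_zero (compLeftₗ μ r))).trans (map_zero (PT3.map g))).symm)
  | ha s t hs ht => rw [map_add, compLeft_add, compLeft_add, map_add, hs, ht]
  | ht x u =>
    have h1 : PT2.map k H g (BaseTensor.tmul _ x u) = BaseTensor.tmul _ x (g u) :=
      BaseTensor.map_tmul _ _ _ _ _ _
    have h2 : ∀ w : PT2 k H R, PT2.comulId k H (PT2.map k H g w) =
        PT3.map g (PT2.comulId k H w) := by
      intro w
      induction w using BaseTensor.induction with
      | h0 => simp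
      | ht x v => unfold PT2.comulId PT2.map PT3.map; simp only [BaseTensor.map_tmul]; rfl
      | ha s t hs ht => simp only [map_add, hs, ht]
    rw [h1, Lin2.compLeft_tmul, Lin2.compLeft_tmul, hg, h2, PT3.map, BaseTensor.map_smul]
    rfl

theorem IsPseudoHom.jacobiator {g : R →ₗ[H] R'} (hg : IsPseudoHom μ μ' g) (a b c : R) :
    jacobiator μ' (g a) (g b) (g c) = PT3.map g (jacobiator μ a b c) := by
  simp only [Pseudo.jacobiator, cyclicSum, hg _ _, hg.compLeft, map_add, PT3.rot_map]

theorem pt_add (r s : R) : pt k H (r + s) = pt k H r + pt k H s := BaseTensor.tmul_add _ _ _ _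

/-- Elements of `(H ⊗ H ⊗ H) ⊗_H R` are separated by a form with dual families. -/
theorem IsDualFamily.eq_zero_of_pair {B : Lin2 k H R R (Triv k H)} {ι : Type*} [Fintype ι]
    {d c : ι → R} (hd : IsDualFamily B d c) {s : PT3 k H R}
    (h : ∀ r, pair B s (pt k H r) = 0) : s = 0 := by
  refine hd.ext fun r => ?_
  apply tmul_one_injective (comul3 k H)
  have h1 := h r
  rw [pair_pt_right] at h1
  simp only [h1, map_zero, TensorProduct.zero_tmul, BaseTensor.zero_tmul]

variable {L : Type*} [AddCommGroup L] [Module k L] [Module H L] [IsScalarTower k H L]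
  {ι : Type*} [Fintype ι] {d : ι → PDual k H L} {c : ι → L}
  {Λ : Lin2 k H L L L} {M : Lin2 k H (PDual k H L) (PDual k H L) (PDual k H L)}
  {μ : Lin2 k H (L × PDual k H L) (L × PDual k H L) (L × PDual k H L)}

theorem IsDouble.pair_jacobiator_swap (h : IsDouble Λ M μ)
    (hμ : ∀ r s, μ.toFun s r = -PT2.flip k H (μ.toFun r s)) {r s t u : L × PDual k H L}
    (h0 : pair (canonicalForm k H L) (Pseudo.jacobiator μ r s t) (pt k H u) = 0) :
    pair (canonicalForm k H L) (Pseudo.jacobiator μ r s u) (pt k H t) = 0 := by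
  rw [Pseudo.pair_jacobiator_swap _ hμ canonicalForm_symm h.invariant, h0, map_zero, neg_zero]

theorem pair_jacobiator_rot {B : Lin2 k H R R (Triv k H)} {μ : Lin2 k H R R R} {r s t u : R}
    (h0 : pair B (jacobiator μ r s t) (pt k H u) = 0) :
    pair B (jacobiator μ t r s) (pt k H u) = 0 := by
  rw [← jacobiator_rot, pair_rot, h0, map_zero]

/-- By its symmetries, the form `⟨J(r, s, t), u⟩` of a double vanishes as soon as it vanishes
when at least three arguments are in the same summand, and when `r, s ∈ L*` and `t, u ∈ L`. -/
theorem IsDouble.jacobiator_eq_zero (hd : IsDualFamily (ev k H L) d c) (h : IsDouble Λ M μ)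
    (hμ : ∀ r s, μ.toFun s r = -PT2.flip k H (μ.toFun r s))
    (hΛ : ∀ a b c, Pseudo.jacobiator Λ a b c = 0) (hM : ∀ f g l, Pseudo.jacobiator M f g l = 0)
    (hW : ∀ f g a b, pair (canonicalForm k H L) (Pseudo.jacobiator μ
      (LinearMap.inr H L (PDual k H L) f) (LinearMap.inr H L (PDual k H L) g)
      (LinearMap.inl H L (PDual k H L) a)) (pt k H (LinearMap.inl H L (PDual k H L) b)) = 0)
    (r s t : L × PDual k H L) : Pseudo.jacobiator μ r s t = 0 := by
  have hlll : ∀ a b c, Pseudo.jacobiator μ (LinearMap.inl H L (PDual k H L) a)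
      (LinearMap.inl H L (PDual k H L) b) (LinearMap.inl H L (PDual k H L) c) = 0 :=
    fun a b c => by rw [h.left.jacobiator, hΛ, map_zero]
  have hddd : ∀ f g l, Pseudo.jacobiator μ (LinearMap.inr H L (PDual k H L) f)
      (LinearMap.inr H L (PDual k H L) g) (LinearMap.inr H L (PDual k H L) l) = 0 :=
    fun a b c => by rw [h.right.jacobiator, hM, map_zero]
  have hlld : ∀ a b f, Pseudo.jacobiator μ (LinearMap.inl H L (PDual k H L) a)
      (LinearMap.inl H L (PDual k H L) b) (LinearMap.inr H L (PDual k H L) f) = 0 := by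
    intro a b f
    refine hd.canonicalForm.eq_zero_of_pair fun r => ?_
    rw [← inl_add_inr r, pt_add, map_add]
    -- The chain `(f, g, a; b) → (g, a, f; b) → (g, a, b; f) → (a, b, g; f)` of rotations and an
    -- exchange of the last two arguments leads from `hW` to the arguments needed here.
    rw [h.pair_jacobiator_swap hμ (by rw [hlll, map_zero, LinearMap.zero_apply]), zero_add]
    exact pair_jacobiator_rot (pair_jacobiator_rot (h.pair_jacobiator_swap hμ
      (pair_jacobiator_rot (pair_jacobiator_rot (hW _ _ _ _)))))
  have hddl : ∀ f g a, Pseudo.jacobiator μ (LinearMap.inr H L (PDual k H L) f)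
      (LinearMap.inr H L (PDual k H L) g) (LinearMap.inl H L (PDual k H L) a) = 0 := by
    intro f g a
    refine hd.canonicalForm.eq_zero_of_pair fun r => ?_
    rw [← inl_add_inr r, pt_add, map_add, hW, zero_add]
    exact h.pair_jacobiator_swap hμ (by rw [hddd, map_zero, LinearMap.zero_apply])
  have hrot : ∀ {r s t : L × PDual k H L}, Pseudo.jacobiator μ r s t = 0 →
      Pseudo.jacobiator μ t r s = 0 := fun h0 => by rw [← jacobiator_rot, h0, map_zero]
  rw [← inl_add_inr r, ← inl_add_inr s, ← inl_add_inr t]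
  simp only [jacobiator_add_left, jacobiator_add_middle, jacobiator_add_right, hlll, hddd, hlld,
    hddl, hrot (hlld _ _ _), hrot (hddl _ _ _), hrot (hrot (hlld _ _ _)),
    hrot (hrot (hddl _ _ _)), add_zero]

end Jacobi

section Cocycle

variable {k H : Type*} [Field k] [Ring H] [HopfAlgebra k H] 

/-! ### Normal forms and coordinates -/

section
variable {Z : Type*} [AddCommGroup Z] [Module k Z] [Module H Z] [IsScalarTower k H Z]

theorem PT2.ofNormal_tmul (h : H) (z : Z) :
    PT2.ofNormal (h ⊗ₜ[k] z) = BaseTensor.tmul (comul2 k H) (h ⊗ₜ[k] 1) z := rfl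

theorem PT2.normal_tmul (x : H2 k H) (z : Z) :
    PT2.normal k H (BaseTensor.tmul (comul2 k H) x z) = LinearMap.lTensor H
      ((Algebra.lsmul k k Z : H →ₐ[k] Module.End k Z).toLinearMap.flip z) (fourier k H x) :=
  BaseTensor.lift_tmul _ _ _ _ _

/-- An element of `(H ⊗ H) ⊗_H Z` is recovered from its normal form. -/
theorem PT2.ofNormal_normal (s : PT2 k H Z) : PT2.ofNormal (PT2.normal k H s) = s := by
  induction s using BaseTensor.induction with
  | h0 => simp
  | ha s t hs ht => simp only [map_add, hs, ht]
  | ht x z =>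
    induction x using TensorProduct.induction_on with
    | zero => simp [BaseTensor.zero_tmul]
    | add s t hs ht => simp only [BaseTensor.add_tmul, map_add, hs, ht]
    | tmul f g =>
      apply push_injective (AlgHom.id k (H2 k H)) id_comul2 (AlgHom.id k (H2 k H)) rfl
      rw [push_tmul, AlgHom.id_apply, tmul_eq_normalAux, PT2.normal_tmul, fourier_tmul]
      have h1 : ∀ w : H2 k H, push (AlgHom.id k (H2 k H)) id_comul2 (PT2.ofNormal
          (LinearMap.lTensor H ((Algebra.lsmul k k Z : H →ₐ[k] Module.End k Z).toLinearMap.flip z)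
            ((f ⊗ₜ[k] 1) * LinearMap.rTensor H (HopfAlgebra.antipode k) w))) =
          normalAux (AlgHom.id k H) f z w := by
        intro w
        induction w using TensorProduct.induction_on with
        | zero => simp
        | add s t hs ht => simp only [mul_add, map_add, hs, ht]
        | tmul a b =>
          rw [normalAux_tmul, LinearMap.rTensor_tmul, Algebra.TensorProduct.tmul_mul_tmul, one_mul,
            LinearMap.lTensor_tmul, PT2.ofNormal_tmul, push_tmul]
          rfl
      exact h1 _

end

section Scalars

variable {A C : Type*} [Ring A] [Algebra k A] [Ring C] [Algebra k C]

/-- A factor from `H` can be moved through the tensor product over `H` with the trivial module. -/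
theorem tmul_mul_right_eq (θ : H →ₐ[k] A) (η : H →ₐ[k] C) (x : A) (y : C) (h : H) :
    BaseTensor.tmul (boxHom θ η) (x ⊗ₜ[k] (y * η h)) (Triv.one k H) =
      BaseTensor.tmul (boxHom θ η) ((x * θ (HopfAlgebra.antipode k h)) ⊗ₜ[k] y) (Triv.one k H) := by
  have h1 := eq_tmul_resid θ (BaseTensor.tmul _ ((1 : A) ⊗ₜ[k] h) (Triv.one k H))
  rw [resid_tmul, one_mul] at h1
  have h2 := congrArg (fun s => (x ⊗ₜ[k] y : A ⊗[k] C) •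
    push (Algebra.TensorProduct.map (AlgHom.id k A) η)
      (map_boxHom (BaseTensor.id_comp θ) (apply_id η)) s) h1
  simp only [push_tmul, BaseTensor.smul_tmul] at h2
  simpa using h2

variable {U V : Type*} [AddCommGroup U] [Module k U] [Module H U] [IsScalarTower k H U]
  [AddCommGroup V] [Module k V] [Module H V] [IsScalarTower k H V]

theorem pair_tmul_right (φ : Lin2 k H U V (Triv k H)) {θ : H →ₐ[k] A} {η : H →ₐ[k] C}
    (s : BaseTensor θ U) (y : C) (v : V) :
    pair φ s (BaseTensor.tmul η y v) =
      BaseTensor.tmul (boxHom θ η) (contract φ v s ⊗ₜ[k] y) (Triv.one k H) := by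
  have h1 : pair φ s (y • push η (apply_id η) (pt k H v)) =
      ((1 : A) ⊗ₜ[k] y) • pair φ s (push η (apply_id η) (pt k H v)) := by
    conv_lhs => rw [← one_smul A s, pair_smul]
  rw [tmul_eq_smul_push η, h1, pair_push_right, pair_pt_right, push_tmul, BaseTensor.smul_tmul]
  simp

theorem scalar3_compRight (φ : Lin2 k H U V (Triv k H)) (u : U) (s : PT2 k H V) :
    scalar3 k H (φ.compRight u s) = TensorProduct.comm k H H
      (LinearMap.lTensor H (coord φ u) (PT2.normal k H s)) := by
  conv_lhs => rw [← PT2.ofNormal_normal s]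
  generalize PT2.normal k H s = n
  induction n using TensorProduct.induction_on with
  | zero =>
    rw [map_zero, map_zero, map_zero]
    exact (congrArg _ (map_zero (compRightₗ φ u))).trans (map_zero _)
  | add s t hs ht =>
    have h1 : φ.compRight u (PT2.ofNormal s + PT2.ofNormal t) = _ := map_add (compRightₗ φ u) _ _
    rw [map_add, h1, map_add, map_add, map_add, ← hs, ← ht]; rfl
  | tmul h v =>
    rw [PT2.ofNormal_tmul, Lin2.compRight_tmul, eq_tmul_coord, PT2.idComul, BaseTensor.map_tmul,
      BaseTensor.smul_tmul, LinearMap.lTensor_tmul, TensorProduct.comm_tmul]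
    refine Eq.trans (congrArg _ ?_) (scalar3_one _)
    congr 1
    simp [incl23, idComul, incl12, Algebra.TensorProduct.one_def]

end Scalars

end Cocycle

section Cocycle

variable {k H : Type*} [Field k] [Ring H] [HopfAlgebra k H] [Coalgebra.IsCocomm k H]
  {R : Type*} [AddCommGroup R] [Module k R] [Module H R] [IsScalarTower k H R]

/-! ### The cocycle condition as a Jacobi identity -/

variable (k H) in
/-- The exchange `(p ⊗ q) ⊗ (r ⊗ s) ↦ (p ⊗ r) ⊗ (q ⊗ s)` of the middle factors. -/
def swapMiddle : H2 k H ⊗[k] H2 k H →ₐ[k] H2 k H ⊗[k] H2 k H :=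
  (Algebra.TensorProduct.tensorTensorTensorComm k k k k H H H H).toAlgHom

theorem swapMiddle_boxHom (h : H) : swapMiddle k H (boxHom (comul2 k H) (comul2 k H) h) =
    boxHom (comul2 k H) (comul2 k H) h := by
  have h1 := LinearMap.congr_fun (CoalgHomClass.map_comp_comul (Coalgebra.comulCoalgHom k H)) h
  exact h1.symm

/-- The exchange of the middle factors on scalars. -/
def Scalar22.swapMiddle : Scalar22 k H →ₗ[k] Scalar22 k H :=
  push (Pseudo.swapMiddle k H) swapMiddle_boxHom

theorem regroup_flipLeft_swapMiddle (x : Scalar22 k H) :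
    Scalar22.regroup (Scalar22.flipLeft (Scalar22.swapMiddle x)) =
      Scalar31.rot (Scalar22.regroup x) := by
  simp only [Scalar22.regroup, Scalar22.flipLeft, Scalar22.swapMiddle, Scalar31.rot, push_push]
  refine push_congr _ ?_ _
  exact algHom_ext_fourfold fun _ _ _ _ => rfl

theorem regroup_flipRight_swapMiddle (x : Scalar22 k H) :
    Scalar22.regroup (Scalar22.flipRight (Scalar22.swapMiddle x)) =
      Scalar31.rot (Scalar22.regroup (Scalar22.comm x)) := by
  simp only [Scalar22.regroup, Scalar22.flipRight, Scalar22.comm, Scalar22.swapMiddle,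
    Scalar31.rot, push_push]
  refine push_congr _ ?_ _
  exact algHom_ext_fourfold fun _ _ _ _ => rfl

theorem regroup_swapMiddle (x : Scalar22 k H) :
    Scalar22.regroup (Scalar22.swapMiddle x) =
      Scalar31.rot (Scalar31.rot (Scalar22.regroup (Scalar22.flipLeft x))) := by
  simp only [Scalar22.regroup, Scalar22.flipLeft, Scalar22.swapMiddle,
    Scalar31.rot, push_push]
  refine push_congr _ ?_ _
  exact algHom_ext_fourfold fun _ _ _ _ => rfl

theorem regroup_flipRight_flipLeft_swapMiddle (x : Scalar22 k H) :
    Scalar22.regroup (Scalar22.flipRight (Scalar22.flipLeft (Scalar22.swapMiddle x))) =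
      Scalar31.rot (Scalar31.rot (Scalar22.regroup (Scalar22.flipLeft (Scalar22.comm x)))) := by
  simp only [Scalar22.regroup, Scalar22.flipLeft, Scalar22.flipRight, Scalar22.comm,
    Scalar22.swapMiddle, Scalar31.rot, push_push]
  refine push_congr _ ?_ _
  exact algHom_ext_fourfold fun _ _ _ _ => rfl

variable (k H) in
/-- The element `(p ⊗ q) ⊗ (r ⊗ 1) ⊗_H 1` for a tensor `(p ⊗ q) ⊗ r`. -/
def Scalar22.ofCoord : H2 k H ⊗[k] H →ₗ[k] Scalar22 k H :=
  (BaseTensor.tmulₗ (boxHom (comul2 k H) (comul2 k H)) (Triv k H)).flip (Triv.one k H) ∘ₗ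
    LinearMap.lTensor (H2 k H) (Algebra.TensorProduct.includeLeft : H →ₐ[k] H2 k H).toLinearMap

theorem Scalar22.ofCoord_tmul (x : H2 k H) (h : H) : Scalar22.ofCoord k H (x ⊗ₜ[k] h) =
    BaseTensor.tmul (boxHom (comul2 k H) (comul2 k H)) (x ⊗ₜ[k] (h ⊗ₜ[k] (1 : H)))
      (Triv.one k H) := rfl

theorem regroup_ofCoord (w : H2 k H ⊗[k] H) : Scalar22.regroup (Scalar22.ofCoord k H w) =
    BaseTensor.tmul (boxHom (comul3 k H) (AlgHom.id k H))
      (Algebra.TensorProduct.assoc k k k H H H w ⊗ₜ[k] (1 : H)) (Triv.one k H) := by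
  induction w using TensorProduct.induction_on with
  | zero => simp [BaseTensor.zero_tmul]
  | add s t hs ht => simp only [map_add, hs, ht, TensorProduct.add_tmul, BaseTensor.add_tmul]
  | tmul x h => rw [Scalar22.ofCoord_tmul, Scalar22.regroup, push_tmul]; rfl

theorem ofCoord_injective : Function.Injective (Scalar22.ofCoord k H) := by
  intro v w h
  have h1 := congrArg Scalar22.regroup h
  rw [regroup_ofCoord, regroup_ofCoord] at h1
  exact (Algebra.TensorProduct.assoc k k k H H H).injective (tmul_one_injective (comul3 k H) h1)

variable {L : Type*} [AddCommGroup L] [Module k L] [Module H L] [IsScalarTower k H L]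

/-- The pairing of `(H ⊗ H) ⊗_H (L ⊗ L)` with two elements of `L*`,
`x ⊗_H u ↦ ((f ⊗ g)(u) ⊗ x) ⊗_H 1`. -/
def pairTensor (f g : PDual k H L) : PT2 k H (DTensor k H L L) →ₗ[k] Scalar22 k H :=
  BaseTensor.lift (comul2 k H)
    (((TensorProduct.mk k (H2 k H) (H2 k H)).compr₂
        ((BaseTensor.tmulₗ (boxHom (comul2 k H) (comul2 k H)) (Triv k H)).flip
          (Triv.one k H))).flip.compl₂
      (coord2 f g ∘ₗ (DTensor.toTensor k H L L).toLinearMap))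
    (fun x h u => by
      have h1 : coord2 f g (DTensor.toTensor k H L L (h • u)) =
          coord2 f g (DTensor.toTensor k H L L u) * comul2 k H (HopfAlgebra.antipode k h) := by
        refine (coord2_act2 f g (comul2 k H h) _).trans ?_
        congr 1
        exact (comul_antipode k h).symm
      change BaseTensor.tmul _ (coord2 f g (DTensor.toTensor k H L L u) ⊗ₜ[k] (x * comul2 k H h)) _ =
        BaseTensor.tmul _ (coord2 f g (DTensor.toTensor k H L L (h • u)) ⊗ₜ[k] x) _
      rw [tmul_mul_right_eq, h1])

theorem pairTensor_tmul (f g : PDual k H L) (x : H2 k H) (u : DTensor k H L L) :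
    pairTensor f g (BaseTensor.tmul _ x u) = BaseTensor.tmul _
      (coord2 f g (DTensor.toTensor k H L L u) ⊗ₜ[k] x) (Triv.one k H) :=
  BaseTensor.lift_tmul _ _ _ _ _

theorem pairTensor_flip (f g : PDual k H L) (s : PT2 k H (DTensor k H L L)) :
    pairTensor f g (PT2.flip k H s) = Scalar22.flipRight (pairTensor f g s) := by
  induction s using BaseTensor.induction with
  | h0 => simp
  | ha s t hs ht => simp only [map_add, hs, ht]
  | ht x u =>
    rw [PT2.flip_def, push_tmul, pairTensor_tmul, pairTensor_tmul, Scalar22.flipRight, push_tmul]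
    rfl

theorem pairTensor_map_cobracket {δ : L →ₗ[H] DTensor k H L L}
    {M : Lin2 k H (PDual k H L) (PDual k H L) (PDual k H L)} (h : IsDual δ M) (f g : PDual k H L)
    (s : PT2 k H L) : pairTensor f g (PT2.map k H δ s) = pair (ev k H L) (M.toFun f g) s := by
  induction s using BaseTensor.induction with
  | h0 => simp
  | ha s t hs ht => simp only [map_add, hs, ht]
  | ht x a =>
    have h1 : PT2.map k H δ (BaseTensor.tmul _ x a) = BaseTensor.tmul _ x (δ a) :=
      BaseTensor.map_tmul _ _ _ _ _ _
    rw [h1, pairTensor_tmul, pair_tmul_right, h]; rfl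

theorem pairTensor_ofNormal (f g : PDual k H L) (n : H ⊗[k] DTensor k H L L) :
    pairTensor f g (PT2.ofNormal n) = Scalar22.ofCoord k H (TensorProduct.comm k H (H2 k H)
      (LinearMap.lTensor H (coord2 f g ∘ₗ (DTensor.toTensor k H L L).toLinearMap) n)) := by
  induction n using TensorProduct.induction_on with
  | zero => simp
  | add s t hs ht => simp only [map_add, hs, ht]
  | tmul h u => rw [PT2.ofNormal_tmul, pairTensor_tmul]; rfl

variable {ι : Type*} [Fintype ι] {d : ι → PDual k H L} {c : ι → L}

/-- The elements of `(H ⊗ H) ⊗_H (L ⊗ L)` are separated by the elements of `L*`. -/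
theorem eq_zero_of_pairTensor (hd : IsDualFamily (ev k H L) d c)
    {s : PT2 k H (DTensor k H L L)} (h : ∀ f g : PDual k H L, pairTensor f g s = 0) : s = 0 := by
  have h1 : ∀ f g : PDual k H L, LinearMap.lTensor H (coord2 f g ∘ₗ (DTensor.toTensor k H L L).toLinearMap)
      (PT2.normal k H s) = 0 := by
    intro f g
    have h2 := h f g
    rw [← PT2.ofNormal_normal s, pairTensor_ofNormal] at h2
    have h3 := ofCoord_injective (h2.trans (map_zero _).symm)
    exact (TensorProduct.comm k H (H2 k H)).injective (h3.trans (map_zero _).symm)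
  have h4 : ∀ n : H ⊗[k] DTensor k H L L, ∑ i, ∑ j, LinearMap.lTensor H
      ((DTensor.toTensor k H L L).symm.toLinearMap ∘ₗ
        TensorProduct.map (antipodeSMul (c i)) (antipodeSMul (c j)))
      (LinearMap.lTensor H (coord2 (d i) (d j) ∘ₗ (DTensor.toTensor k H L L).toLinearMap) n) =
        n := by
    intro n
    induction n using TensorProduct.induction_on with
    | zero => simp
    | add s t hs ht => simp only [map_add, Finset.sum_add_distrib, hs, ht]
    | tmul h u =>
      simp only [LinearMap.lTensor_tmul, LinearMap.comp_apply, LinearEquiv.coe_coe]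
      simp only [← TensorProduct.tmul_sum, ← map_sum, sum_map_antipodeSMul hd]
      rfl
  rw [← PT2.ofNormal_normal s, ← h4 (PT2.normal k H s)]
  simp only [h1, map_zero, Finset.sum_const_zero]

end Cocycle

section Cocycle

variable {k H : Type*} [Field k] [Ring H] [HopfAlgebra k H] [Coalgebra.IsCocomm k H]
  {L : Type*} [AddCommGroup L] [Module k L] [Module H L] [IsScalarTower k H L]
  {Λ : Lin2 k H L L L} {M : Lin2 k H (PDual k H L) (PDual k H L) (PDual k H L)}
  {μ : Lin2 k H (L × PDual k H L) (L × PDual k H L) (L × PDual k H L)}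
  {δ : L →ₗ[H] DTensor k H L L}

variable (μ) in
/-- The component in `L*` of the bracket of `f ∈ L*` with `a ∈ L`. -/
def coadjoint (f : PDual k H L) (a : L) : PT2 k H (PDual k H L) :=
  PT2.map k H (LinearMap.snd H L (PDual k H L))
    (μ.toFun (LinearMap.inr H L (PDual k H L) f) (LinearMap.inl H L (PDual k H L) a))

variable (μ) in
/-- The component in `L` of the bracket of `f ∈ L*` with `a ∈ L`. -/
def dualCoadjoint (f : PDual k H L) (a : L) : PT2 k H L :=
  PT2.map k H (LinearMap.fst H L (PDual k H L))
    (μ.toFun (LinearMap.inr H L (PDual k H L) f) (LinearMap.inl H L (PDual k H L) a))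

theorem inlMap_add_coadjoint (f : PDual k H L) (a : L) :
    inlMap k H L _ (dualCoadjoint μ f a) + inrMap k H L _ (coadjoint μ f a) =
      μ.toFun (LinearMap.inr H L (PDual k H L) f) (LinearMap.inl H L (PDual k H L) a) :=
  inlMap_add_inrMap _

/-- The component in `L*` of the bracket of `f` with `a` is the transpose of the adjoint action
of `a` on `L`. -/
theorem IsDouble.contract_coadjoint (h : IsDouble Λ M μ) (f : PDual k H L) (a m : L) :
    contract (ev k H L) m (coadjoint μ f a) = TensorProduct.comm k H H
      (LinearMap.lTensor H (coord (ev k H L) f) (PT2.normal k H (Λ.toFun a m))) := by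
  rw [← scalar3_compRight, ← scalar3_compLeft, ← compRight_inr_inl, ← compLeft_inr_inl]
  have h1 : inlMap k H L (comul2 k H) (Λ.toFun a m) =
      μ.toFun (LinearMap.inl H L (PDual k H L) a) (LinearMap.inl H L (PDual k H L) m) :=
    (h.left a m).symm
  rw [h1, ← h.invariant, ← inlMap_add_coadjoint, compLeft_add, compLeft_inl_inl, zero_add]

variable (μ) in
/-- The form `⟨[f * a], [g * b]⟩` with `[f * a]` replaced by its component in `L*`. -/
def mixedForm (f g : PDual k H L) (a b : L) : Scalar22 k H :=
  pair (canonicalForm k H L) (inrMap k H L _ (coadjoint μ f a))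
    (μ.toFun (LinearMap.inr H L (PDual k H L) g) (LinearMap.inl H L (PDual k H L) b))

/-- By invariance the mixed form is `⟨[[f * a]' * g], b⟩`, where `[f * a]'` is the component in
`L*`; by duality this is a coordinate of `δ(b)`. -/
theorem IsDouble.mixedForm_eq (h : IsDouble Λ M μ) (hδ : IsDual δ M) (f g : PDual k H L)
    (a b : L) :
    mixedForm μ f g a b = Scalar22.ofCoord k H (TensorProduct.map (contractₗ (ev k H L) (coadjoint μ f a))
      (coord (ev k H L) g) (toTensor δ b)) := by
  apply regroup_injective
  rw [mixedForm, regroup_ofCoord, hδ.map_contract_left, ← pair_compLeft_pt _ h.invariant]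
  have h1 : μ.compLeft (inrMap k H L _ (coadjoint μ f a)) (LinearMap.inr H L (PDual k H L) g) =
      inrMap k H L _ (M.compLeft (coadjoint μ f a) g) := h.right.compLeft _ _
  rw [h1, ← inlMap_pt, pair_inr_inl, pair_pt_right]

/-- As `L` and `L*` are isotropic, `⟨[f * a], [g * b]⟩` is the sum of the contributions of the
component of `[f * a]` in `L*` and of the component of `[g * b]` in `L*`. -/
theorem bracketForm_eq_add_comm (f g : PDual k H L) (a b : L) :
    bracketForm (canonicalForm k H L) μ (LinearMap.inr H L (PDual k H L) f)
      (LinearMap.inl H L (PDual k H L) a) (LinearMap.inr H L (PDual k H L) g)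
      (LinearMap.inl H L (PDual k H L) b) =
    mixedForm μ f g a b + Scalar22.comm (mixedForm μ g f b a) := by
  have h1 : ∀ s t : PT2 k H (L × PDual k H L), pair (canonicalForm k H L) t s =
      Scalar22.comm (pair (canonicalForm k H L) s t) := by
    intro s t
    rw [pair_comm (canonicalForm k H L) (canonicalForm k H L) 1
      (fun u v => by rw [one_smul]; exact canonicalForm_symm v u), one_smul]
    rfl
  rw [mixedForm, mixedForm, ← h1, bracketForm, ← inlMap_add_coadjoint f a, ← inlMap_add_coadjoint g b]
  simp only [map_add, LinearMap.add_apply, pair_inl_inl, pair_inr_inr]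
  abel

theorem flipLeft_swapMiddle_ofCoord (x y z : H) :
    Scalar22.flipLeft (Scalar22.swapMiddle (Scalar22.ofCoord k H ((x ⊗ₜ[k] z) ⊗ₜ[k] y))) =
      Scalar22.ofCoord k H ((y ⊗ₜ[k] x) ⊗ₜ[k] z) := by
  rw [Scalar22.ofCoord_tmul, Scalar22.swapMiddle, push_tmul, Scalar22.flipLeft, push_tmul]
  rfl

theorem swapMiddle_ofCoord (x y z : H) :
    Scalar22.swapMiddle (Scalar22.ofCoord k H ((x ⊗ₜ[k] z) ⊗ₜ[k] y)) =
      Scalar22.ofCoord k H ((x ⊗ₜ[k] y) ⊗ₜ[k] z) := by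
  rw [Scalar22.ofCoord_tmul, Scalar22.swapMiddle, push_tmul]
  rfl

/-- The pairing of the action of `a` on `L ⊗ L` with `f` and `g`, in terms of the transposed
actions on `f` and `g`. -/
theorem IsDouble.pairTensor_tensorAct (h : IsDouble Λ M μ) (f g : PDual k H L) (a : L)
    (u : L ⊗[k] L) :
    pairTensor f g (tensorAct Λ Λ a u) =
      Scalar22.swapMiddle (Scalar22.ofCoord k H (TensorProduct.map
        (contractₗ (ev k H L) (coadjoint μ f a)) (coord (ev k H L) g) u)) +
      Scalar22.flipLeft (Scalar22.swapMiddle (Scalar22.ofCoord k H (TensorProduct.map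
        (contractₗ (ev k H L) (coadjoint μ g a)) (coord (ev k H L) f)
          (TensorProduct.comm k L L u)))) := by
  rw [tensorAct, LinearMap.comp_apply, pairTensor_ofNormal, LinearMap.comp_apply,
    LinearMap.add_apply, map_add, map_add, map_add, map_add]
  induction u using TensorProduct.induction_on with
  | zero => simp
  | add s t hs ht =>
    simp only [map_add] at hs ht ⊢
    rw [add_add_add_comm, hs, ht, add_add_add_comm]
  | tmul m n =>
    congr 1
    · rw [LinearMap.comp_apply, LinearMap.rTensor_tmul, TensorProduct.map_tmul, contractₗ_apply,
        h.contract_coadjoint, LinearMap.comp_apply]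
      generalize PT2.normal k H (Λ.toFun a m) = v
      induction v using TensorProduct.induction_on with
      | zero => simp
      | add s t hs ht => simp only [map_add, TensorProduct.add_tmul, hs, ht]
      | tmul p m' =>
        rw [LinearMap.lTensor_tmul, TensorProduct.comm_tmul, swapMiddle_ofCoord]
        rfl
    · rw [LinearMap.comp_apply, LinearMap.lTensor_tmul, TensorProduct.comm_tmul,
        TensorProduct.map_tmul, contractₗ_apply, h.contract_coadjoint, LinearMap.comp_apply]
      generalize PT2.normal k H (Λ.toFun a n) = v
      induction v using TensorProduct.induction_on with
      | zero => simp
      | add s t hs ht =>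
        simp only [map_add, TensorProduct.add_tmul, TensorProduct.tmul_add, hs, ht]
      | tmul p m' =>
        rw [LinearMap.lTensor_tmul, TensorProduct.comm_tmul, flipLeft_swapMiddle_ofCoord]
        rfl

/-- The failure of the cocycle condition, paired with `f` and `g`, is up to sign the form
`⟨J(f, g, a), b⟩`. -/
theorem IsDouble.pair_jacobiator_eq (h : IsDouble Λ M μ)
    (hμ : ∀ r s, μ.toFun s r = -PT2.flip k H (μ.toFun r s)) (hδ : IsDual δ M)
    (hs : ∀ a, TensorProduct.comm k L L (toTensor δ a) = -toTensor δ a) (f g : PDual k H L)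
    (a b : L) :
    pair (canonicalForm k H L) (Pseudo.jacobiator μ
      (LinearMap.inr H L (PDual k H L) f) (LinearMap.inr H L (PDual k H L) g)
      (LinearMap.inl H L (PDual k H L) a)) (pt k H (LinearMap.inl H L (PDual k H L) b)) =
    -Scalar22.regroup (pairTensor f g (tensorAct Λ Λ a (toTensor δ b) -
      PT2.flip k H (tensorAct Λ Λ b (toTensor δ a)) - PT2.map k H δ (Λ.toFun a b))) := by
  have h1 : pairTensor f g (PT2.map k H δ (Λ.toFun a b)) =
      bracketForm (canonicalForm k H L) μ (LinearMap.inr H L (PDual k H L) f)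
        (LinearMap.inr H L (PDual k H L) g) (LinearMap.inl H L (PDual k H L) a)
        (LinearMap.inl H L (PDual k H L) b) := by
    have h2 : bracketForm (canonicalForm k H L) μ (LinearMap.inr H L (PDual k H L) f)
        (LinearMap.inr H L (PDual k H L) g) (LinearMap.inl H L (PDual k H L) a)
        (LinearMap.inl H L (PDual k H L) b) = pair (canonicalForm k H L)
          (inrMap k H L _ (M.toFun f g)) (inlMap k H L _ (Λ.toFun a b)) := by
      rw [bracketForm, h.left, h.right]; rfl
    rw [pairTensor_map_cobracket hδ, h2, pair_inr_inl]
  have h2 : ∀ f g a b, pairTensor f g (tensorAct Λ Λ a (toTensor δ b)) =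
      Scalar22.swapMiddle (mixedForm μ f g a b) -
        Scalar22.flipLeft (Scalar22.swapMiddle (mixedForm μ g f a b)) := by
    intro f g a b
    rw [h.pairTensor_tensorAct, hs, map_neg, map_neg, map_neg, map_neg, ← h.mixedForm_eq hδ,
      ← h.mixedForm_eq hδ, sub_eq_add_neg]
  rw [pair_jacobiator _ h.invariant, bracketForm_eq_add_comm g f a b,
    bracketForm_swap_left _ hμ (LinearMap.inr H L (PDual k H L) f) (LinearMap.inl H L _ a),
    bracketForm_eq_add_comm f g a b, map_sub (pairTensor f g), map_sub (pairTensor f g), h1,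
    pairTensor_flip, h2, h2]
  simp only [map_neg, map_add, map_sub, regroup_flipLeft_swapMiddle,
    regroup_flipRight_swapMiddle, regroup_flipRight_flipLeft_swapMiddle, regroup_swapMiddle]
  abel

variable {ι : Type*} [Fintype ι] {d : ι → PDual k H L} {c : ι → L}

/-- The cocycle condition for `δ` is the vanishing of `⟨J(f, g, a), b⟩` for `f, g ∈ L*` and
`a, b ∈ L`. -/
theorem IsDouble.cocycle_iff (hd : IsDualFamily (ev k H L) d c) (h : IsDouble Λ M μ)
    (hμ : ∀ r s, μ.toFun s r = -PT2.flip k H (μ.toFun r s)) (hδ : IsDual δ M)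
    (hs : ∀ a, TensorProduct.comm k L L (toTensor δ a) = -toTensor δ a) (a b : L) :
    tensorAct Λ Λ a (toTensor δ b) - PT2.flip k H (tensorAct Λ Λ b (toTensor δ a)) =
      PT2.map k H δ (Λ.toFun a b) ↔
    ∀ f g, pair (canonicalForm k H L) (Pseudo.jacobiator μ
      (LinearMap.inr H L (PDual k H L) f) (LinearMap.inr H L (PDual k H L) g)
      (LinearMap.inl H L (PDual k H L) a)) (pt k H (LinearMap.inl H L (PDual k H L) b)) = 0 := by
  simp only [h.pair_jacobiator_eq hμ hδ hs, neg_eq_zero]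
  rw [← sub_eq_zero]
  constructor
  · intro h0 f g
    rw [h0, map_zero, map_zero]
  · intro h0
    refine eq_zero_of_pairTensor hd fun f g => regroup_injective ?_
    rw [h0, map_zero]

end Cocycle

section Main

variable {k H : Type*} [Field k] [Ring H] [HopfAlgebra k H] [Coalgebra.IsCocomm k H]
  {L : Type*} [AddCommGroup L] [Module k L] [Module H L] [IsScalarTower k H L]
  {R : Type*} [AddCommGroup R] [Module k R] [Module H R] [IsScalarTower k H R]
  {R' : Type*} [AddCommGroup R'] [Module k R'] [Module H R'] [IsScalarTower k H R']

/-! ### The Manin triple of a Lie pseudo-bialgebra -/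

theorem IsDualFamily.finite {U V : Type*} [AddCommGroup U] [Module k U] [Module H U]
    [IsScalarTower k H U] [AddCommGroup V] [Module k V] [Module H V] [IsScalarTower k H V]
    {φ : Lin2 k H U V (Triv k H)} {ι : Type*} [Fintype ι] {d : ι → U} {c : ι → V}
    (hd : IsDualFamily φ d c) : Module.Finite H U :=
  Module.finite_def.2 (Submodule.fg_def.2 ⟨Set.range d, Set.finite_range d,
    eq_top_iff.2 fun u _ => by
      rw [← hd.left u]
      exact Submodule.sum_mem _ fun i _ =>
        Submodule.smul_mem _ _ (Submodule.subset_span ⟨i, rfl⟩)⟩)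

/-- The range of a homomorphism is a pseudosubalgebra. -/
theorem IsPseudoHom.isPseudosubalgebra_range {ν : Lin2 k H R R R} {μ : Lin2 k H R' R' R'}
    {g : R →ₗ[H] R'} (hg : IsPseudoHom ν μ g) : IsPseudosubalgebra μ (LinearMap.range g) := by
  rintro _ ⟨a, rfl⟩ _ ⟨b, rfl⟩
  refine ⟨PT2.map k H g.rangeRestrict (ν.toFun a b), ?_⟩
  rw [hg, PT2.map_map]
  rfl

variable {ι : Type*} [Fintype ι] {d : ι → PDual k H L} {c : ι → L}

/-- The Lie pseudoalgebra structure on `L*` that is dual to a Lie coalgebra structure on `L`. -/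
def LieCoalgebra.dual (hd : IsDualFamily (ev k H L) d c) (δ : LieCoalgebra k H L) :
    LiePseudoalgebra k H (PDual k H L) where
  bracket := dualBracket d c δ.cobracket
  skew := (IsDual.skew_iff hd (isDual_dualBracket hd δ.cobracket)).1 δ.skew
  jacobi := (IsDual.jacobi_iff hd (isDual_dualBracket hd δ.cobracket)).1 δ.cojacobi

theorem LieCoalgebra.isDual_dual (hd : IsDualFamily (ev k H L) d c) (δ : LieCoalgebra k H L) :
    IsDual δ.cobracket (δ.dual hd).bracket := isDual_dualBracket hd δ.cobracket

variable {Λ : LiePseudoalgebra k H L}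

theorem LiePseudoalgebra.jacobiator_eq_zero (Λ : LiePseudoalgebra k H L) (a b c : L) :
    jacobiator Λ.bracket a b c = 0 :=
  (jacobi_iff_jacobiator Λ.skew a b c).1 (Λ.jacobi a b c)

/-- The Lie pseudoalgebra structure on the double of a Lie pseudo-bialgebra. -/
def LiePseudoBialgebra.doubleLie (hd : IsDualFamily (ev k H L) d c)
    (δ : LiePseudoBialgebra Λ) : LiePseudoalgebra k H (L × PDual k H L) :=
  have hμ : ∀ r s, (doubleBracket Λ.bracket (δ.dual hd).bracket d c).toFun s r =
      -PT2.flip k H ((doubleBracket Λ.bracket (δ.dual hd).bracket d c).toFun r s) :=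
    hd.canonicalForm.cyclicBracket_skew (sumBracket_skew Λ.skew (δ.dual hd).skew)
  have h := isDouble_doubleBracket (Λ := Λ.bracket) (M := (δ.dual hd).bracket) hd
  { bracket := doubleBracket Λ.bracket (δ.dual hd).bracket d c
    skew := hμ
    jacobi := fun r s t => (jacobi_iff_jacobiator hμ r s t).2
      (h.jacobiator_eq_zero hd hμ Λ.jacobiator_eq_zero (δ.dual hd).jacobiator_eq_zero
        (fun f g a b => (h.cocycle_iff hd hμ (δ.isDual_dual hd) δ.skew a b).1
          (δ.cocycle a b) f g) r s t) }

theorem LiePseudoBialgebra.isDouble (hd : IsDualFamily (ev k H L) d c)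
    (δ : LiePseudoBialgebra Λ) :
    IsDouble Λ.bracket (δ.dual hd).bracket (δ.doubleLie hd).bracket :=
  isDouble_doubleBracket hd

/-- The pseudo Manin triple `(L ⊕ L*, L, L*)` of a Lie pseudo-bialgebra. -/
def LiePseudoBialgebra.double (hd : IsDualFamily (ev k H L) d c)
    (δ : LiePseudoBialgebra Λ) : ManinTripleOn Λ (L × PDual k H L) where
  lie := δ.doubleLie hd
  form := canonicalForm k H L
  R₁ := LinearMap.range (LinearMap.inl H L (PDual k H L))
  R₀ := LinearMap.range (LinearMap.inr H L (PDual k H L))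
  finite := hd.canonicalForm.finite
  symm := canonicalForm_symm
  invariant := (δ.isDouble hd).invariant
  nondegenerate := hd.canonicalForm.nondegenerate
  subalgebra₁ := (δ.isDouble hd).left.isPseudosubalgebra_range
  subalgebra₀ := (δ.isDouble hd).right.isPseudosubalgebra_range
  isCompl := LinearMap.isCompl_range_inl_inr
  isotropic₁ := by
    rintro _ ⟨a, rfl⟩ _ ⟨b, rfl⟩
    exact canonicalForm_inl_inl a b
  isotropic₀ := by
    rintro _ ⟨a, rfl⟩ _ ⟨b, rfl⟩
    exact canonicalForm_inr_inr a b
  incl := LinearMap.inl H L (PDual k H L)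
  incl_injective := LinearMap.inl_injective
  incl_range := rfl
  incl_hom := (δ.isDouble hd).left

theorem snd_map_inrMap (s : PT2 k H (PDual k H L)) :
    PT2.map k H (LinearMap.snd H L (PDual k H L)) (inrMap k H L (comul2 k H) s) = s := by
  refine (PT2.map_map _ _ s).trans ?_
  rw [LinearMap.snd_comp_inr, PT2.map_id]

/-- An isomorphism of the doubles of two Lie pseudo-bialgebra structures that is the identity
on `L` is the identity on `L*` as well, since it preserves `L*` and the form. Hence the doubles
determine the cobrackets. -/
theorem LiePseudoBialgebra.eq_of_maninIso (hd : IsDualFamily (ev k H L) d c)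
    {δ δ' : LiePseudoBialgebra Λ} (h : ManinIso (δ.double hd) (δ'.double hd)) : δ = δ' := by
  obtain ⟨e, h1, h2, h3, h4⟩ := h
  have hl : ∀ a, e (LinearMap.inl H L (PDual k H L) a) = LinearMap.inl H L (PDual k H L) a := h4
  have hr : ∀ f, e (LinearMap.inr H L (PDual k H L) f) = LinearMap.inr H L (PDual k H L) f := by
    intro f
    have h5 : e (LinearMap.inr H L (PDual k H L) f) ∈
        LinearMap.range (LinearMap.inr H L (PDual k H L)) := by
      have h6 : e (LinearMap.inr H L (PDual k H L) f) ∈ (δ.double hd).R₀.map e.toLinearMap :=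
        ⟨_, ⟨f, rfl⟩, rfl⟩
      rw [h3] at h6
      exact h6
    obtain ⟨g, hg⟩ := h5
    rw [← hg]
    congr 1
    refine Subtype.ext (LinearMap.ext fun a => ?_)
    have h6 := h2 (LinearMap.inr H L (PDual k H L) f) (LinearMap.inl H L (PDual k H L) a)
    rw [← hg, hl] at h6
    exact (canonicalForm_inr_inl g a).symm.trans (h6.trans (canonicalForm_inr_inl f a))
  have hM : (δ.dual hd).bracket = (δ'.dual hd).bracket := by
    apply Lin2.ext
    refine LinearMap.ext fun f => LinearMap.ext fun g => ?_
    have h5 := h1 (LinearMap.inr H L (PDual k H L) f) (LinearMap.inr H L (PDual k H L) g)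
    have h6 : e.toLinearMap ∘ₗ LinearMap.inr H L (PDual k H L) = LinearMap.inr H L (PDual k H L) :=
      LinearMap.ext hr
    have h7 : (δ.double hd).lie.bracket.toFun (LinearMap.inr H L (PDual k H L) f)
      (LinearMap.inr H L (PDual k H L) g) = _ := (δ.isDouble hd).right f g
    have h8 : (δ'.double hd).lie.bracket.toFun (LinearMap.inr H L (PDual k H L) f)
      (LinearMap.inr H L (PDual k H L) g) = _ := (δ'.isDouble hd).right f g
    rw [LinearEquiv.coe_coe, hr, hr, h7, h8, PT2.map_map, h6] at h5
    have h9 := congrArg (PT2.map k H (LinearMap.snd H L (PDual k H L))) h5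
    exact (snd_map_inrMap _).symm.trans (h9.symm.trans (snd_map_inrMap _))
  have hδ : δ.cobracket = δ'.cobracket := by
    refine IsDual.cobracket_unique hd (δ.isDual_dual hd) ?_
    rw [hM]
    exact δ'.isDual_dual hd
  exact LiePseudoBialgebra.ext hδ

/-! ### Every Manin triple is a double -/

namespace ManinTripleOn

variable (T : ManinTripleOn Λ R)

/-- The projection `R → L` along `R₀`. -/
theorem exists_proj : ∃ p : R →ₗ[H] L, (∀ a, p (T.incl a) = a) ∧ (∀ s ∈ T.R₀, p s = 0) ∧
    ∀ r, r - T.incl (p r) ∈ T.R₀ := by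
  have h : IsCompl (LinearMap.range T.incl) T.R₀ := by
    rw [T.incl_range]; exact T.isCompl
  refine ⟨LinearMap.linearProjOfIsCompl T.R₀ T.incl T.incl_injective h,
    LinearMap.linearProjOfIsCompl_apply_left _ _ _ _,
    LinearMap.linearProjOfIsCompl_apply_right' _ _ _ _, fun r => ?_⟩
  refine (LinearMap.ker_linearProjOfIsCompl T.R₀ T.incl T.incl_injective h).le
    (LinearMap.mem_ker.2 ?_)
  rw [map_sub, LinearMap.linearProjOfIsCompl_apply_left, sub_self]

theorem form_incl_incl (a b : L) : T.form.toFun (T.incl a) (T.incl b) = 0 := by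
  have h : ∀ a, T.incl a ∈ T.R₁ := fun a => by rw [← T.incl_range]; exact ⟨a, rfl⟩
  exact T.isotropic₁ _ (h a) _ (h b)

/-- The map `R → L*`, `r ↦ ⟨r, ·⟩`. -/
def toDual : R →ₗ[H] PDual k H L where
  toFun r := ⟨T.form.toFun r ∘ₗ T.incl.restrictScalars k, fun h a => by
    change T.form.toFun r (T.incl (h • a)) = _
    rw [map_smul, Lin2.smul_right]; rfl⟩
  map_add' r s := Subtype.ext (LinearMap.ext fun a => by
    change T.form.toFun (r + s) (T.incl a) = _
    rw [map_add]; rfl)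
  map_smul' h r := Subtype.ext (LinearMap.ext fun a => Lin2.smul_left T.form h r _)

theorem toDual_apply (r : R) (a : L) : (T.toDual r).1 a = T.form.toFun r (T.incl a) := rfl

theorem toDual_incl (a : L) : T.toDual (T.incl a) = 0 :=
  Subtype.ext (LinearMap.ext fun b => T.form_incl_incl a b)

theorem eq_zero_of_form {r : R} (h : ∀ s, T.form.toFun r s = 0) : r = 0 :=
  T.nondegenerate.1 (Subtype.ext (LinearMap.ext fun s => by
    change T.form.toFun r s = T.form.toFun 0 s
    rw [h, map_zero, LinearMap.zero_apply]))

/-- A pseudo Manin triple is isomorphic to `(L ⊕ L*, L, L*)` with the canonical form, as an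
`H`-module with a form. -/
theorem exists_equiv : ∃ e : R ≃ₗ[H] L × PDual k H L,
    (∀ r s, (canonicalForm k H L).toFun (e r) (e s) = T.form.toFun r s) ∧
    T.R₀.map e.toLinearMap = LinearMap.range (LinearMap.inr H L (PDual k H L)) ∧
    ∀ a, e (T.incl a) = LinearMap.inl H L (PDual k H L) a := by
  obtain ⟨p, hp1, hp2, hp3⟩ := T.exists_proj
  -- As `L` and `R₀` are isotropic, the form is determined by the pairing of `R` with `L`.
  have hform : ∀ r s, T.form.toFun r s =
      T.form.toFun r (T.incl (p s)) + PT2.flip k H (T.form.toFun s (T.incl (p r))) := by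
    intro r s
    have h1 : T.form.toFun (r - T.incl (p r)) (s - T.incl (p s)) = 0 :=
      T.isotropic₀ _ (hp3 r) _ (hp3 s)
    simp only [map_sub, LinearMap.sub_apply, T.form_incl_incl, sub_zero] at h1
    rw [← T.symm, ← sub_eq_zero, ← h1]
    abel
  have hinj : Function.Injective (p.prod T.toDual) := by
    rw [← LinearMap.ker_eq_bot, LinearMap.ker_eq_bot']
    intro r hr
    have h1 : p r = 0 := congrArg Prod.fst hr
    have h2 : T.toDual r = 0 := congrArg Prod.snd hr
    refine T.eq_zero_of_form fun s => ?_
    rw [hform, h1, map_zero, map_zero, map_zero, add_zero, ← toDual_apply, h2]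
    rfl
  -- The element of `R` that represents `f ∘ p` is in `R₀`, since `f ∘ p` vanishes on `R₀`.
  have hmem : ∀ f : PDual k H L, ∃ r ∈ T.R₀, T.toDual r = f := by
    intro f
    obtain ⟨r, hr⟩ := T.nondegenerate.2 ⟨f.1 ∘ₗ p.restrictScalars k, fun h s => by
      change f.1 (p (h • s)) = _
      rw [map_smul, f.2]; rfl⟩
    have h1 : ∀ s, T.form.toFun r s = f.1 (p s) := fun s =>
      LinearMap.congr_fun (congrArg Subtype.val hr) s
    have h2 : T.incl (p r) = 0 := by
      refine T.eq_zero_of_form fun s => ?_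
      rw [T.symm]
      have h3 := hform r s
      rw [h1, h1, hp1, left_eq_add] at h3
      exact h3
    refine ⟨r, ?_, Subtype.ext (LinearMap.ext fun a => ?_)⟩
    · have h3 := hp3 r
      rwa [h2, sub_zero] at h3
    · rw [toDual_apply, h1, hp1]
  have hsurj : Function.Surjective (p.prod T.toDual) := by
    rintro ⟨a, f⟩
    obtain ⟨r, hr, rfl⟩ := hmem f
    refine ⟨T.incl a + r, Prod.ext ?_ ?_⟩
    · change p (T.incl a + r) = a
      rw [map_add, hp1, hp2 r hr, add_zero]
    · change T.toDual (T.incl a + r) = _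
      rw [map_add, T.toDual_incl, zero_add]
  refine ⟨LinearEquiv.ofBijective (p.prod T.toDual) ⟨hinj, hsurj⟩, fun r s => (hform r s).symm,
    ?_, fun a => Prod.ext (hp1 a) (T.toDual_incl a)⟩
  ext x
  constructor
  · rintro ⟨r, hr, rfl⟩
    exact ⟨T.toDual r, Prod.ext (hp2 r hr).symm rfl⟩
  · rintro ⟨f, rfl⟩
    obtain ⟨r, hr, rfl⟩ := hmem f
    exact ⟨r, hr, Prod.ext (hp2 r hr) rfl⟩

end ManinTripleOn

/-- Transport of a pseudobracket along an isomorphism. -/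
def Lin2.transport (μ : Lin2 k H R R R) (e : R ≃ₗ[H] R') : Lin2 k H R' R' R' where
  toFun := (μ.toFun.compl₁₂ (e.symm.toLinearMap.restrictScalars k)
    (e.symm.toLinearMap.restrictScalars k)).compr₂ (PT2.map k H e.toLinearMap)
  map_smul' f g r s := by
    change PT2.map k H e.toLinearMap (μ.toFun (e.symm (f • r)) (e.symm (g • s))) =
      (f ⊗ₜ[k] g : H2 k H) • PT2.map k H e.toLinearMap (μ.toFun (e.symm r) (e.symm s))
    rw [map_smul e.symm, map_smul e.symm, μ.map_smul', PT2.map, BaseTensor.map_smul]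
    rfl

theorem Lin2.isPseudoHom_transport (μ : Lin2 k H R R R) (e : R ≃ₗ[H] R') :
    IsPseudoHom μ (μ.transport e) e.toLinearMap := fun a b => by
  change PT2.map k H e.toLinearMap (μ.toFun (e.symm (e a)) (e.symm (e b))) = _
  rw [e.symm_apply_apply, e.symm_apply_apply]


theorem PT2.map_injective {g : R →ₗ[H] R'} {g' : R' →ₗ[H] R} (h : g' ∘ₗ g = LinearMap.id) :
    Function.Injective (PT2.map k H g) :=
  Function.LeftInverse.injective (g := PT2.map k H g') fun s => by
    rw [PT2.map_map, h, PT2.map_id]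

theorem PT3.map_injective {g : R →ₗ[H] R'} {g' : R' →ₗ[H] R} (h : g' ∘ₗ g = LinearMap.id) :
    Function.Injective (PT3.map (k := k) g) :=
  Function.LeftInverse.injective (g := PT3.map g') fun s => by
    rw [PT3.map, PT3.map, BaseTensor.map_map]
    simp only [h]
    exact BaseTensor.map_id _ s

section Hom

variable {ν : Lin2 k H R R R} {μ : Lin2 k H R' R' R'} {g : R →ₗ[H] R'} {g' : R' →ₗ[H] R}

/-- Skew-symmetry is inherited along a split injective homomorphism. -/
theorem IsPseudoHom.skew_of_split (hg : IsPseudoHom ν μ g) (h : g' ∘ₗ g = LinearMap.id)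
    (hμ : ∀ r s, μ.toFun s r = -PT2.flip k H (μ.toFun r s)) (r s : R) :
    ν.toFun s r = -PT2.flip k H (ν.toFun r s) := by
  apply PT2.map_injective h
  rw [← hg, hμ, hg, map_neg, PT2.flip_map]

/-- The Jacobi identity is inherited along a split injective homomorphism. -/
theorem IsPseudoHom.jacobiator_of_split (hg : IsPseudoHom ν μ g) (h : g' ∘ₗ g = LinearMap.id)
    (hμ : ∀ r s t, Pseudo.jacobiator μ r s t = 0) (r s t : R) :
    Pseudo.jacobiator ν r s t = 0 := by
  apply PT3.map_injective (k := k) h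
  rw [← hg.jacobiator, hμ, map_zero]

end Hom

theorem Lin2.transport_skew {μ : Lin2 k H R R R}
    (hμ : ∀ r s, μ.toFun s r = -PT2.flip k H (μ.toFun r s)) (e : R ≃ₗ[H] R') (r s : R') :
    (μ.transport e).toFun s r = -PT2.flip k H ((μ.transport e).toFun r s) := by
  change PT2.map k H e.toLinearMap (μ.toFun (e.symm s) (e.symm r)) =
    -PT2.flip k H (PT2.map k H e.toLinearMap (μ.toFun (e.symm r) (e.symm s)))
  rw [hμ, map_neg, PT2.flip_map]

theorem Lin2.jacobiator_transport {μ : Lin2 k H R R R} (hμ : ∀ r s t, jacobiator μ r s t = 0)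
    (e : R ≃ₗ[H] R') (r s t : R') : jacobiator (μ.transport e) r s t = 0 := by
  have h := (μ.isPseudoHom_transport e).jacobiator (e.symm r) (e.symm s) (e.symm t)
  simp only [LinearEquiv.coe_coe, LinearEquiv.apply_symm_apply] at h
  rw [h, hμ, map_zero]

theorem Lin2.isInvariantForm_transport {μ : Lin2 k H R R R} {B : Lin2 k H R R (Triv k H)}
    {B' : Lin2 k H R' R' (Triv k H)} (e : R ≃ₗ[H] R') (hB : IsSymmForm B) (hB' : IsSymmForm B')
    (h : ∀ r s, B'.toFun (e r) (e s) = B.toFun r s) (hμ : IsInvariantForm μ B) :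
    IsInvariantForm (μ.transport e) B' := by
  have h1 : ∀ s r, B'.compLeft (PT2.map k H e.toLinearMap s) (e r) = B.compLeft s r := by
    intro s r
    induction s using BaseTensor.induction with
    | h0 =>
      rw [map_zero]
      exact (map_zero (compLeftₗ B' (e r))).trans (map_zero (compLeftₗ B r)).symm
    | ha s t hs ht => rw [map_add, compLeft_add, compLeft_add, hs, ht]
    | ht x u =>
      have h2 : PT2.map k H e.toLinearMap (BaseTensor.tmul _ x u) = BaseTensor.tmul _ x (e u) :=
        BaseTensor.map_tmul _ _ _ _ _ _
      rw [h2, Lin2.compLeft_tmul, Lin2.compLeft_tmul, h]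
  rw [hB'.invariant_iff]
  rw [hB.invariant_iff] at hμ
  intro a b c
  have h2 := h1 (μ.toFun (e.symm a) (e.symm b)) (e.symm c)
  have h3 := h1 (μ.toFun (e.symm b) (e.symm c)) (e.symm a)
  rw [e.apply_symm_apply] at h2 h3
  exact h2.trans ((hμ _ _ _).trans (congrArg _ h3.symm))

/-- The bracket of a pseudo Manin triple, transported to `L ⊕ L*`, is a double. -/
theorem ManinTripleOn.exists_isDouble (T : ManinTripleOn Λ R) :
    ∃ (e : R ≃ₗ[H] L × PDual k H L)
      (M : Lin2 k H (PDual k H L) (PDual k H L) (PDual k H L)),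
      IsDouble Λ.bracket M (T.lie.bracket.transport e) ∧
      (∀ r s, (canonicalForm k H L).toFun (e r) (e s) = T.form.toFun r s) ∧
      T.R₀.map e.toLinearMap = LinearMap.range (LinearMap.inr H L (PDual k H L)) ∧
      ∀ a, e (T.incl a) = LinearMap.inl H L (PDual k H L) a := by
  obtain ⟨e, h1, h2, h3⟩ := T.exists_equiv
  let μ := T.lie.bracket.transport e
  have he := T.lie.bracket.isPseudoHom_transport e
  let M : Lin2 k H (PDual k H L) (PDual k H L) (PDual k H L) :=
    { toFun := (μ.toFun.compl₁₂ (LinearMap.inr k L (PDual k H L))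
        (LinearMap.inr k L (PDual k H L))).compr₂ (PT2.map k H (LinearMap.snd H L (PDual k H L)))
      map_smul' := fun f g φ ψ => by
        change PT2.map k H _ (μ.toFun (LinearMap.inr H L (PDual k H L) (f • φ))
          (LinearMap.inr H L (PDual k H L) (g • ψ))) = (f ⊗ₜ[k] g : H2 k H) • PT2.map k H _
            (μ.toFun (LinearMap.inr H L (PDual k H L) φ) (LinearMap.inr H L (PDual k H L) ψ))
        rw [map_smul (LinearMap.inr H L (PDual k H L)), map_smul (LinearMap.inr H L (PDual k H L)),
          μ.map_smul', PT2.map, BaseTensor.map_smul]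
        rfl }
  refine ⟨e, M, ⟨fun a b => ?_, fun f g => ?_,
    Lin2.isInvariantForm_transport e T.symm canonicalForm_symm h1 T.invariant⟩, h1, h2, h3⟩
  · have h4 := he (T.incl a) (T.incl b)
    rw [LinearEquiv.coe_coe, h3, h3, T.incl_hom, PT2.map_map] at h4
    rw [h4]
    congr 2
    exact LinearMap.ext h3
  · have h4 : ∀ f, ∃ r ∈ T.R₀, e r = LinearMap.inr H L (PDual k H L) f := fun f => by
      have h5 : LinearMap.inr H L (PDual k H L) f ∈ T.R₀.map e.toLinearMap := by
        rw [h2]; exact ⟨f, rfl⟩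
      exact h5
    obtain ⟨r, hr, hrf⟩ := h4 f
    obtain ⟨s, hs, hsg⟩ := h4 g
    obtain ⟨x, hx⟩ := T.subalgebra₀ r hr s hs
    have h5 := he r s
    rw [LinearEquiv.coe_coe, hrf, hsg, ← hx, PT2.map_map] at h5
    have h6 : LinearMap.inr H L (PDual k H L) ∘ₗ LinearMap.snd H L (PDual k H L) ∘ₗ
        e.toLinearMap ∘ₗ T.R₀.subtype = e.toLinearMap ∘ₗ T.R₀.subtype := by
      refine LinearMap.ext fun r => ?_
      have h7 : e r ∈ LinearMap.range (LinearMap.inr H L (PDual k H L)) := by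
        rw [← h2]; exact ⟨r, r.2, rfl⟩
      obtain ⟨φ, hφ⟩ := h7
      change LinearMap.inr H L (PDual k H L) (e r).2 = e r
      rw [← hφ]; rfl
    have h7 : M.toFun f g = PT2.map k H (LinearMap.snd H L (PDual k H L))
      (μ.toFun (LinearMap.inr H L (PDual k H L) f) (LinearMap.inr H L (PDual k H L) g)) := rfl
    rw [h7, h5, PT2.map_map, PT2.map_map, LinearMap.comp_assoc, h6]

/-- Every pseudo Manin triple is isomorphic to the double of a Lie pseudo-bialgebra: the cobracket
is dual to the bracket of `R₀ ≅ L*`, and the cocycle condition is part of the Jacobi identity. -/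
theorem ManinTripleOn.exists_maninIso (hd : IsDualFamily (ev k H L) d c) (T : ManinTripleOn Λ R) :
    ∃ δ : LiePseudoBialgebra Λ, ManinIso (δ.double hd) T := by
  obtain ⟨e, M, h, h1, h2, h3⟩ := T.exists_isDouble
  have hμ := Lin2.transport_skew T.lie.skew e
  have hJ := Lin2.jacobiator_transport T.lie.jacobiator_eq_zero e
  have hsplit : LinearMap.snd H L (PDual k H L) ∘ₗ LinearMap.inr H L (PDual k H L) =
    LinearMap.id := LinearMap.snd_comp_inr _ _ _
  have hM := h.right.skew_of_split hsplit hμ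
  have hMJ := h.right.jacobiator_of_split hsplit hJ
  have hdual := isDual_dualCobracket hd M
  have hs := (hdual.skew_iff hd).2 hM
  let δ : LiePseudoBialgebra Λ :=
    { cobracket := dualCobracket d c M
      skew := hs
      cojacobi := (hdual.jacobi_iff hd).2 fun f g l => (jacobi_iff_jacobiator hM f g l).2 (hMJ f g l)
      cocycle := fun a b => (h.cocycle_iff hd hμ hdual hs a b).2 fun f g => by
        rw [hJ, map_zero, LinearMap.zero_apply] }
  have h4 : (δ.dual hd).bracket = M := IsDual.bracket_unique hd (δ.isDual_dual hd) hdual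
  have h5 : (δ.doubleLie hd).bracket = T.lie.bracket.transport e := by
    have h6 := δ.isDouble hd
    rw [h4] at h6
    exact h6.unique hd h
  refine ⟨δ, ManinIso.symm ⟨e, ?_, h1, h2, h3⟩⟩
  change IsPseudoHom T.lie.bracket (δ.doubleLie hd).bracket e.toLinearMap
  rw [h5]
  exact T.lie.bracket.isPseudoHom_transport e

theorem ManinTripleOn.existsUnique_maninIso (hd : IsDualFamily (ev k H L) d c)
    (T : ManinTripleOn Λ R) : ∃! δ : LiePseudoBialgebra Λ, ManinIso (δ.double hd) T := by
  obtain ⟨δ, h⟩ := T.exists_maninIso hd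
  exact ⟨δ, h, fun δ' h' => LiePseudoBialgebra.eq_of_maninIso hd (h'.trans h.symm)⟩

theorem exists_isDualFamily [Module.Free H L] [Module.Finite H L] :
    ∃ (n : ℕ) (d : Fin n → PDual k H L) (c : Fin n → L), IsDualFamily (ev k H L) d c :=
  ⟨_, _, _, isDualFamily_dual (dualBasis_apply
    ((Module.Free.chooseBasis H L).reindex (Fintype.equivFin _)))⟩

end Main

end

end Pseudo

theorem mainTheorem3 {k : Type*} {H : Type*} {L : Type*}
    [Field k] [IsAlgClosed k] [CharZero k]
    [Ring H] [HopfAlgebra k H] [Coalgebra.IsCocomm k H]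
    [AddCommGroup L] [Module k L] [Module H L] [IsScalarTower k H L]
    [Module.Free H L] [Module.Finite H L] (Λ : Pseudo.LiePseudoalgebra k H L) :
    ∃ D : Pseudo.LiePseudoBialgebra Λ → Pseudo.ManinTripleOn Λ (L × Pseudo.PDual k H L),
      -- `D δ` is `(L ⊕ L*, L, L*)` with the canonical form, the bracket dual to `δ` on `L*`,
      -- and the unique bracket that these data and invariance allow
      (∀ δ : Pseudo.LiePseudoBialgebra Λ,
        (D δ).form = Pseudo.canonicalForm k H L ∧
        (D δ).incl = LinearMap.inl H L (Pseudo.PDual k H L) ∧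
        (D δ).R₀ = LinearMap.range (LinearMap.inr H L (Pseudo.PDual k H L)) ∧
        ∃ M : Pseudo.LiePseudoalgebra k H (Pseudo.PDual k H L),
          (∀ M', Pseudo.IsDualBracket δ.toLieCoalgebra M' ↔ M' = M) ∧
          Pseudo.IsPseudoHom M.bracket (D δ).lie.bracket
            (LinearMap.inr H L (Pseudo.PDual k H L)) ∧
          ∀ μ : Pseudo.Lin2 k H (L × Pseudo.PDual k H L) (L × Pseudo.PDual k H L)
              (L × Pseudo.PDual k H L),
            (∀ a b, μ.toFun b a = -Pseudo.PT2.flip k H (μ.toFun a b)) →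
            Pseudo.IsPseudoHom Λ.bracket μ (LinearMap.inl H L (Pseudo.PDual k H L)) →
            Pseudo.IsPseudoHom M.bracket μ (LinearMap.inr H L (Pseudo.PDual k H L)) →
            Pseudo.IsInvariantForm μ (Pseudo.canonicalForm k H L) →
            μ = (D δ).lie.bracket) ∧
      -- one-to-one correspondence with the isomorphism classes of pseudo Manin triples
      Function.Bijective (fun δ : Pseudo.LiePseudoBialgebra Λ =>
        (Quotient.mk (Pseudo.maninSetoid Λ) ⟨L × Pseudo.PDual k H L, D δ⟩)) ∧
      -- the same for triples that live in any universe
      ∀ (R : Type*) [AddCommGroup R] [Module k R] [Module H R] [IsScalarTower k H R]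
        (T : Pseudo.ManinTripleOn Λ R),
        ∃! δ : Pseudo.LiePseudoBialgebra Λ, Pseudo.ManinIso (D δ) T := by
  obtain ⟨n, d, c, hd⟩ := Pseudo.exists_isDualFamily (k := k) (H := H) (L := L)
  refine ⟨fun δ => δ.double hd, fun δ => ⟨rfl, rfl, rfl, δ.dual hd, fun M' => ?_,
    (δ.isDouble hd).right, fun μ _ hl hr hinv => ?_⟩, ⟨fun δ δ' h => ?_, fun T => ?_⟩, ?_⟩
  · rw [Pseudo.isDualBracket_iff]
    constructor
    · intro h
      exact Pseudo.LiePseudoalgebra.ext (h.bracket_unique hd (δ.isDual_dual hd))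
    · rintro rfl
      exact δ.isDual_dual hd
  · exact Pseudo.IsDouble.unique hd ⟨hl, hr, hinv⟩ (δ.isDouble hd)
  · exact Pseudo.LiePseudoBialgebra.eq_of_maninIso hd (Quotient.exact h)
  · induction T using Quotient.ind with
    | _ T =>
      obtain ⟨δ, h⟩ := T.triple.exists_maninIso hd
      exact ⟨δ, Quotient.sound h⟩
  · intro R _ _ _ _ T
    exact T.existsUnique_maninIso hd
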